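/- **Setting.** Let $\sigma\ge\frac12$, $\beta\in\mathbb R$ (focusing case: $\beta>0$), $\lambda>0$. Let $G_\lambda(\mathbf x)=\frac1{2\pi}K_0(\sqrt\lambda|\mathbf x|)$ on $\mathbb R^2$, where $K_0$ is the MacDonald function of order zero, and $$V=\{\chi\in L^2(\mathbb R^2):\ \chi=\chi_\lambda+q_\chi G_\lambda,\ \chi_\lambda\in H^1(\mathbb R^2),\ q_\chi\in\mathbb C\}.$$ Put $\theta_\lambda(s)=\frac1{2\pi}\log\frac{\sqrt\lambda}2+\frac{\gamma}{2\pi}-\beta s^{2\sigma}$ with $\gamma$ the Euler–Mascheroni constant, let $\langle\cdot,\cdot\rangle$ be the $L^2$ product, antilinear in the first entry, and $\widehat f(\mathbf k)=\frac1{2\pi}\int_{\mathbb R^2}e^{-i\mathbf x\cdot\mathbf k}f(\mathbf x)\,d\mathbf x$ the unitary Fourier transform. Let $\psi_0=\phi_{\lambda,0}+q(0)G_\lambda\in V$ with $\phi_{\lambda,0}\in\mathcal S(\mathbb R^2)$. Let $T_*\in(0,\infty]$ and let $\psi_t=\phi_{\lambda,t}+q(t)G_\lambda\in V$, $t\in[0,T_*)$,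 be a solution, with $q$ continuous on $[0,T_*)$, of the Cauchy problem $$i\tfrac{d}{dt}\langle\chi,\psi_t\rangle=\langle\nabla\chi_\lambda,\nabla\phi_{\lambda,t}\rangle+\lambda\langle\chi_\lambda,\phi_{\lambda,t}\rangle-\lambda\langle\chi,\psi_t\rangle+\theta_\lambda(|q(t)|)\,q_\chi^*\,q(t)\qquad\forall\chi\in V,\ t\in[0,T_*),$$ with $\psi_{t=0}=\psi_0$ (for instance, $T_*$ is the maximal existence time). Set $\mathcal M(t)=\int_{\mathbb R^2}|\mathbf x|^2|\psi_t(\mathbf x)|^2\,d\mathbf x$. **Proposition.** $\mathcal M(t)$ is finite for every $t\in[0,T_*)$, and $\mathcal M$ is absolutely continuous on $[0,T]$ for every $0\le T<T_*$. For every $t\in(0,T_*)$ the weak gradient $\nabla_{\mathbf k}\widehat\psi_t$ exists and lies in $L^2(\mathbb R^2)$, and $\mathcal M$ is differentiable at $t$ with $$\dot{\mathcal M}(t)=4\,\mathrm{Im}\int_{\mathbb R^2}\widehat\psi_t(\mathbf k)\ \mathbf k\cdot\nabla_{\mathbf k}\widehat\psi_t^*(\mathbf k)\,d\mathbf k,$$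 where the integral is the improper one, $\lim_{R\to\infty}\int_{|\mathbf k|\le R}$, and this limit exists in $\mathbb C$. -/

import Mathlib

open MeasureTheory Filter Topology
open scoped FourierTransform SchwartzMap LineDeriv

noncomputable section

namespace PointNLS

/-- The Euclidean plane. -/
abbrev Plane : Type := EuclideanSpace ℝ (Fin 2)

/-- `L²(ℝ²; ℂ)`.  Its inner product is antilinear in the first entry. -/
abbrev L2 : Type := Lp (α := Plane) ℂ 2 (volume : Measure Plane)

/-- `j`-th vector of the canonical basis of the plane. -/
def basisVec (j : Fin 2) : Plane := EuclideanSpace.single j 1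

/-- `g = (g 0, g 1)` is the weak (distributional) gradient of `f`, both being in `L²`. -/
def IsWeakGradient (f : L2) (g : Fin 2 → L2) : Prop :=
  ∀ j : Fin 2, ∂_{basisVec j} (f : 𝓢'(Plane, ℂ)) = (g j : 𝓢'(Plane, ℂ))

/-- The Sobolev space `H¹(ℝ²)`: an `L²` function together with its weak gradient in `L²`. -/
structure H1 where
  toL2 : L2
  grad : Fin 2 → L2
  isWeakGradient : IsWeakGradient toL2 grad

/-- MacDonald function of order zero, `K₀(r) = ∫₀^∞ exp (-r cosh s) ds` for `r > 0`. -/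
def macdonaldK0 (r : ℝ) : ℝ :=
  ∫ s in Set.Ioi (0 : ℝ), Real.exp (-(r * Real.cosh s))

/-- Green function `G_lam` of `-Δ + lam` on the plane. -/
def green (lam : ℝ) (x : Plane) : ℝ :=
  (2 * Real.pi)⁻¹ * macdonaldK0 (Real.sqrt lam * ‖x‖)

/-- The space `V`: the functions `χ = χ_lam + q_χ G_lam` in `L²` with `χ_lam ∈ H¹` (the regular
part) and `q_χ ∈ ℂ` (the charge). -/
structure FormDomain (lam : ℝ) where
  toL2 : L2
  reg : H1
  charge : ℂ
  decomp : ∀ᵐ x : Plane, toL2 x = reg.toL2 x + charge * (green lam x : ℂ)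

/-- `θ_lam(s) = (1/2π) log (√lam / 2) + γ/(2π) - β s^{2σ}`. -/
def theta (β σ lam s : ℝ) : ℝ :=
  (2 * Real.pi)⁻¹ * Real.log (Real.sqrt lam / 2)
    + Real.eulerMascheroniConstant / (2 * Real.pi) - β * s ^ (2 * σ)

/-- Right-hand side of the weak equation, tested with `χ`:
`⟨∇χ_lam, ∇φ_lam⟩ + lam ⟨χ_lam, φ_lam⟩ - lam ⟨χ, ψ⟩ + θ_lam(|q|) q_χ^* q`. -/
def weakForm (β σ : ℝ) {lam : ℝ} (χ ψ : FormDomain lam) : ℂ :=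
  (∑ j : Fin 2, inner ℂ (χ.reg.grad j) (ψ.reg.grad j))
    + (lam : ℂ) * inner ℂ χ.reg.toL2 ψ.reg.toL2
    - (lam : ℂ) * inner ℂ χ.toL2 ψ.toL2
    + (theta β σ lam ‖ψ.charge‖ : ℂ) * (starRingEnd ℂ χ.charge) * ψ.charge

/-- The time interval `[0, Tstar)`, where `Tstar` may be `∞`. -/
def timeInterval (Tstar : EReal) : Set ℝ := {t : ℝ | 0 ≤ t ∧ (t : EReal) < Tstar}

/-- `ψ` solves, on `[0, Tstar)` and with values in `V`, the weak Cauchy problem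
`i d/dt ⟨χ, ψ_t⟩ = weakForm χ ψ_t` for all `χ ∈ V`, `ψ_{t=0} = ψ₀`, and its charge `q` is
continuous.  The derivative at `t = 0` is one-sided. -/
structure IsSolution (β σ : ℝ) {lam : ℝ} (Tstar : EReal) (ψ₀ : FormDomain lam)
    (ψ : ℝ → FormDomain lam) : Prop where
  continuousOn_charge : ContinuousOn (fun t => (ψ t).charge) (timeInterval Tstar)
  weak_eq : ∀ χ : FormDomain lam, ∀ t ∈ timeInterval Tstar, ∃ d : ℂ,
    HasDerivWithinAt (fun s => (inner ℂ χ.toL2 (ψ s).toL2 : ℂ)) d (timeInterval Tstar) t ∧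
      Complex.I * d = weakForm β σ χ (ψ t)
  initial : (ψ 0).toL2 = ψ₀.toL2

/-- The initial data of the space `𝒟_𝒮`: the regular part is a Schwartz function.  (Then
`(1 + |k|^ε)` times the Fourier transform of the regular part is automatically integrable.) -/
def IsSchwartzDatum {lam : ℝ} (ψ₀ : FormDomain lam) : Prop :=
  ∃ f : 𝓢(Plane, ℂ), ∀ᵐ x : Plane, ψ₀.reg.toL2 x = f x

theorem memLp_dilation (f : L2) :
    MemLp (fun k : Plane => ((2 * Real.pi : ℝ) : ℂ)⁻¹ * f ((2 * Real.pi)⁻¹ • k)) 2 volume := by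
  have hc : (2 * Real.pi)⁻¹ ≠ 0 := by positivity
  have h1 : MemLp (fun k : Plane => f ((2 * Real.pi)⁻¹ • k)) 2 volume := by
    have hmap := Measure.map_addHaar_smul (volume : Measure Plane) hc
    have hm : AEMeasurable (fun k : Plane => (2 * Real.pi)⁻¹ • k) volume :=
      (measurable_const_smul _).aemeasurable
    have h2 : MemLp f 2 (Measure.map (fun k : Plane => (2 * Real.pi)⁻¹ • k) volume) := by
      rw [hmap]
      exact (Lp.memLp f).smul_measure ENNReal.ofReal_ne_top
    exact h2.comp_of_map hm
  exact h1.const_mul _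

/-- The unitary Fourier transform on `L²(ℝ²)` with the convention
`ψ̂(k) = (1/2π) ∫ e^{-i x·k} ψ(x) dx`; Mathlib's `𝓕` has the kernel `e^{-2πi x·ξ}`, whence the
dilation. -/
def fourierHat (f : L2) : L2 := (memLp_dilation (𝓕 f)).toLp _

/-- The moment of inertia `∫ |x|² |f(x)|² dx`. -/
def momentOfInertia (f : L2) : ℝ := ∫ x : Plane, ‖x‖ ^ 2 * ‖f x‖ ^ 2

/-- `∫_{|k| ≤ R} F(k) k·(g(k))^* dk` for a scalar `F` and a vector field `g`. -/
def truncatedPairing (F : L2) (g : Fin 2 → L2) (R : ℝ) : ℂ :=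
  ∫ k in Metric.closedBall (0 : Plane) R,
    F k * ∑ j : Fin 2, ((k j : ℝ) : ℂ) * (starRingEnd ℂ) (g j k)

end PointNLS

end

/-!
In the Fourier variable `u = |k|²` the weak equation, tested with band-limited functions without
charge, is linear in `ψ̂_t` with the source `-q(t)`: as `(|k|² + lam) Ĝ_lam = 1`, neither `lam` nor
the nonlinearity `theta` survives.  This gives Duhamel's formula (`duhamel`)
`ψ̂_t = e^{-iut} (ψ̂_0 + (i/2π) ∫_0^t e^{ius} q(s) ds)`, and the only properties of `q` that matter
are its continuity and the membership `ψ_t ∈ V`.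

Extend `q` from `[0, T]` to a continuous function `f` supported in `[-1, T + 1]`.  On the left, the
extension `q(0) e^{i lam s} η(s)` with a smooth cut-off `η` cancels the slowly decaying Fourier
transform of `q(0) G_lam`, so that (`exists_profile`)
`ψ̂_t = e^{-iut} (n(k) + (i/2π) F_t(u))`, `F_t(u) = ∫_{-1}^t e^{ius} f(s) ds`,
with a rapidly decaying `n`.  Hence
`∇ψ̂_t = e^{-iut} (∇n - 2itk n + (k/π) P_t(u))`, `P_t(u) = ∫_{-1}^t (t - s) e^{ius} f(s) ds`,
and by Plancherel's theorem `𝓜(t) = ∫ |∇ψ̂_t|²`.  Every term that contains `n` is harmless.  What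
remains is `(1/π) ∫_0^∞ u |P_t(u)|² du`; as `∂_t P_t = F_t`, its formal derivative is
`(2/π) Re ∫_0^∞ u F_t conj(P_t) du`, and this integral does not converge absolutely.

Two facts rescue it, and both use that the regular parts are in `H¹`, which says that
`F_t(u) + i q(t) e^{iut} / (u + lam)` is square integrable with weight `u`.  At the final time `T`
it implies that the Fourier transform of `f` over `[-1, T + 1]` has a finite half-derivative,
`∫_0^∞ u |f̂|² du < ∞`.  Insert a factor `e^{-εu}` and write `F_t` as `f̂` minus the integral over
`[t, T + 1]`.  The pairing of `P_t` with `f̂` is controlled by the energy and by `∫ u |f̂|²`; the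
pairing of `(t - s) f(s)`, `s < t`, with `f(s')`, `s' > t`, is the double integral of
`(t - s) f(s) conj(f(s'))` against a kernel of size `|s - s'|⁻²`, hence bounded and convergent as
`ε → 0`.  Grönwall's inequality bounds the energies with cutoff, both pairings converge uniformly
in `t`, and the energy is differentiable with a bounded derivative `2 ℓ(t)`, where `ℓ(t)` is the
limit of the pairings with cutoff (`exists_hasDerivAt_rampEnergy`).  At time `t` the same fact,
together with the Riemann-Lebesgue lemma, shows that the improper integral
`∫_0^∞ u F_t conj(P_t) du` exists (`exists_tendsto_intervalIntegral_pairing`); Abel's theorem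
identifies its real part with `ℓ(t)`.
-/

noncomputable section

namespace PointNLS

/-! ### Oscillatory integrals over an interval -/

/-- `∫_a^b e^{ius} g(s) ds`, the Fourier transform at frequency `u` of `g` cut off to `[a, b]`. -/
def oscInt (g : ℝ → ℂ) (a b u : ℝ) : ℂ :=
  ∫ s in a..b, Complex.exp (Complex.I * u * s) * g s

lemma norm_exp_I_mul_mul (u s : ℝ) : ‖Complex.exp (Complex.I * u * s)‖ = 1 := by
  rw [show Complex.I * u * s = ((u * s : ℝ) : ℂ) * Complex.I by push_cast; ring]
  exact Complex.norm_exp_ofReal_mul_I _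

lemma continuous_oscInt_integrand {g : ℝ → ℂ} (hg : Continuous g) (u : ℝ) :
    Continuous fun s : ℝ => Complex.exp (Complex.I * u * s) * g s := by fun_prop

lemma intervalIntegrable_oscInt {g : ℝ → ℂ} (hg : Continuous g) (a b u : ℝ) :
    IntervalIntegrable (fun s : ℝ => Complex.exp (Complex.I * u * s) * g s) volume a b :=
  (continuous_oscInt_integrand hg u).intervalIntegrable a b

lemma norm_oscInt_le {g : ℝ → ℂ} {a b B : ℝ} (h : ∀ s ∈ Set.uIoc a b, ‖g s‖ ≤ B) (u : ℝ) :
    ‖oscInt g a b u‖ ≤ B * |b - a| := by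
  refine intervalIntegral.norm_integral_le_of_norm_le_const fun s hs => ?_
  rw [norm_mul, norm_exp_I_mul_mul, one_mul]
  exact h s hs

lemma oscInt_add_adjacent {g : ℝ → ℂ} (hg : Continuous g) (a b c u : ℝ) :
    oscInt g a b u + oscInt g b c u = oscInt g a c u :=
  intervalIntegral.integral_add_adjacent_intervals (intervalIntegrable_oscInt hg a b u)
    (intervalIntegrable_oscInt hg b c u)

lemma hasDerivAt_oscInt_right {g : ℝ → ℂ} (hg : Continuous g) (a t u : ℝ) :
    HasDerivAt (fun t => oscInt g a t u) (Complex.exp (Complex.I * u * t) * g t) t :=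
  intervalIntegral.integral_hasDerivAt_right (intervalIntegrable_oscInt hg a t u)
    (continuous_oscInt_integrand hg u).stronglyMeasurable.stronglyMeasurableAtFilter
    (continuous_oscInt_integrand hg u).continuousAt

lemma hasDerivAt_oscInt_freq {g : ℝ → ℂ} (hg : Continuous g) (a b u : ℝ) :
    HasDerivAt (oscInt g a b) (Complex.I * oscInt (fun s => s * g s) a b u) u := by
  have h := (intervalIntegral.hasDerivAt_integral_of_dominated_loc_of_deriv_le
    (μ := volume) (a := a) (b := b) (x₀ := u) (s := Set.univ)
    (F := fun (u s : ℝ) => Complex.exp (Complex.I * u * s) * g s)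
    (F' := fun (u s : ℝ) => Complex.I * (Complex.exp (Complex.I * u * s) * (s * g s)))
    (bound := fun s : ℝ => ‖(s : ℂ) * g s‖) Filter.univ_mem
    (Eventually.of_forall fun v => (continuous_oscInt_integrand hg v).aestronglyMeasurable)
    (intervalIntegrable_oscInt hg a b u)
    (Continuous.aestronglyMeasurable (by fun_prop))
    (Eventually.of_forall fun s _ v _ => by
      rw [norm_mul, norm_mul, norm_exp_I_mul_mul, Complex.norm_I, one_mul, one_mul])
    (Continuous.intervalIntegrable (by fun_prop) _ _)
    (Eventually.of_forall fun s _ v _ => by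
      have h1 : HasDerivAt (fun v : ℝ => Complex.I * (v : ℂ) * s) (Complex.I * s) v := by
        simpa using ((Complex.ofRealCLM.hasDerivAt (x := v)).const_mul Complex.I).mul_const (s : ℂ)
      have h2 := h1.cexp.mul_const (g s)
      convert! h2 using 1
      ring)).2
  convert! h using 1
  rw [oscInt, ← intervalIntegral.integral_const_mul]

lemma continuous_oscInt_freq {g : ℝ → ℂ} (hg : Continuous g) (a b : ℝ) :
    Continuous (oscInt g a b) :=
  continuous_iff_continuousAt.2 fun u => (hasDerivAt_oscInt_freq hg a b u).continuousAt

/-- The Riemann-Lebesgue lemma on an interval. -/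
lemma tendsto_oscInt_atTop (g : ℝ → ℂ) (a b : ℝ) :
    Tendsto (oscInt g a b) atTop (𝓝 0) := by
  wlog hab : a ≤ b generalizing a b
  · have h := (this b a (le_of_not_ge hab)).neg
    simp only [neg_zero] at h
    refine h.congr fun u => ?_
    rw [oscInt, oscInt, intervalIntegral.integral_symm]
    simp
  have h := Real.tendsto_integral_exp_smul_cocompact ((Set.Ioc a b).indicator g)
  have h2 : Tendsto (fun u : ℝ => -(u / (2 * Real.pi))) atTop (cocompact ℝ) := by
    refine Tendsto.mono_right ?_ atBot_le_cocompact
    exact tendsto_neg_atTop_atBot.comp (tendsto_id.atTop_div_const (by positivity))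
  refine (h.comp h2).congr fun u => ?_
  rw [oscInt, intervalIntegral.integral_of_le hab, ← integral_indicator measurableSet_Ioc]
  simp only [Function.comp]
  refine integral_congr_ae (Eventually.of_forall fun s => ?_)
  by_cases hs : s ∈ Set.Ioc a b
  · simp only [Set.indicator_of_mem hs, Circle.smul_def, smul_eq_mul, Real.fourierChar_apply]
    congr 2
    push_cast
    field_simp
  · simp [Set.indicator_of_notMem hs]

/-- `∫_a^t (t - s) e^{ius} f(s) ds`. -/
def rampInt (f : ℝ → ℂ) (a t u : ℝ) : ℂ := oscInt (fun s => ((t - s : ℝ) : ℂ) * f s) a t u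

lemma rampInt_eq {f : ℝ → ℂ} (hf : Continuous f) (a t u : ℝ) :
    rampInt f a t u = t * oscInt f a t u - oscInt (fun s => s * f s) a t u := by
  rw [rampInt, oscInt, oscInt, oscInt, ← intervalIntegral.integral_const_mul,
    ← intervalIntegral.integral_sub]
  · congr 1; ext s; push_cast; ring
  · exact Continuous.intervalIntegrable (by fun_prop) _ _
  · exact Continuous.intervalIntegrable (by fun_prop) _ _

lemma hasDerivAt_rampInt {f : ℝ → ℂ} (hf : Continuous f) (a t u : ℝ) :
    HasDerivAt (fun t => rampInt f a t u) (oscInt f a t u) t := by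
  have h1 := (Complex.ofRealCLM.hasDerivAt (x := t)).mul (hasDerivAt_oscInt_right hf a t u)
  have h2 := hasDerivAt_oscInt_right (g := fun s => s * f s) (by fun_prop) a t u
  refine ((h1.sub h2).congr_deriv ?_).congr_of_eventuallyEq
    (Eventually.of_forall fun s => rampInt_eq hf a s u)
  simp; ring

lemma continuous_rampInt_freq {f : ℝ → ℂ} (hf : Continuous f) (a t : ℝ) :
    Continuous (rampInt f a t) :=
  continuous_oscInt_freq (by fun_prop) a t

lemma hasDerivAt_exp_mul_oscInt {f : ℝ → ℂ} (hf : Continuous f) (a t u : ℝ) :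
    HasDerivAt (fun u : ℝ => Complex.exp (-(Complex.I * u * t)) * oscInt f a t u)
      (-(Complex.I * (Complex.exp (-(Complex.I * u * t)) * rampInt f a t u))) u := by
  have h1 : HasDerivAt (fun v : ℝ => -(Complex.I * (v : ℂ) * t)) (-(Complex.I * t)) u := by
    simpa using (((Complex.ofRealCLM.hasDerivAt (x := u)).const_mul Complex.I).mul_const
      (t : ℂ)).fun_neg
  refine (h1.cexp.mul (hasDerivAt_oscInt_freq hf a t u)).congr_deriv ?_
  rw [rampInt_eq hf]; ring

/-! ### A form with exponential cutoff -/

lemma integrableOn_exp_mul_id {ε : ℝ} (hε : 0 < ε) :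
    IntegrableOn (fun u : ℝ => Real.exp (-(ε * u)) * u) (Set.Ioi 0) := by
  have h := integrableOn_rpow_mul_exp_neg_mul_rpow (s := 1) (p := 1) (b := ε)
    (by norm_num) one_pos hε
  refine h.congr_fun (fun u hu => ?_) measurableSet_Ioi
  simp only [Real.rpow_one]
  rw [mul_comm, neg_mul]

/-- `∫_0^∞ u e^{-pu} du = p⁻²` in the right half plane. -/
lemma integral_id_mul_exp_neg {p : ℂ} (hp : 0 < p.re) :
    ∫ u in Set.Ioi (0 : ℝ), (u : ℂ) * Complex.exp (-(p * u)) = (p ^ 2)⁻¹ := by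
  have hp0 : p ≠ 0 := by rintro rfl; simp at hp
  have hn : ∀ u : ℝ, ‖Complex.exp (-(p * u))‖ = Real.exp (-(p.re * u)) := by
    intro u; rw [Complex.norm_exp]; simp
  have hd : ∀ u : ℝ, HasDerivAt
      (fun u : ℝ => -((u : ℂ) / p + (p ^ 2)⁻¹) * Complex.exp (-(p * u)))
      ((u : ℂ) * Complex.exp (-(p * u))) u := by
    intro u
    have h0 := Complex.ofRealCLM.hasDerivAt (x := u)
    have h1 := ((h0.div_const p).add_const ((p ^ 2)⁻¹)).neg
    have h2 := (h0.const_mul p).neg.cexp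
    refine (h1.mul h2).congr_deriv ?_
    simp only [Complex.ofRealCLM_apply, Complex.ofReal_one, Pi.neg_apply]
    field_simp
    ring
  have hint : IntegrableOn (fun u : ℝ => (u : ℂ) * Complex.exp (-(p * u))) (Set.Ioi 0) := by
    refine (integrableOn_exp_mul_id hp).mono'
      (Continuous.aestronglyMeasurable (by fun_prop)) ?_
    filter_upwards [ae_restrict_mem measurableSet_Ioi] with u hu
    rw [norm_mul, hn, Complex.norm_real, Real.norm_of_nonneg (le_of_lt hu), mul_comm]
  have hlim : Tendsto (fun u : ℝ => -((u : ℂ) / p + (p ^ 2)⁻¹) * Complex.exp (-(p * u)))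
      atTop (𝓝 0) := by
    rw [tendsto_zero_iff_norm_tendsto_zero]
    have e1 : Tendsto (fun u : ℝ => u * Real.exp (-(p.re * u))) atTop (𝓝 0) := by
      have := Real.tendsto_pow_mul_exp_neg_atTop_nhds_zero 1
      have h3 := (this.comp (tendsto_id.const_mul_atTop hp)).const_mul (p.re⁻¹)
      simp only [mul_zero] at h3
      refine h3.congr fun u => ?_
      simp only [Function.comp, id, pow_one]
      field_simp
    have e2 : Tendsto (fun u : ℝ => Real.exp (-(p.re * u))) atTop (𝓝 0) :=
      Real.tendsto_exp_neg_atTop_nhds_zero.comp (tendsto_id.const_mul_atTop hp)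
    have e3 := (e1.const_mul (‖p‖⁻¹)).add (e2.const_mul (‖(p ^ 2)⁻¹‖))
    simp only [mul_zero, add_zero] at e3
    refine squeeze_zero' (Eventually.of_forall fun u => norm_nonneg _) ?_ e3
    filter_upwards [eventually_ge_atTop 0] with u hu
    rw [norm_mul, norm_neg, hn]
    calc _ ≤ (‖(u : ℂ) / p‖ + ‖(p ^ 2)⁻¹‖) * Real.exp (-(p.re * u)) := by
          gcongr; exact norm_add_le _ _
      _ = _ := by
          rw [norm_div, Complex.norm_real, Real.norm_of_nonneg hu]; ring
  have := integral_Ioi_of_hasDerivAt_of_tendsto' (fun u _ => hd u) hint hlim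
  rw [this]; simp

/-- `∫_0^∞ e^{-εu} u |P_t(u)|² du` with `P_t = rampInt f a t`. -/
def rampEnergy (f : ℝ → ℂ) (a ε t : ℝ) : ℝ :=
  ∫ u in Set.Ioi (0 : ℝ), Real.exp (-(ε * u)) * u * ‖rampInt f a t u‖ ^ 2

/-- `Re ∫_0^∞ e^{-εu} u F_t(u) conj (P_t(u)) du` with `F_t = oscInt f a t`, `P_t = rampInt f a t`.
For `ε > 0` it is half of the derivative of `rampEnergy`. -/
def rampPairing (f : ℝ → ℂ) (a ε t : ℝ) : ℝ :=
  ∫ u in Set.Ioi (0 : ℝ), Real.exp (-(ε * u)) * u *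
    (oscInt f a t u * (starRingEnd ℂ) (rampInt f a t u)).re

/-- The pairing of `(t - s) f(s)`, `s < t`, with `f(s')`, `s' > t`. -/
def crossPairing (f : ℝ → ℂ) (a b ε t : ℝ) : ℂ :=
  ∫ u in Set.Ioi (0 : ℝ), ((Real.exp (-(ε * u)) * u : ℝ) : ℂ) *
    (rampInt f a t u * (starRingEnd ℂ) (oscInt f t b u))

lemma exists_bound_osc {f : ℝ → ℂ} (hf : Continuous f) {a b : ℝ} (hab : a ≤ b) :
    ∃ K : ℝ, 0 ≤ K ∧ (∀ s ∈ Set.Icc (a - 1) (b + 1), ‖f s‖ ≤ K) ∧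
      ∀ t ∈ Set.Icc (a - 1) (b + 1), ∀ u,
      ‖oscInt f a t u‖ ≤ K ∧ ‖oscInt f t b u‖ ≤ K ∧ ‖rampInt f a t u‖ ≤ K := by
  obtain ⟨B, hB⟩ := isCompact_Icc.exists_bound_of_continuousOn (s := Set.Icc (a - 1) (b + 1))
    hf.continuousOn
  have hB0 : 0 ≤ B := (norm_nonneg _).trans (hB a ⟨by linarith, by linarith⟩)
  have hsub : ∀ c ∈ Set.Icc (a - 1) (b + 1), ∀ d ∈ Set.Icc (a - 1) (b + 1),
      Set.uIoc c d ⊆ Set.Icc (a - 1) (b + 1) := fun c hc d hd =>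
    Set.uIoc_subset_uIcc.trans (Set.uIcc_subset_Icc hc hd)
  have hL : ∀ c ∈ Set.Icc (a - 1) (b + 1), ∀ d ∈ Set.Icc (a - 1) (b + 1),
      |d - c| ≤ b - a + 2 := fun c hc d hd => by
    rw [abs_le]; constructor <;> linarith [hc.1, hc.2, hd.1, hd.2]
  have ha : a ∈ Set.Icc (a - 1) (b + 1) := ⟨by linarith, by linarith⟩
  have hb : b ∈ Set.Icc (a - 1) (b + 1) := ⟨by linarith, by linarith⟩
  have hR : 0 ≤ b - a + 2 := by linarith
  have hR1 : 0 ≤ B * (b - a + 2) := by positivity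
  have hR2 : 0 ≤ (b - a + 2) * B * (b - a + 2) := by positivity
  refine ⟨B + B * (b - a + 2) + (b - a + 2) * B * (b - a + 2), by positivity,
    fun s hs => (hB s hs).trans (by linarith), fun t ht u => ⟨?_, ?_, ?_⟩⟩
  · have := norm_oscInt_le (fun s hs => hB s (hsub a ha t ht hs)) u
    have h2 := mul_le_mul_of_nonneg_left (hL a ha t ht) hB0
    linarith
  · have := norm_oscInt_le (fun s hs => hB s (hsub t ht b hb hs)) u
    have h2 := mul_le_mul_of_nonneg_left (hL t ht b hb) hB0
    linarith
  · have := norm_oscInt_le (g := fun s => ((t - s : ℝ) : ℂ) * f s) (a := a) (b := t)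
      (B := (b - a + 2) * B) (fun s hs => by
        rw [norm_mul, Complex.norm_real]
        exact mul_le_mul (hL s (hsub a ha t ht hs) t ht) (hB s (hsub a ha t ht hs))
          (norm_nonneg _) hR) u
    have h2 := mul_le_mul_of_nonneg_left (hL a ha t ht) (mul_nonneg hR hB0)
    rw [rampInt]
    linarith

/-- Bounded continuous functions are integrable against the cut-off weight. -/
lemma integrableOn_weight_mul {ε : ℝ} (hε : 0 < ε) {g : ℝ → ℝ} (hg : Continuous g) {K : ℝ}
    (hK : ∀ u, |g u| ≤ K) :
    IntegrableOn (fun u : ℝ => Real.exp (-(ε * u)) * u * g u) (Set.Ioi 0) :=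
  (integrableOn_exp_mul_id hε).mul_bdd (c := K) hg.aestronglyMeasurable
    (Eventually.of_forall hK)

lemma hasDerivAt_rampEnergy {f : ℝ → ℂ} (hf : Continuous f) {a b : ℝ} (hab : a ≤ b)
    {ε : ℝ} (hε : 0 < ε) {t : ℝ} (ht : t ∈ Set.Ioo (a - 1) (b + 1)) :
    HasDerivAt (rampEnergy f a ε) (2 * rampPairing f a ε t) t := by
  obtain ⟨K, hK0, -, hK⟩ := exists_bound_osc hf hab
  have hbd : ∀ s ∈ Set.Ioo (a - 1) (b + 1), ∀ u,
      |(oscInt f a s u * (starRingEnd ℂ) (rampInt f a s u)).re| ≤ K * K := fun s hs u => by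
    obtain ⟨h1, -, h2⟩ := hK s (Set.Ioo_subset_Icc_self hs) u
    refine (Complex.abs_re_le_norm _).trans ?_
    rw [norm_mul, RCLike.norm_conj]
    exact mul_le_mul h1 h2 (norm_nonneg _) hK0
  have hc1 : ∀ s, Continuous (oscInt f a s) := fun s => continuous_oscInt_freq hf a s
  have hc2 : ∀ s, Continuous (rampInt f a s) := fun s => continuous_rampInt_freq hf a s
  have h := (hasDerivAt_integral_of_dominated_loc_of_deriv_le
    (μ := volume.restrict (Set.Ioi (0 : ℝ))) (x₀ := t) (s := Set.Ioo (a - 1) (b + 1))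
    (F := fun s u => Real.exp (-(ε * u)) * u * ‖rampInt f a s u‖ ^ 2)
    (F' := fun s u => Real.exp (-(ε * u)) * u *
      (2 * (oscInt f a s u * (starRingEnd ℂ) (rampInt f a s u)).re))
    (bound := fun u => Real.exp (-(ε * u)) * u * (2 * (K * K)))
    (isOpen_Ioo.mem_nhds ht)
    (Eventually.of_forall fun s => by
      have := hc2 s
      exact Continuous.aestronglyMeasurable (by fun_prop))
    (integrableOn_weight_mul hε (by have := hc2 t; fun_prop) (K := K ^ 2) fun u => by
      rw [abs_of_nonneg (by positivity)]
      exact pow_le_pow_left₀ (norm_nonneg _) (hK t (Set.Ioo_subset_Icc_self ht) u).2.2 2)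
    (by
      have := hc2 t
      have := hc1 t
      exact Continuous.aestronglyMeasurable (by fun_prop))
    (by
      filter_upwards [ae_restrict_mem measurableSet_Ioi] with u hu s hs
      have hu : (0 : ℝ) < u := hu
      rw [norm_mul, Real.norm_of_nonneg (by positivity), norm_mul, Real.norm_of_nonneg zero_le_two,
        Real.norm_eq_abs]
      gcongr
      exact hbd s hs u)
    ((integrableOn_exp_mul_id hε).mul_const _)
    (Eventually.of_forall fun u s _ => by
      have h1 := (hasDerivAt_rampInt hf a s u).norm_sq
      refine (h1.const_mul _).congr_deriv ?_
      congr 2)).2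
  refine h.congr_deriv ?_
  rw [rampPairing, ← integral_const_mul]
  congr 1; ext u; ring

/-- The two functions of `crossPairing` have disjoint supports, whence the absolutely convergent
kernel `(ε + i(x + y))⁻²`, where `x = t - s` and `y = s' - t`. -/
lemma crossPairing_eq {f : ℝ → ℂ} (hf : Continuous f) {a b t ε : ℝ} (hε : 0 < ε)
    (ht : t ∈ Set.Icc a b) :
    crossPairing f a b ε t = ∫ p in Set.Ioc 0 (t - a) ×ˢ Set.Ioc 0 (b - t),
      (p.1 : ℂ) * f (t - p.1) * (starRingEnd ℂ) (f (t + p.2)) *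
        (((ε : ℂ) + Complex.I * (p.1 + p.2)) ^ 2)⁻¹ := by
  obtain ⟨K, hK0, hK, -⟩ := exists_bound_osc hf (ht.1.trans ht.2)
  have e1 : ∀ u, rampInt f a t u = ∫ x in Set.Ioc 0 (t - a),
      Complex.exp (Complex.I * u * (t - x : ℝ)) * ((x : ℂ) * f (t - x)) := fun u => by
    rw [← intervalIntegral.integral_of_le (by linarith [ht.1])]
    have := intervalIntegral.integral_comp_sub_left (a := 0) (b := t - a)
      (fun s : ℝ => Complex.exp (Complex.I * u * s) * (((t - s : ℝ) : ℂ) * f s)) t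
    simp only [sub_sub_cancel, sub_zero] at this
    rw [this]; rfl
  have e2 : ∀ u : ℝ, (starRingEnd ℂ) (oscInt f t b u) = ∫ y in Set.Ioc 0 (b - t),
      Complex.exp (-(Complex.I * u * (t + y : ℝ))) * (starRingEnd ℂ) (f (t + y)) := fun u => by
    rw [← intervalIntegral.integral_of_le (by linarith [ht.2])]
    have := intervalIntegral.integral_comp_add_left (a := 0) (b := b - t)
      (fun s : ℝ => Complex.exp (-(Complex.I * u * s)) * (starRingEnd ℂ) (f s)) t
    simp only [add_zero, add_sub_cancel] at this
    rw [this, oscInt, intervalIntegral.integral_of_le ht.2, intervalIntegral.integral_of_le ht.2,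
      ← integral_conj]
    congr 1; ext s
    rw [map_mul, ← Complex.exp_conj]
    simp
  set S : Set (ℝ × ℝ) := Set.Ioc 0 (t - a) ×ˢ Set.Ioc 0 (b - t) with hS
  have hSm : MeasurableSet S := measurableSet_Ioc.prod measurableSet_Ioc
  have hSf : volume S ≠ ⊤ := by
    rw [hS, Measure.volume_eq_prod, Measure.prod_prod]
    simp [ENNReal.mul_eq_top]
  have : IsFiniteMeasure ((volume : Measure (ℝ × ℝ)).restrict S) :=
    ⟨by rw [Measure.restrict_apply_univ]; exact lt_top_iff_ne_top.2 hSf⟩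
  have e3 : ∀ u : ℝ, ((Real.exp (-(ε * u)) * u : ℝ) : ℂ) *
      (rampInt f a t u * (starRingEnd ℂ) (oscInt f t b u)) = ∫ p in S,
        ((p.1 : ℂ) * f (t - p.1) * (starRingEnd ℂ) (f (t + p.2))) *
          ((u : ℂ) * Complex.exp (-(((ε : ℂ) + Complex.I * (p.1 + p.2)) * u))) := fun u => by
    rw [e1, e2, hS, Measure.volume_eq_prod, ← setIntegral_prod_mul, ← integral_const_mul]
    congr 1; ext p
    rw [show -(((ε : ℂ) + Complex.I * (p.1 + p.2)) * u) = ((-(ε * u) : ℝ) : ℂ) +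
      Complex.I * u * (t - p.1 : ℝ) + -(Complex.I * u * (t + p.2 : ℝ)) by push_cast; ring,
      Complex.exp_add, Complex.exp_add]
    push_cast
    ring
  rw [crossPairing]
  simp_rw [e3]
  rw [integral_integral_swap]
  · refine integral_congr_ae ?_
    filter_upwards [ae_restrict_mem hSm] with p hp
    rw [integral_const_mul, integral_id_mul_exp_neg (by simpa using hε)]
  · have hw := (integrableOn_exp_mul_id hε).mul_prod
      (integrable_const (μ := (volume : Measure (ℝ × ℝ)).restrict S) ((t - a) * K * K))
    refine hw.mono' (Continuous.aestronglyMeasurable (by fun_prop)) ?_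
    rw [Measure.prod_restrict]
    filter_upwards [ae_restrict_mem (measurableSet_Ioi.prod hSm)] with q hq
    obtain ⟨hu, hp1, hp2⟩ := hq
    have hu : 0 < q.1 := hu
    have h1 : ‖f (t - q.2.1)‖ ≤ K := hK _ ⟨by linarith [hp1.2], by linarith [hp1.1, ht.2]⟩
    have h2 : ‖f (t + q.2.2)‖ ≤ K := hK _ ⟨by linarith [hp2.1, ht.1], by linarith [hp2.2]⟩
    have h3 : ‖Complex.exp (-(((ε : ℂ) + Complex.I * (q.2.1 + q.2.2)) * q.1))‖ =
        Real.exp (-(ε * q.1)) := by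
      rw [Complex.norm_exp]; simp
    simp only [Function.uncurry, norm_mul, RCLike.norm_conj, Complex.norm_real, h3]
    rw [Real.norm_of_nonneg hu.le, Real.norm_of_nonneg hp1.1.le]
    calc _ ≤ ((t - a) * K * K) * (q.1 * Real.exp (-(ε * q.1))) := by
          have h0 : 0 ≤ t - a := by linarith [ht.1]
          gcongr
          exact hp1.2
      _ = _ := by ring

lemma integrableOn_cross_kernel (R : ℝ) :
    IntegrableOn (fun p : ℝ × ℝ => p.1 * ((p.1 + p.2) ^ 2)⁻¹) (Set.Ioc 0 R ×ˢ Set.Ioc 0 R) := by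
  rcases lt_or_ge R 0 with hR | hR
  · simp [Set.Ioc_eq_empty (not_lt.2 hR.le)]
  have h1 : IntegrableOn (fun x : ℝ => x ^ (-(1 / 2) : ℝ)) (Set.Ioc 0 R) := by
    have := intervalIntegral.intervalIntegrable_rpow' (a := 0) (b := R) (r := -(1 / 2))
      (by norm_num)
    rwa [intervalIntegrable_iff_integrableOn_Ioc_of_le hR] at this
  have h2 := h1.mul_prod h1
  rw [Measure.prod_restrict] at h2
  refine Integrable.mono' h2 (Measurable.aestronglyMeasurable (by fun_prop)) ?_
  filter_upwards [ae_restrict_mem (measurableSet_Ioc.prod measurableSet_Ioc)] with p hp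
  obtain ⟨⟨hx, -⟩, hy, -⟩ := hp
  have hxy : 0 < p.1 + p.2 := by linarith
  rw [Real.norm_of_nonneg (by positivity), Real.rpow_neg hx.le, Real.rpow_neg hy.le,
    ← Real.sqrt_eq_rpow, ← Real.sqrt_eq_rpow, ← mul_inv, ← Real.sqrt_mul hx.le]
  rw [← div_eq_mul_inv, div_le_iff₀ (by positivity), inv_mul_eq_div, le_div_iff₀ (by positivity)]
  have hs : √(p.1 * p.2) ≤ p.1 + p.2 :=
    Real.sqrt_le_iff.2 ⟨hxy.le, by nlinarith⟩
  nlinarith [hs, hx, hy, Real.sqrt_nonneg (p.1 * p.2)]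

/-- As the cutoff is removed, the cross pairing converges uniformly in `t`, and it stays bounded. -/
lemma exists_crossPairing_limit {f : ℝ → ℂ} (hf : Continuous f) {a b : ℝ} (hab : a ≤ b) :
    ∃ (C : ℝ) (Ω : ℝ → ℂ), 0 ≤ C ∧
      (∀ ε > 0, ∀ t ∈ Set.Icc a b, ‖crossPairing f a b ε t‖ ≤ C) ∧
      TendstoUniformlyOn (fun ε t => crossPairing f a b ε t) Ω (𝓝[>] (0 : ℝ)) (Set.Icc a b) := by
  obtain ⟨K, hK0, hK, -⟩ := exists_bound_osc hf hab
  set R : ℝ := b - a with hR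
  set Q : Set (ℝ × ℝ) := Set.Ioc 0 R ×ˢ Set.Ioc 0 R with hQ
  have hQm : MeasurableSet Q := measurableSet_Ioc.prod measurableSet_Ioc
  set κ : ℝ → ℝ × ℝ → ℂ := fun ε p => (((ε : ℂ) + Complex.I * (p.1 + p.2)) ^ 2)⁻¹ with hκ
  have hκm : ∀ ε, Measurable (κ ε) := fun ε => by rw [hκ]; fun_prop
  have hker := integrableOn_cross_kernel R
  have hκb : ∀ ε : ℝ, ∀ p ∈ Q, p.1 * ‖κ ε p‖ ≤ p.1 * ((p.1 + p.2) ^ 2)⁻¹ := by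
    intro ε p hp
    obtain ⟨⟨hx, -⟩, hy, -⟩ := hp
    have h1 : p.1 + p.2 ≤ ‖(ε : ℂ) + Complex.I * (p.1 + p.2)‖ := by
      have := Complex.abs_im_le_norm ((ε : ℂ) + Complex.I * (p.1 + p.2))
      simp only [Complex.add_im, Complex.ofReal_im, Complex.mul_im, Complex.I_re, Complex.I_im,
        Complex.add_re, Complex.ofReal_re, zero_mul, one_mul, zero_add] at this
      exact (le_abs_self _).trans this
    rw [hκ, norm_inv, norm_pow]
    gcongr
  have hSQ : ∀ t ∈ Set.Icc a b, Set.Ioc 0 (t - a) ×ˢ Set.Ioc 0 (b - t) ⊆ Q := fun t ht =>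
    Set.prod_mono (Set.Ioc_subset_Ioc_right (by linarith [ht.2]))
      (Set.Ioc_subset_Ioc_right (by linarith [ht.1]))
  have hff : ∀ t ∈ Set.Icc a b, ∀ p ∈ Set.Ioc 0 (t - a) ×ˢ Set.Ioc 0 (b - t),
      ‖f (t - p.1) * (starRingEnd ℂ) (f (t + p.2))‖ ≤ K * K := fun t ht p hp => by
    rw [norm_mul, RCLike.norm_conj]
    exact mul_le_mul (hK _ ⟨by linarith [hp.1.2], by linarith [hp.1.1, ht.2]⟩)
      (hK _ ⟨by linarith [hp.2.1, ht.1], by linarith [hp.2.2]⟩) (norm_nonneg _) hK0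
  -- estimate of the form with a kernel dominated by `p.1 * ((p.1 + p.2) ^ 2)⁻¹`
  have key : ∀ k : ℝ × ℝ → ℂ, IntegrableOn (fun p => p.1 * ‖k p‖) Q →
      ∀ t ∈ Set.Icc a b, ‖∫ p in Set.Ioc 0 (t - a) ×ˢ Set.Ioc 0 (b - t),
        (p.1 : ℂ) * f (t - p.1) * (starRingEnd ℂ) (f (t + p.2)) * k p‖ ≤
      K * K * ∫ p in Q, p.1 * ‖k p‖ := by
    intro k hk t ht
    have hS : MeasurableSet (Set.Ioc 0 (t - a) ×ˢ Set.Ioc (0 : ℝ) (b - t)) :=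
      measurableSet_Ioc.prod measurableSet_Ioc
    refine (norm_integral_le_of_norm_le ((hk.mono_set (hSQ t ht)).const_mul (K * K)) ?_).trans ?_
    · filter_upwards [ae_restrict_mem hS] with p hp
      have hx : 0 < p.1 := hp.1.1
      calc _ = ‖f (t - p.1) * (starRingEnd ℂ) (f (t + p.2))‖ * (p.1 * ‖k p‖) := by
            rw [mul_assoc (p.1 : ℂ), norm_mul, norm_mul, Complex.norm_real,
              Real.norm_of_nonneg hx.le]
            ring
        _ ≤ _ := by gcongr; exact hff t ht p hp
    · rw [integral_const_mul]
      refine mul_le_mul_of_nonneg_left (setIntegral_mono_set hk ?_ ?_) (mul_nonneg hK0 hK0)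
      · filter_upwards [ae_restrict_mem hQm] with p hp
        exact mul_nonneg hp.1.1.le (norm_nonneg _)
      · exact (hSQ t ht).eventuallyLE
  have hint : ∀ ε, IntegrableOn (fun p => p.1 * ‖κ ε p‖) Q := fun ε => by
    refine Integrable.mono' hker
      (measurable_fst.mul (hκm ε).norm).aestronglyMeasurable ?_
    filter_upwards [ae_restrict_mem hQm] with p hp
    rw [Real.norm_of_nonneg (mul_nonneg hp.1.1.le (norm_nonneg _))]
    exact hκb ε p hp
  have hintd : ∀ ε, IntegrableOn (fun p => p.1 * ‖κ ε p - κ 0 p‖) Q := fun ε => by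
    refine Integrable.mono' ((hint ε).add (hint 0))
      (measurable_fst.mul ((hκm ε).sub (hκm 0)).norm).aestronglyMeasurable ?_
    filter_upwards [ae_restrict_mem hQm] with p hp
    have hx : 0 ≤ p.1 := hp.1.1.le
    rw [Real.norm_of_nonneg (mul_nonneg hx (norm_nonneg _))]
    calc _ ≤ p.1 * (‖κ ε p‖ + ‖κ 0 p‖) := by gcongr; exact norm_sub_le _ _
      _ = _ := by simp only [Pi.add_apply]; ring
  have hlim : Tendsto (fun ε => ∫ p in Q, p.1 * ‖κ ε p - κ 0 p‖) (𝓝[>] (0 : ℝ)) (𝓝 0) := by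
    have h0 : 𝓝 (0 : ℝ) = 𝓝 (∫ p in Q, (0 : ℝ)) := by simp
    refine Eq.mpr (congrArg _ h0) ?_
    refine tendsto_integral_filter_of_dominated_convergence
      (fun p : ℝ × ℝ => 2 * (p.1 * ((p.1 + p.2) ^ 2)⁻¹))
      (Eventually.of_forall fun ε =>
        (measurable_fst.mul ((hκm ε).sub (hκm 0)).norm).aestronglyMeasurable)
      (Eventually.of_forall fun ε => ?_) (hker.const_mul 2) ?_
    · filter_upwards [ae_restrict_mem hQm] with p hp
      have hx : 0 ≤ p.1 := hp.1.1.le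
      rw [Real.norm_of_nonneg (mul_nonneg hx (norm_nonneg _))]
      calc _ ≤ p.1 * (‖κ ε p‖ + ‖κ 0 p‖) := by gcongr; exact norm_sub_le _ _
        _ ≤ _ := by linarith [hκb ε p hp, hκb 0 p hp]
    · filter_upwards [ae_restrict_mem hQm] with p hp
      have hne : ((0 : ℝ) : ℂ) + Complex.I * (p.1 + p.2) ≠ 0 := by
        have : (0 : ℝ) < p.1 + p.2 := add_pos hp.1.1 hp.2.1
        rw [Complex.ofReal_zero, zero_add]
        exact mul_ne_zero Complex.I_ne_zero (by exact_mod_cast this.ne')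
      have hc : ContinuousAt (fun ε : ℝ => p.1 * ‖κ ε p - κ 0 p‖) 0 := by
        have : ContinuousAt (fun ε : ℝ => κ ε p) 0 := by
          rw [hκ]
          refine ContinuousAt.inv₀ (by fun_prop) (pow_ne_zero 2 hne)
        fun_prop
      have := hc.tendsto
      simp only [sub_self, norm_zero, mul_zero] at this
      exact this.mono_left nhdsWithin_le_nhds
  refine ⟨K * K * ∫ p in Q, p.1 * ((p.1 + p.2) ^ 2)⁻¹,
    fun t => ∫ p in Set.Ioc 0 (t - a) ×ˢ Set.Ioc 0 (b - t),
        (p.1 : ℂ) * f (t - p.1) * (starRingEnd ℂ) (f (t + p.2)) * κ 0 p, ?_, ?_, ?_⟩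
  · refine mul_nonneg (mul_nonneg hK0 hK0) (setIntegral_nonneg hQm fun p hp => ?_)
    exact mul_nonneg hp.1.1.le (by positivity)
  · intro ε hε t ht
    rw [crossPairing_eq hf hε ht]
    refine (key (κ ε) (hint ε) t ht).trans ?_
    refine mul_le_mul_of_nonneg_left ?_ (mul_nonneg hK0 hK0)
    exact setIntegral_mono_on (hint ε) hker hQm (hκb ε)
  · rw [Metric.tendstoUniformlyOn_iff]
    intro η hη
    have h2 := hlim.const_mul (K * K)
    rw [mul_zero] at h2
    filter_upwards [h2.eventually (gt_mem_nhds hη), self_mem_nhdsWithin] with ε hε hε0 t ht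
    refine lt_of_le_of_lt ?_ hε
    rw [dist_comm, dist_eq_norm, crossPairing_eq hf hε0 ht]
    have hS : MeasurableSet (Set.Ioc 0 (t - a) ×ˢ Set.Ioc (0 : ℝ) (b - t)) :=
      measurableSet_Ioc.prod measurableSet_Ioc
    have hi : ∀ ε, IntegrableOn (fun p : ℝ × ℝ =>
        (p.1 : ℂ) * f (t - p.1) * (starRingEnd ℂ) (f (t + p.2)) * κ ε p)
        (Set.Ioc 0 (t - a) ×ˢ Set.Ioc 0 (b - t)) := fun ε => by
      refine Integrable.mono' (((hint ε).mono_set (hSQ t ht)).const_mul (K * K))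
        (Measurable.aestronglyMeasurable ?_) ?_
      · have := hκm ε
        have := hf.measurable
        fun_prop
      · filter_upwards [ae_restrict_mem hS] with p hp
        have hx : 0 < p.1 := hp.1.1
        calc _ = ‖f (t - p.1) * (starRingEnd ℂ) (f (t + p.2))‖ * (p.1 * ‖κ ε p‖) := by
              rw [mul_assoc (p.1 : ℂ), norm_mul, norm_mul, Complex.norm_real,
                Real.norm_of_nonneg hx.le]
              ring
          _ ≤ _ := by gcongr; exact hff t ht p hp
    have := key (fun p => κ ε p - κ 0 p) (hintd ε) t ht
    rw [← integral_sub (hi ε) (hi 0)]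
    convert! this using 4 with p
    ring

/-- `Re ∫_0^∞ e^{-εu} u P_t(u) conj (F_b(u)) du` with `F_b = oscInt f a b`. -/
def directPairing (f : ℝ → ℂ) (a b ε t : ℝ) : ℝ :=
  ∫ u in Set.Ioi (0 : ℝ), Real.exp (-(ε * u)) * u *
    (rampInt f a t u * (starRingEnd ℂ) (oscInt f a b u)).re

lemma rampPairing_eq {f : ℝ → ℂ} (hf : Continuous f) {a b t ε : ℝ} (hε : 0 < ε)
    (ht : t ∈ Set.Icc a b) :
    rampPairing f a ε t = directPairing f a b ε t - (crossPairing f a b ε t).re := by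
  obtain ⟨K, hK0, -, hK⟩ := exists_bound_osc hf (ht.1.trans ht.2)
  have ht' : t ∈ Set.Icc (a - 1) (b + 1) := ⟨by linarith [ht.1], by linarith [ht.2]⟩
  have hb' : b ∈ Set.Icc (a - 1) (b + 1) := ⟨by linarith [ht.1, ht.2], by linarith⟩
  have c1 := continuous_rampInt_freq hf a t
  have c2 := continuous_oscInt_freq hf t b
  have c3 := continuous_oscInt_freq hf a b
  have bd : ∀ z w : ℂ, ‖z‖ ≤ K → ‖w‖ ≤ K → ‖z * (starRingEnd ℂ) w‖ ≤ K * K := fun z w hz hw => by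
    rw [norm_mul, RCLike.norm_conj]; exact mul_le_mul hz hw (norm_nonneg _) hK0
  have i1 : IntegrableOn (fun u => Real.exp (-(ε * u)) * u *
      (rampInt f a t u * (starRingEnd ℂ) (oscInt f a b u)).re) (Set.Ioi 0) :=
    integrableOn_weight_mul hε (by fun_prop) fun u =>
      (Complex.abs_re_le_norm _).trans (bd _ _ (hK t ht' u).2.2 (hK b hb' u).1)
  have i2 : IntegrableOn (fun u => Real.exp (-(ε * u)) * u *
      (rampInt f a t u * (starRingEnd ℂ) (oscInt f t b u)).re) (Set.Ioi 0) :=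
    integrableOn_weight_mul hε (by fun_prop) fun u =>
      (Complex.abs_re_le_norm _).trans (bd _ _ (hK t ht' u).2.2 (hK t ht' u).2.1)
  have i3 : IntegrableOn (fun u : ℝ => ((Real.exp (-(ε * u)) * u : ℝ) : ℂ) *
      (rampInt f a t u * (starRingEnd ℂ) (oscInt f t b u))) (Set.Ioi 0) :=
    (integrableOn_exp_mul_id hε).ofReal.mul_bdd (c := K * K)
      (Continuous.aestronglyMeasurable (by fun_prop))
      (Eventually.of_forall fun u => bd _ _ (hK t ht' u).2.2 (hK t ht' u).2.1)
  have e : (crossPairing f a b ε t).re = ∫ u in Set.Ioi (0 : ℝ), Real.exp (-(ε * u)) * u *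
      (rampInt f a t u * (starRingEnd ℂ) (oscInt f t b u)).re := by
    have := integral_re i3
    simp only [RCLike.re_to_complex, Complex.re_ofReal_mul] at this
    exact this.symm
  rw [e, directPairing, ← integral_sub i1 i2, rampPairing]
  congr 1; ext u
  rw [← oscInt_add_adjacent hf a t b u]
  simp only [map_add, mul_add, Complex.add_re, Complex.mul_re, Complex.conj_re, Complex.conj_im]
  ring

/-! ### Removing the exponential cutoff -/

/-- If `√u · f̂ ∈ L²(0, ∞)`, where `f̂ = oscInt f a b`, the energies with cutoff are bounded
uniformly in the cutoff: their derivative is at most the energy plus a constant, because the part of `f`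
to the right of `t` interacts with the ramp to the left of `t` only through `crossPairing`. -/
lemma exists_rampEnergy_bound {f : ℝ → ℂ} (hf : Continuous f) {a b : ℝ} (hab : a ≤ b)
    (hE : IntegrableOn (fun u => u * ‖oscInt f a b u‖ ^ 2) (Set.Ioi 0)) :
    ∃ C : ℝ, 0 ≤ C ∧ ∀ ε > 0, ∀ t ∈ Set.Icc a b,
      rampEnergy f a ε t ≤ C ∧ |rampPairing f a ε t| ≤ C := by
  obtain ⟨K, hK0, -, hK⟩ := exists_bound_osc hf hab
  obtain ⟨C₁, -, hC₁, hC₁b, -⟩ := exists_crossPairing_limit hf hab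
  set H : ℝ := ∫ u in Set.Ioi (0 : ℝ), u * ‖oscInt f a b u‖ ^ 2 with hH
  have hH0 : 0 ≤ H := setIntegral_nonneg measurableSet_Ioi fun u hu =>
    mul_nonneg (le_of_lt hu) (by positivity)
  have hEn : ∀ ε t, 0 ≤ rampEnergy f a ε t := fun ε t =>
    setIntegral_nonneg measurableSet_Ioi fun u hu =>
      mul_nonneg (mul_nonneg (Real.exp_nonneg _) (le_of_lt hu)) (by positivity)
  have hL : ∀ ε > 0, ∀ t ∈ Set.Icc a b,
      2 * |rampPairing f a ε t| ≤ rampEnergy f a ε t + (H + 2 * C₁) := by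
    intro ε hε t ht
    have ht' : t ∈ Set.Icc (a - 1) (b + 1) := ⟨by linarith [ht.1], by linarith [ht.2]⟩
    have i1 : IntegrableOn (fun u => Real.exp (-(ε * u)) * u * ‖rampInt f a t u‖ ^ 2)
        (Set.Ioi 0) :=
      integrableOn_weight_mul hε (by have := continuous_rampInt_freq hf a t; fun_prop)
        (K := K ^ 2) fun u => by
          rw [abs_of_nonneg (by positivity)]
          exact pow_le_pow_left₀ (norm_nonneg _) (hK t ht' u).2.2 2
    have hd : |directPairing f a b ε t| ≤ (1 / 2) * (rampEnergy f a ε t + H) := by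
      rw [directPairing, rampEnergy, hH, ← integral_add i1 hE, ← integral_const_mul,
        ← Real.norm_eq_abs]
      refine norm_integral_le_of_norm_le ((i1.add hE).const_mul _) ?_
      filter_upwards [ae_restrict_mem measurableSet_Ioi] with u hu
      have hu : 0 < u := hu
      have he : Real.exp (-(ε * u)) ≤ 1 := Real.exp_le_one_iff.2 (by nlinarith)
      have hr : |(rampInt f a t u * (starRingEnd ℂ) (oscInt f a b u)).re| ≤
          ‖rampInt f a t u‖ * ‖oscInt f a b u‖ := by
        refine (Complex.abs_re_le_norm _).trans ?_
        rw [norm_mul, RCLike.norm_conj]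
      rw [norm_mul, Real.norm_of_nonneg (by positivity), Real.norm_eq_abs]
      calc _ ≤ Real.exp (-(ε * u)) * u * (‖rampInt f a t u‖ * ‖oscInt f a b u‖) := by gcongr
        _ ≤ Real.exp (-(ε * u)) * u * ((1 / 2) *
              (‖rampInt f a t u‖ ^ 2 + ‖oscInt f a b u‖ ^ 2)) := by
            refine mul_le_mul_of_nonneg_left ?_ (by positivity)
            nlinarith [sq_nonneg (‖rampInt f a t u‖ - ‖oscInt f a b u‖)]
        _ = (1 / 2) * (Real.exp (-(ε * u)) * u * ‖rampInt f a t u‖ ^ 2 +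
              Real.exp (-(ε * u)) * (u * ‖oscInt f a b u‖ ^ 2)) := by ring
        _ ≤ (1 / 2) * (Real.exp (-(ε * u)) * u * ‖rampInt f a t u‖ ^ 2 +
              1 * (u * ‖oscInt f a b u‖ ^ 2)) := by gcongr
        _ = _ := by rw [one_mul]
    have hc := (Complex.abs_re_le_norm _).trans (hC₁b ε hε t ht)
    rw [rampPairing_eq hf hε ht]
    have := abs_sub (directPairing f a b ε t) (crossPairing f a b ε t).re
    linarith
  have hB : ∀ ε > 0, ∀ t ∈ Set.Icc a b,
      rampEnergy f a ε t ≤ (H + 2 * C₁) * Real.exp (b - a) := by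
    intro ε hε t ht
    have hsub : Set.Icc a b ⊆ Set.Ioo (a - 1) (b + 1) := fun s hs =>
      ⟨by linarith [hs.1], by linarith [hs.2]⟩
    have h := norm_le_gronwallBound_of_norm_deriv_right_le (f := rampEnergy f a ε)
      (f' := fun t => 2 * rampPairing f a ε t) (δ := 0) (K := 1) (ε := H + 2 * C₁) (a := a) (b := b)
      (fun s hs => (hasDerivAt_rampEnergy hf hab hε (hsub hs)).continuousAt.continuousWithinAt)
      (fun s hs => (hasDerivAt_rampEnergy hf hab hε
        (hsub (Set.Ico_subset_Icc_self hs))).hasDerivWithinAt)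
      (by simp [rampEnergy, rampInt, oscInt])
      (fun s hs => by
        rw [Real.norm_eq_abs, abs_mul, abs_two, Real.norm_of_nonneg (hEn ε s), one_mul]
        exact hL ε hε s (Set.Ico_subset_Icc_self hs)) t ht
    rw [Real.norm_of_nonneg (hEn ε t), gronwallBound_of_K_ne_0 one_ne_zero] at h
    refine h.trans ?_
    simp only [zero_mul, zero_add, div_one, one_mul]
    gcongr
    have := Real.exp_le_exp.2 (show t - a ≤ b - a by linarith [ht.2])
    linarith
  have hD0 : 0 ≤ (H + 2 * C₁) * Real.exp (b - a) := by positivity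
  refine ⟨(H + 2 * C₁) * Real.exp (b - a) + (H + 2 * C₁), by positivity, fun ε hε t ht => ⟨?_, ?_⟩⟩
  · linarith [hB ε hε t ht]
  · linarith [hB ε hε t ht, hL ε hε t ht, abs_nonneg (rampPairing f a ε t)]

lemma tendsto_exp_neg_mul (u : ℝ) :
    Tendsto (fun ε : ℝ => Real.exp (-(ε * u))) (𝓝[>] 0) (𝓝 1) := by
  have : Continuous fun ε : ℝ => Real.exp (-(ε * u)) := by fun_prop
  have h := this.tendsto 0
  simp only [zero_mul, neg_zero, Real.exp_zero] at h
  exact h.mono_left nhdsWithin_le_nhds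

/-- Removal of the cutoff in an absolutely convergent integral. -/
lemma tendsto_integral_exp_neg_smul {E : Type*} [NormedAddCommGroup E] [NormedSpace ℝ E]
    {g : ℝ → E} (hg : IntegrableOn g (Set.Ioi 0)) :
    Tendsto (fun ε : ℝ => ∫ u in Set.Ioi (0 : ℝ), Real.exp (-(ε * u)) • g u) (𝓝[>] 0)
      (𝓝 (∫ u in Set.Ioi (0 : ℝ), g u)) := by
  refine tendsto_integral_filter_of_dominated_convergence (fun u => ‖g u‖) ?_ ?_ hg.norm ?_
  · exact Eventually.of_forall fun ε =>
      (Continuous.aestronglyMeasurable (by fun_prop)).smul hg.aestronglyMeasurable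
  · filter_upwards [self_mem_nhdsWithin] with ε hε
    filter_upwards [ae_restrict_mem measurableSet_Ioi] with u hu
    have : Real.exp (-(ε * u)) ≤ 1 := Real.exp_le_one_iff.2
      (by have := mul_pos (Set.mem_Ioi.1 hε) (Set.mem_Ioi.1 hu); linarith)
    rw [norm_smul, Real.norm_of_nonneg (Real.exp_nonneg _)]
    exact mul_le_of_le_one_left (norm_nonneg _) this
  · refine Eventually.of_forall fun u => ?_
    simpa using (tendsto_exp_neg_mul u).smul_const (g u)

lemma integrableOn_rampInt_sq {f : ℝ → ℂ} (hf : Continuous f) {a t C : ℝ}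
    (hC : ∀ ε > 0, rampEnergy f a ε t ≤ C)
    (hint : ∀ ε > 0, IntegrableOn (fun u => Real.exp (-(ε * u)) * u * ‖rampInt f a t u‖ ^ 2)
      (Set.Ioi 0)) :
    IntegrableOn (fun u => u * ‖rampInt f a t u‖ ^ 2) (Set.Ioi 0) := by
  have hc : Continuous fun u => u * ‖rampInt f a t u‖ ^ 2 := by
    have := continuous_rampInt_freq hf a t
    fun_prop
  refine integrableOn_Ioi_of_intervalIntegral_norm_bounded (Real.exp 1 * C) 0
    (l := atTop) (b := fun x : ℝ => x) (fun x => hc.integrableOn_Ioc) tendsto_id ?_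
  filter_upwards [eventually_gt_atTop 0] with x hx
  have hε : 0 < x⁻¹ := inv_pos.2 hx
  have h1 : rampEnergy f a x⁻¹ t ≤ C := hC _ hε
  refine le_trans ?_ (mul_le_mul_of_nonneg_left h1 (Real.exp_nonneg 1))
  rw [intervalIntegral.integral_of_le hx.le, rampEnergy, ← integral_const_mul]
  have hi : IntegrableOn (fun u => Real.exp 1 *
      (Real.exp (-(x⁻¹ * u)) * u * ‖rampInt f a t u‖ ^ 2)) (Set.Ioi 0) := (hint _ hε).const_mul _
  refine (setIntegral_mono_on hc.norm.integrableOn_Ioc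
    (hi.mono_set Set.Ioc_subset_Ioi_self) measurableSet_Ioc ?_).trans
    (setIntegral_mono_set hi ?_ Set.Ioc_subset_Ioi_self.eventuallyLE)
  · intro u hu
    have h2 : 1 ≤ Real.exp 1 * Real.exp (-(x⁻¹ * u)) := by
      rw [← Real.exp_add]
      refine Real.one_le_exp ?_
      have : x⁻¹ * u ≤ x⁻¹ * x := mul_le_mul_of_nonneg_left hu.2 hε.le
      rw [inv_mul_cancel₀ hx.ne'] at this
      linarith
    have h3 : 0 ≤ u * ‖rampInt f a t u‖ ^ 2 := mul_nonneg hu.1.le (by positivity)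
    rw [Real.norm_of_nonneg h3]
    calc _ ≤ (Real.exp 1 * Real.exp (-(x⁻¹ * u))) * (u * ‖rampInt f a t u‖ ^ 2) :=
          le_mul_of_one_le_left h3 h2
      _ = _ := by ring
  · filter_upwards [ae_restrict_mem measurableSet_Ioi] with u hu
    have hu : 0 < u := hu
    simp only [Pi.zero_apply]
    positivity

/-- The derivative of `t ↦ ∫_0^∞ u |P_t(u)|² du`, where `P_t(u) = ∫_a^t (t - s) e^{ius} f(s) ds`,
for a function `f` on `[a, b]` whose Fourier transform satisfies `√u · f̂ ∈ L²(0, ∞)`. -/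
theorem exists_hasDerivAt_rampEnergy {f : ℝ → ℂ} (hf : Continuous f) {a b : ℝ} (hab : a ≤ b)
    (hE : IntegrableOn (fun u => u * ‖oscInt f a b u‖ ^ 2) (Set.Ioi 0)) :
    ∃ (C : ℝ) (ℓ : ℝ → ℝ), ∀ t ∈ Set.Ioo a b,
      IntegrableOn (fun u => u * ‖rampInt f a t u‖ ^ 2) (Set.Ioi 0) ∧ |ℓ t| ≤ C ∧
      HasDerivAt (fun t => ∫ u in Set.Ioi (0 : ℝ), u * ‖rampInt f a t u‖ ^ 2) (2 * ℓ t) t ∧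
      Tendsto (fun ε => rampPairing f a ε t) (𝓝[>] 0) (𝓝 (ℓ t)) := by
  obtain ⟨K, hK0, -, hK⟩ := exists_bound_osc hf hab
  obtain ⟨C, hC0, hC⟩ := exists_rampEnergy_bound hf hab hE
  obtain ⟨-, Ω, -, -, hΩ⟩ := exists_crossPairing_limit hf hab
  have hIcc : ∀ t ∈ Set.Icc a b, t ∈ Set.Icc (a - 1) (b + 1) := fun t ht =>
    ⟨by linarith [ht.1], by linarith [ht.2]⟩
  have cP : ∀ t, Continuous (rampInt f a t) := fun t => continuous_rampInt_freq hf a t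
  have cF := continuous_oscInt_freq hf a b
  have hint : ∀ ε > 0, ∀ t ∈ Set.Icc a b,
      IntegrableOn (fun u => Real.exp (-(ε * u)) * u * ‖rampInt f a t u‖ ^ 2) (Set.Ioi 0) :=
    fun ε hε t ht => integrableOn_weight_mul hε (by have := cP t; fun_prop)
      (K := K ^ 2) fun u => by
        rw [abs_of_nonneg (by positivity)]
        exact pow_le_pow_left₀ (norm_nonneg _) (hK t (hIcc t ht) u).2.2 2
  have hP : ∀ t ∈ Set.Icc a b, IntegrableOn (fun u => u * ‖rampInt f a t u‖ ^ 2) (Set.Ioi 0) :=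
    fun t ht => integrableOn_rampInt_sq hf (fun ε hε => (hC ε hε t ht).1)
      fun ε hε => hint ε hε t ht
  have hElim : ∀ t ∈ Set.Icc a b, Tendsto (fun ε => rampEnergy f a ε t) (𝓝[>] 0)
      (𝓝 (∫ u in Set.Ioi (0 : ℝ), u * ‖rampInt f a t u‖ ^ 2)) := fun t ht => by
    refine (tendsto_integral_exp_neg_smul (hP t ht)).congr fun ε => ?_
    rw [rampEnergy]; simp_rw [mul_assoc, smul_eq_mul]
  have hPC : ∀ t ∈ Set.Icc a b, ∫ u in Set.Ioi (0 : ℝ), u * ‖rampInt f a t u‖ ^ 2 ≤ C :=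
    fun t ht => le_of_tendsto (hElim t ht)
      (by filter_upwards [self_mem_nhdsWithin] with ε hε using (hC ε hε t ht).1)
  have hprod : ∀ t ∈ Set.Icc a b, IntegrableOn (fun u => u *
      (rampInt f a t u * (starRingEnd ℂ) (oscInt f a b u)).re) (Set.Ioi 0) := fun t ht => by
    refine Integrable.mono' ((hP t ht).add hE)
      (Continuous.aestronglyMeasurable (by have := cP t; fun_prop)) ?_
    filter_upwards [ae_restrict_mem measurableSet_Ioi] with u hu
    have hu : 0 < u := hu
    have hr : |(rampInt f a t u * (starRingEnd ℂ) (oscInt f a b u)).re| ≤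
        ‖rampInt f a t u‖ * ‖oscInt f a b u‖ := by
      refine (Complex.abs_re_le_norm _).trans ?_
      rw [norm_mul, RCLike.norm_conj]
    rw [norm_mul, Real.norm_of_nonneg hu.le, Real.norm_eq_abs]
    calc _ ≤ u * (‖rampInt f a t u‖ ^ 2 + ‖oscInt f a b u‖ ^ 2) := by
          gcongr
          nlinarith [sq_nonneg (‖rampInt f a t u‖ - ‖oscInt f a b u‖), hr,
            sq_nonneg ‖rampInt f a t u‖, sq_nonneg ‖oscInt f a b u‖]
      _ = _ := by simp only [Pi.add_apply]; ring
  set A : ℝ → ℝ := fun t => ∫ u in Set.Ioi (0 : ℝ), u *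
      (rampInt f a t u * (starRingEnd ℂ) (oscInt f a b u)).re with hA
  -- `|1 - e^{-εu}| |P| |f̂| ≤ δ |P|² + δ⁻¹ (1 - e^{-εu}) |f̂|²`, and the first term is small
  -- uniformly in `t`, while the second does not depend on `t`.
  have hAu : TendstoUniformlyOn (fun ε t => directPairing f a b ε t) A (𝓝[>] (0 : ℝ))
      (Set.Icc a b) := by
    rw [Metric.tendstoUniformlyOn_iff]
    intro η hη
    set δ : ℝ := η / (2 * (C + 1)) with hδ
    have hδ0 : 0 < δ := by positivity
    have hκ : Tendsto (fun ε : ℝ => δ⁻¹ * ((∫ u in Set.Ioi (0 : ℝ), u * ‖oscInt f a b u‖ ^ 2) -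
        ∫ u in Set.Ioi (0 : ℝ), Real.exp (-(ε * u)) * (u * ‖oscInt f a b u‖ ^ 2)))
        (𝓝[>] 0) (𝓝 0) := by
      have := ((tendsto_integral_exp_neg_smul (E := ℝ) hE).const_sub
        (∫ u in Set.Ioi (0 : ℝ), u * ‖oscInt f a b u‖ ^ 2)).const_mul δ⁻¹
      simpa using this
    filter_upwards [hκ.eventually (gt_mem_nhds (half_pos hη)), self_mem_nhdsWithin]
      with ε hε hε0 t ht
    have hε0 : 0 < ε := hε0
    have hEe : IntegrableOn (fun u => Real.exp (-(ε * u)) * (u * ‖oscInt f a b u‖ ^ 2))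
        (Set.Ioi 0) :=
      hE.bdd_mul (c := 1) (Continuous.aestronglyMeasurable (by fun_prop)) (by
        filter_upwards [ae_restrict_mem measurableSet_Ioi] with u hu
        rw [Real.norm_of_nonneg (Real.exp_nonneg _)]
        exact Real.exp_le_one_iff.2
          (by have := mul_pos (Set.mem_Ioi.1 hε0) (Set.mem_Ioi.1 hu); linarith))
    have hdi : IntegrableOn (fun u => Real.exp (-(ε * u)) * (u *
        (rampInt f a t u * (starRingEnd ℂ) (oscInt f a b u)).re)) (Set.Ioi 0) :=
      (hprod t ht).bdd_mul (c := 1) (Continuous.aestronglyMeasurable (by fun_prop)) (by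
        filter_upwards [ae_restrict_mem measurableSet_Ioi] with u hu
        rw [Real.norm_of_nonneg (Real.exp_nonneg _)]
        exact Real.exp_le_one_iff.2
          (by have := mul_pos (Set.mem_Ioi.1 hε0) (Set.mem_Ioi.1 hu); linarith))
    have hsub : IntegrableOn (fun u => δ⁻¹ * (u * ‖oscInt f a b u‖ ^ 2 -
        Real.exp (-(ε * u)) * (u * ‖oscInt f a b u‖ ^ 2))) (Set.Ioi 0) :=
      (hE.sub hEe).const_mul _
    have hle : |A t - directPairing f a b ε t| ≤
        δ * (∫ u in Set.Ioi (0 : ℝ), u * ‖rampInt f a t u‖ ^ 2) +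
        δ⁻¹ * ((∫ u in Set.Ioi (0 : ℝ), u * ‖oscInt f a b u‖ ^ 2) -
        ∫ u in Set.Ioi (0 : ℝ), Real.exp (-(ε * u)) * (u * ‖oscInt f a b u‖ ^ 2)) := by
      rw [hA, directPairing]
      simp_rw [mul_assoc]
      rw [← integral_sub (hprod t ht) hdi, ← integral_sub hE hEe, ← integral_const_mul,
        ← integral_const_mul, ← integral_add ((hP t ht).const_mul _) hsub, ← Real.norm_eq_abs]
      refine norm_integral_le_of_norm_le (((hP t ht).const_mul _).add hsub) ?_
      filter_upwards [ae_restrict_mem measurableSet_Ioi] with u hu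
      have hu : 0 < u := hu
      have he : Real.exp (-(ε * u)) ≤ 1 :=
        Real.exp_le_one_iff.2 (by have := mul_pos hε0 hu; linarith)
      have he0 := Real.exp_pos (-(ε * u))
      set e := Real.exp (-(ε * u))
      set x := ‖rampInt f a t u‖
      set y := ‖oscInt f a b u‖
      have hr : |(rampInt f a t u * (starRingEnd ℂ) (oscInt f a b u)).re| ≤ x * y := by
        refine (Complex.abs_re_le_norm _).trans ?_
        rw [norm_mul, RCLike.norm_conj]
      rw [← one_sub_mul, norm_mul, norm_mul, Real.norm_of_nonneg (by linarith),
        Real.norm_of_nonneg hu.le, Real.norm_eq_abs]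
      have h4 : (1 - e) * (x * y) ≤ δ * x ^ 2 + δ⁻¹ * ((1 - e) * y ^ 2) := by
        have h5 : x * ((1 - e) * y) ≤ δ * x ^ 2 + δ⁻¹ * ((1 - e) * y) ^ 2 := by
          have h6 := sq_nonneg (δ * x - (1 - e) * y)
          have h7 : δ * x ^ 2 + δ⁻¹ * ((1 - e) * y) ^ 2 - x * ((1 - e) * y) =
              δ⁻¹ * ((δ * x - (1 - e) * y) ^ 2 + δ * (x * ((1 - e) * y))) := by
            field_simp; ring
          have h8 : 0 ≤ x * ((1 - e) * y) :=
            mul_nonneg (norm_nonneg _) (mul_nonneg (by linarith) (norm_nonneg _))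
          have h9 : 0 ≤ δ⁻¹ * ((δ * x - (1 - e) * y) ^ 2 + δ * (x * ((1 - e) * y))) := by
            positivity
          linarith
        have h10 : ((1 - e) * y) ^ 2 ≤ (1 - e) * y ^ 2 := by
          rw [mul_pow]
          refine mul_le_mul_of_nonneg_right ?_ (sq_nonneg y)
          nlinarith
        have h11 := mul_le_mul_of_nonneg_left h10 (inv_nonneg.2 hδ0.le)
        nlinarith
      calc _ ≤ (1 - e) * (u * (x * y)) := by
            refine mul_le_mul_of_nonneg_left (mul_le_mul_of_nonneg_left hr hu.le) (by linarith)
        _ = u * ((1 - e) * (x * y)) := by ring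
        _ ≤ u * (δ * x ^ 2 + δ⁻¹ * ((1 - e) * y ^ 2)) := by gcongr
        _ = _ := by ring
    rw [Real.dist_eq]
    refine lt_of_le_of_lt hle ?_
    have h12 : δ * (∫ u in Set.Ioi (0 : ℝ), u * ‖rampInt f a t u‖ ^ 2) ≤ η / 2 := by
      refine (mul_le_mul_of_nonneg_left (hPC t ht) hδ0.le).trans ?_
      rw [hδ, div_mul_eq_mul_div, div_le_div_iff₀ (by positivity) two_pos]
      nlinarith
    linarith
  have hLu : TendstoUniformlyOn (fun ε t => rampPairing f a ε t) (fun t => A t - (Ω t).re)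
      (𝓝[>] (0 : ℝ)) (Set.Icc a b) := by
    have h1 : TendstoUniformlyOn (fun ε t => (crossPairing f a b ε t).re) (fun t => (Ω t).re)
        (𝓝[>] (0 : ℝ)) (Set.Icc a b) :=
      Complex.reCLM.lipschitz.uniformContinuous.comp_tendstoUniformlyOn hΩ
    refine (hAu.sub h1).congr ?_
    filter_upwards [self_mem_nhdsWithin] with ε hε t ht
    exact (rampPairing_eq hf hε ht).symm
  refine ⟨C, fun t => A t - (Ω t).re, fun t ht => ?_⟩
  have ht' := Set.Ioo_subset_Icc_self ht
  have hpt := hLu.tendsto_at ht'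
  refine ⟨hP t ht', ?_, ?_, hpt⟩
  · refine le_of_tendsto hpt.abs ?_
    filter_upwards [self_mem_nhdsWithin] with ε hε using (hC ε hε t ht').2
  · have h2 : TendstoUniformlyOn (fun ε t => 2 * rampPairing f a ε t)
        (fun t => 2 * (A t - (Ω t).re)) (𝓝[>] (0 : ℝ)) (Set.Ioo a b) :=
      ((Real.uniformContinuous_const_mul (x := 2)).comp_tendstoUniformlyOn hLu).mono
        Set.Ioo_subset_Icc_self
    refine hasDerivAt_of_tendstoUniformlyOn (l := 𝓝[>] (0 : ℝ)) isOpen_Ioo h2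
      (f := fun ε => rampEnergy f a ε) ?_
      (fun s hs => hElim s (Set.Ioo_subset_Icc_self hs)) ht
    filter_upwards [self_mem_nhdsWithin] with ε hε s hs
    exact hasDerivAt_rampEnergy hf hab hε ⟨by linarith [hs.1], by linarith [hs.2]⟩

/-! ### Improper integrals and Abel summation -/

/-- Abel summation: an improper integral is the limit of its regularizations by `e^{-εu}`. -/
lemma tendsto_integral_exp_neg_mul_of_tendsto_intervalIntegral {g : ℝ → ℂ} (hg : Continuous g)
    (hint : ∀ ε > 0, IntegrableOn (fun u : ℝ => Real.exp (-(ε * u)) • g u) (Set.Ioi 0)) {j : ℂ}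
    (hj : Tendsto (fun U : ℝ => ∫ u in (0 : ℝ)..U, g u) atTop (𝓝 j)) :
    Tendsto (fun ε : ℝ => ∫ u in Set.Ioi (0 : ℝ), Real.exp (-(ε * u)) • g u) (𝓝[>] 0) (𝓝 j) := by
  set Φ : ℝ → ℂ := fun U => ∫ u in (0 : ℝ)..U, g u with hΦ
  have hΦd : ∀ u, HasDerivAt Φ (g u) u := fun u =>
    intervalIntegral.integral_hasDerivAt_right (hg.intervalIntegrable _ _)
      hg.stronglyMeasurable.stronglyMeasurableAtFilter hg.continuousAt
  have hΦc : Continuous Φ := continuous_iff_continuousAt.2 fun u => (hΦd u).continuousAt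
  obtain ⟨C, hC⟩ : ∃ C, ∀ u ∈ Set.Ici (0 : ℝ), ‖Φ u‖ ≤ C := by
    obtain ⟨U, hU⟩ := (hj.norm.eventually (gt_mem_nhds (lt_add_one ‖j‖))).exists_forall_of_atTop
    obtain ⟨B, hB⟩ := (isCompact_Icc (a := (0 : ℝ)) (b := U)).exists_bound_of_continuousOn
      hΦc.continuousOn
    refine ⟨max B (‖j‖ + 1), fun u hu => ?_⟩
    rcases le_total u U with h | h
    · exact (hB u ⟨hu, h⟩).trans (le_max_left _ _)
    · exact (hU u h).le.trans (le_max_right _ _)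
  have hexp : ∀ ε : ℝ, 0 < ε → IntegrableOn (fun u : ℝ => Real.exp (-(ε * u))) (Set.Ioi 0) :=
    fun ε hε => by simpa only [neg_mul] using integrableOn_exp_mul_Ioi (neg_lt_zero.2 hε) 0
  have hΦint : ∀ ε : ℝ, 0 < ε →
      IntegrableOn (fun u : ℝ => Real.exp (-(ε * u)) • Φ u) (Set.Ioi 0) := fun ε hε => by
    refine ((hexp ε hε).mul_const C).mono' (Continuous.aestronglyMeasurable (by fun_prop)) ?_
    filter_upwards [ae_restrict_mem measurableSet_Ioi] with u hu
    rw [norm_smul, Real.norm_of_nonneg (Real.exp_nonneg _)]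
    exact mul_le_mul_of_nonneg_left (hC u (Set.mem_Ici.2 (le_of_lt hu))) (Real.exp_nonneg _)
  have hparts : ∀ ε : ℝ, 0 < ε → ∫ u in Set.Ioi (0 : ℝ), Real.exp (-(ε * u)) • g u =
      ∫ x in Set.Ioi (0 : ℝ), Real.exp (-x) • Φ (ε⁻¹ * x) := fun ε hε => by
    have hd : ∀ u : ℝ, HasDerivAt (fun u : ℝ => Real.exp (-(ε * u)) • Φ u)
        (Real.exp (-(ε * u)) • g u - ε • (Real.exp (-(ε * u)) • Φ u)) u := fun u => by
      have h1 : HasDerivAt (fun u : ℝ => Real.exp (-(ε * u))) (Real.exp (-(ε * u)) * -(ε * 1)) u :=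
        (((hasDerivAt_id u).const_mul ε).fun_neg).exp
      refine (h1.smul (hΦd u)).congr_deriv ?_
      rw [smul_smul, sub_eq_add_neg, ← neg_smul]
      congr 2; ring
    have hl : Tendsto (fun u : ℝ => Real.exp (-(ε * u)) • Φ u) atTop (𝓝 0) := by
      have := (Real.tendsto_exp_neg_atTop_nhds_zero.comp
        (tendsto_id.const_mul_atTop hε)).smul hj
      simpa using this
    have hsm : IntegrableOn (fun u : ℝ => ε • (Real.exp (-(ε * u)) • Φ u)) (Set.Ioi 0) :=
      (hΦint ε hε).smul ε
    have h := integral_Ioi_of_hasDerivAt_of_tendsto' (a := 0) (fun u _ => hd u)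
      ((hint ε hε).sub hsm) hl
    rw [integral_sub (hint ε hε) hsm, integral_smul] at h
    simp only [hΦ, intervalIntegral.integral_same, smul_zero, sub_zero] at h
    rw [sub_eq_zero.1 h]
    have h2 := integral_comp_mul_left_Ioi (fun x => Real.exp (-x) • Φ (ε⁻¹ * x)) 0 hε
    simp only [mul_zero] at h2
    rw [eq_inv_smul_iff₀ hε.ne'] at h2
    rw [← h2]
    simp only [inv_mul_cancel_left₀ hε.ne', hΦ]
  have hlim : Tendsto (fun ε : ℝ => ∫ x in Set.Ioi (0 : ℝ), Real.exp (-x) • Φ (ε⁻¹ * x)) (𝓝[>] 0)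
      (𝓝 (∫ x in Set.Ioi (0 : ℝ), Real.exp (-x) • j)) := by
    refine tendsto_integral_filter_of_dominated_convergence (fun x => Real.exp (-x) * C) ?_ ?_ ?_ ?_
    · exact Eventually.of_forall fun ε => Continuous.aestronglyMeasurable (by fun_prop)
    · filter_upwards [self_mem_nhdsWithin] with ε hε
      filter_upwards [ae_restrict_mem measurableSet_Ioi] with x hx
      rw [norm_smul, Real.norm_of_nonneg (Real.exp_nonneg _)]
      exact mul_le_mul_of_nonneg_left
        (hC _ (Set.mem_Ici.2 (mul_nonneg (inv_nonneg.2 (le_of_lt hε)) (le_of_lt hx))))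
        (Real.exp_nonneg _)
    · simpa using (hexp 1 one_pos).mul_const C
    · filter_upwards [ae_restrict_mem measurableSet_Ioi] with x hx
      refine Tendsto.const_smul (hj.comp ?_) _
      exact tendsto_inv_nhdsGT_zero.atTop_mul_const hx
  rw [integral_smul_const, integral_exp_neg_Ioi_zero, one_smul] at hlim
  refine hlim.congr' ?_
  filter_upwards [self_mem_nhdsWithin] with ε hε using (hparts ε hε).symm

/-- If the oscillatory integral up to `t` is, up to a function `D` with `√u · D ∈ L²(0, ∞)`, equal
to the contribution `-iq e^{iut} / (u + lam)` of its end point, then it has a convergent improper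
pairing with `rampInt f a t`. The contribution of the end point is integrated by parts. -/
lemma exists_tendsto_intervalIntegral_pairing {f : ℝ → ℂ} (hf : Continuous f) {a t lam : ℝ}
    (hlam : 0 < lam) {q : ℂ}
    (hP : IntegrableOn (fun u => u * ‖rampInt f a t u‖ ^ 2) (Set.Ioi 0))
    (hD : IntegrableOn (fun u : ℝ => u * ‖oscInt f a t u +
      Complex.I * q * Complex.exp (Complex.I * u * t) / (u + lam)‖ ^ 2) (Set.Ioi 0)) :
    ∃ j : ℂ, Tendsto (fun U : ℝ => ∫ u in (0 : ℝ)..U,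
      (u : ℂ) * (oscInt f a t u * (starRingEnd ℂ) (rampInt f a t u))) atTop (𝓝 j) := by
  have cP := continuous_rampInt_freq hf a t
  have cF := continuous_oscInt_freq hf a t
  have hne : ∀ u ∈ Set.Ici (0 : ℝ), (u : ℂ) + lam ≠ 0 := fun u hu => by
    have : (0 : ℝ) < u + lam := add_pos_of_nonneg_of_pos hu hlam
    exact_mod_cast this.ne'
  set D : ℝ → ℂ := fun u => oscInt f a t u +
      Complex.I * q * Complex.exp (Complex.I * u * t) / (u + lam) with hDdef
  have cD : ContinuousOn D (Set.Ici 0) := by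
    refine cF.continuousOn.add (ContinuousOn.div (by fun_prop) (by fun_prop) hne)
  set h : ℝ → ℂ := fun u => (starRingEnd ℂ) (Complex.exp (-(Complex.I * u * t)) * oscInt f a t u)
    with hh
  set h' : ℝ → ℂ := fun u => Complex.I * (Complex.exp (Complex.I * u * t) *
    (starRingEnd ℂ) (rampInt f a t u)) with hh'
  have hd : ∀ u, HasDerivAt h (h' u) u := fun u => by
    have := (hasDerivAt_exp_mul_oscInt hf a t u).star
    refine this.congr_deriv ?_
    simp only [hh', RCLike.star_def, map_neg, map_mul, Complex.conj_I, ← Complex.exp_conj,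
      Complex.conj_ofReal]
    simp only [neg_mul, neg_neg]
  have ch' : Continuous h' := by fun_prop
  have hh0 : Tendsto h atTop (𝓝 0) := by
    rw [tendsto_zero_iff_norm_tendsto_zero]
    refine (tendsto_oscInt_atTop f a t).norm.congr' ?_ |>.trans (by simp)
    refine Eventually.of_forall fun u => ?_
    have := norm_exp_I_mul_mul u (-t)
    simp only [hh, RCLike.norm_conj, norm_mul]
    rw [show -(Complex.I * u * t) = Complex.I * u * ((-t : ℝ) : ℂ) by push_cast; ring, this,
      one_mul]
  have ch : Continuous h := continuous_iff_continuousAt.2 fun u => (hd u).continuousAt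
  obtain ⟨B, hB⟩ : ∃ B, ∀ u, ‖h u‖ ≤ B := by
    obtain ⟨B, hB⟩ := isCompact_uIcc.exists_bound_of_continuousOn (s := Set.uIcc a t)
      hf.continuousOn
    refine ⟨B * |t - a|, fun u => ?_⟩
    have := norm_exp_I_mul_mul u (-t)
    simp only [hh, RCLike.norm_conj, norm_mul]
    rw [show -(Complex.I * u * t) = Complex.I * u * ((-t : ℝ) : ℂ) by push_cast; ring, this,
      one_mul]
    exact norm_oscInt_le (fun s hs => hB s (Set.uIoc_subset_uIcc hs)) u
  -- the weight `u / (u + lam)` and its derivative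
  set k : ℝ → ℝ := fun u => u / (u + lam) with hk
  have hkd : ∀ u ∈ Set.Ici (0 : ℝ), HasDerivAt k (lam / (u + lam) ^ 2) u := fun u hu => by
    have : u + lam ≠ 0 := (add_pos_of_nonneg_of_pos hu hlam).ne'
    refine ((hasDerivAt_id u).div ((hasDerivAt_id u).add_const lam) this).congr_deriv ?_
    simp
  have ck' : ContinuousOn (fun u : ℝ => lam / (u + lam) ^ 2) (Set.Ici 0) := by
    refine ContinuousOn.div (by fun_prop) (by fun_prop) fun u hu => ?_
    exact pow_ne_zero 2 (add_pos_of_nonneg_of_pos hu hlam).ne'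
  have hk1 : Tendsto k atTop (𝓝 1) := by
    have h1 : Tendsto (fun u : ℝ => 1 - lam / (u + lam)) atTop (𝓝 (1 - 0)) :=
      (tendsto_const_nhds.div_atTop (tendsto_atTop_add_const_right _ _ tendsto_id)).const_sub 1
    rw [sub_zero] at h1
    refine h1.congr' ?_
    filter_upwards [eventually_ge_atTop 0] with u hu
    have : u + lam ≠ 0 := (add_pos_of_nonneg_of_pos hu hlam).ne'
    rw [hk]; field_simp; ring
  have ik' : IntegrableOn (fun u : ℝ => lam / (u + lam) ^ 2) (Set.Ioi 0) :=
    integrableOn_Ioi_deriv_of_nonneg' (g := k) (fun u hu => hkd u hu)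
      (fun u _ => by positivity) hk1
  have ik'h : IntegrableOn (fun u : ℝ => ((lam / (u + lam) ^ 2 : ℝ) : ℂ) * h u) (Set.Ioi 0) :=
    ik'.ofReal.mul_bdd (c := B) ch.aestronglyMeasurable (Eventually.of_forall hB)
  have iD : IntegrableOn (fun u : ℝ => (u : ℂ) * (D u * (starRingEnd ℂ) (rampInt f a t u)))
      (Set.Ioi 0) := by
    refine Integrable.mono' (hD.add hP) (ContinuousOn.aestronglyMeasurable ?_ measurableSet_Ioi) ?_
    · have := cD.mono (Set.Ioi_subset_Ici_self (a := (0 : ℝ)))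
      fun_prop
    · filter_upwards [ae_restrict_mem measurableSet_Ioi] with u hu
      have hu : 0 < u := hu
      simp only [norm_mul, RCLike.norm_conj, Pi.add_apply, Complex.norm_real]
      rw [Real.norm_of_nonneg hu.le, ← mul_add]
      gcongr
      nlinarith [sq_nonneg (‖D u‖ - ‖rampInt f a t u‖), sq_nonneg ‖D u‖,
        sq_nonneg ‖rampInt f a t u‖]
  refine ⟨(∫ u in Set.Ioi (0 : ℝ), (u : ℂ) * (D u * (starRingEnd ℂ) (rampInt f a t u))) -
    q * (1 * 0 - (k 0 : ℂ) * h 0 - ∫ u in Set.Ioi (0 : ℝ), ((lam / (u + lam) ^ 2 : ℝ) : ℂ) *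
      h u), ?_⟩
  have l1 := intervalIntegral_tendsto_integral_Ioi 0 iD tendsto_id
  have l2 := intervalIntegral_tendsto_integral_Ioi 0 ik'h tendsto_id
  have l3 := ((Complex.continuous_ofReal.tendsto _).comp hk1).mul hh0
  refine (l1.sub (((l3.sub_const ((k 0 : ℂ) * h 0)).sub l2).const_mul q)).congr' ?_ |>.trans
    (by simp)
  filter_upwards [eventually_ge_atTop 0] with U hU
  have hsub : Set.uIcc 0 U ⊆ Set.Ici (0 : ℝ) := by
    rw [Set.uIcc_of_le hU]; exact Set.Icc_subset_Ici_self
  have hparts := intervalIntegral.integral_mul_deriv_eq_deriv_mul (a := 0) (b := U)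
    (u := fun u => (k u : ℂ)) (v := h) (u' := fun u => ((lam / (u + lam) ^ 2 : ℝ) : ℂ)) (v' := h')
    (fun u hu => (hkd u (hsub hu)).ofReal_comp) (fun u _ => hd u)
    (ContinuousOn.intervalIntegrable
      (Complex.continuous_ofReal.comp_continuousOn (ck'.mono hsub)))
    (ch'.intervalIntegrable _ _)
  simp only [id, Function.comp]
  rw [← hparts, ← intervalIntegral.integral_const_mul, ← intervalIntegral.integral_sub]
  · refine intervalIntegral.integral_congr fun u hu => ?_
    have h0 := hne u (hsub hu)
    simp only [hDdef, hh', hk]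
    push_cast
    field_simp
    ring
  · refine ContinuousOn.intervalIntegrable ?_
    have := cD.mono hsub
    fun_prop
  · refine ContinuousOn.intervalIntegrable ?_
    have ck : ContinuousOn k (Set.uIcc 0 U) := fun u hu =>
      (hkd u (hsub hu)).continuousAt.continuousWithinAt
    fun_prop

/-! ### Radial integrals in the plane -/

/-- The image of Lebesgue measure on the plane under `k ↦ |k|²` is `π` times Lebesgue measure on the
half line. -/
lemma map_norm_sq_volume :
    Measure.map (fun k : Plane => ‖k‖ ^ 2) volume =
      ENNReal.ofReal Real.pi • volume.restrict (Set.Ioi (0 : ℝ)) := by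
  have hm : Measurable fun k : Plane => ‖k‖ ^ 2 := by fun_prop
  have : IsLocallyFiniteMeasure (ENNReal.ofReal Real.pi • volume.restrict (Set.Ioi (0 : ℝ))) :=
    inferInstanceAs
      (IsLocallyFiniteMeasure (Real.toNNReal Real.pi • volume.restrict (Set.Ioi (0 : ℝ))))
  refine (Real.measure_ext_Ioo_rat fun p q => ?_).symm
  rw [Measure.map_apply hm measurableSet_Ioo, Measure.smul_apply,
    Measure.restrict_apply measurableSet_Ioo, smul_eq_mul]
  rcases le_or_gt (q : ℝ) (max 0 p) with hq | hq
  · have e1 : Set.Ioo (p : ℝ) q ∩ Set.Ioi 0 = ∅ := by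
      ext x
      simp only [Set.mem_inter_iff, Set.mem_Ioo, Set.mem_Ioi, Set.mem_empty_iff_false, iff_false]
      rintro ⟨⟨h1, h2⟩, h3⟩
      exact absurd (max_lt h3 h1) (not_lt.2 (h2.le.trans hq))
    have e2 : volume ((fun k : Plane => ‖k‖ ^ 2) ⁻¹' Set.Ioo (p : ℝ) q) = 0 := by
      refine measure_mono_null (t := {0}) (fun k hk => ?_) (measure_singleton _)
      by_contra h
      have : 0 < ‖k‖ ^ 2 := by have := norm_pos_iff.2 h; positivity
      exact absurd (max_lt this hk.1) (not_lt.2 (hk.2.le.trans hq))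
    rw [e1, e2, measure_empty, mul_zero]
  · have hq0 : (0 : ℝ) < q := (le_max_left _ _).trans_lt hq
    set p' : ℝ := max 0 p with hp'
    have hp0 : 0 ≤ p' := le_max_left _ _
    have e1 : Set.Ioo (p : ℝ) q ∩ Set.Ioi 0 = Set.Ioo p' q := by
      ext x
      simp only [Set.mem_inter_iff, Set.mem_Ioo, Set.mem_Ioi, hp', max_lt_iff]
      tauto
    have e2 : volume ((fun k : Plane => ‖k‖ ^ 2) ⁻¹' Set.Ioo (p : ℝ) q) =
        volume (Metric.ball (0 : Plane) √q \ Metric.closedBall 0 √p') := by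
      refine measure_congr ?_
      have hz : ∀ᵐ k : Plane, k ≠ 0 := by
        rw [ae_iff]; simp
      filter_upwards [hz] with k hk
      have hk0 : 0 < ‖k‖ ^ 2 := by have := norm_pos_iff.2 hk; positivity
      refine propext ?_
      change (p : ℝ) < ‖k‖ ^ 2 ∧ ‖k‖ ^ 2 < q ↔ k ∈ Metric.ball 0 √q \ Metric.closedBall 0 √p'
      rw [Set.mem_sdiff, mem_ball_zero_iff, mem_closedBall_zero_iff, not_le,
        Real.lt_sqrt (norm_nonneg _), Real.sqrt_lt hp0 (norm_nonneg _), hp', max_lt_iff]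
      tauto
    rw [e1, e2, measure_sdiff (Metric.closedBall_subset_ball (Real.sqrt_lt_sqrt hp0 hq))
      measurableSet_closedBall.nullMeasurableSet measure_closedBall_lt_top.ne,
      EuclideanSpace.volume_ball_fin_two, EuclideanSpace.volume_closedBall_fin_two,
      Real.volume_Ioo, ← ENNReal.ofReal_pow (Real.sqrt_nonneg _),
      ← ENNReal.ofReal_pow (Real.sqrt_nonneg _), Real.sq_sqrt hq0.le, Real.sq_sqrt hp0,
      ENNReal.ofReal_sub _ hp0, ENNReal.mul_sub (by simp), mul_comm, mul_comm (ENNReal.ofReal p')]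

lemma measurable_norm_sq : Measurable fun k : Plane => ‖k‖ ^ 2 := by fun_prop

lemma aestronglyMeasurable_map_norm_sq {E : Type*} [NormedAddCommGroup E] {h : ℝ → E}
    (hm : AEStronglyMeasurable h (volume.restrict (Set.Ioi (0 : ℝ)))) :
    AEStronglyMeasurable h (Measure.map (fun k : Plane => ‖k‖ ^ 2) volume) := by
  rw [map_norm_sq_volume]; exact hm.smul_measure _

lemma integrable_radial_iff {E : Type*} [NormedAddCommGroup E] {h : ℝ → E}
    (hm : AEStronglyMeasurable h (volume.restrict (Set.Ioi (0 : ℝ)))) :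
    Integrable (fun k : Plane => h (‖k‖ ^ 2)) ↔ IntegrableOn h (Set.Ioi 0) := by
  have := integrable_map_measure (aestronglyMeasurable_map_norm_sq hm)
    measurable_norm_sq.aemeasurable
  rw [map_norm_sq_volume, integrable_smul_measure (by simp [Real.pi_pos]) (by simp)] at this
  exact this.symm

lemma integral_radial {E : Type*} [NormedAddCommGroup E] [NormedSpace ℝ E] {h : ℝ → E}
    (hm : AEStronglyMeasurable h (volume.restrict (Set.Ioi (0 : ℝ)))) :
    ∫ k : Plane, h (‖k‖ ^ 2) = Real.pi • ∫ u in Set.Ioi (0 : ℝ), h u := by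
  have := integral_map measurable_norm_sq.aemeasurable (aestronglyMeasurable_map_norm_sq hm)
  rw [map_norm_sq_volume, integral_smul_measure] at this
  rw [← this, ENNReal.toReal_ofReal Real.pi_pos.le]

lemma setIntegral_radial {E : Type*} [NormedAddCommGroup E] [NormedSpace ℝ E] {h : ℝ → E}
    (hm : Continuous h) {R : ℝ} (hR : 0 ≤ R) :
    ∫ k in Metric.closedBall (0 : Plane) R, h (‖k‖ ^ 2) =
      Real.pi • ∫ u in (0 : ℝ)..R ^ 2, h u := by
  have e : ∀ k : Plane, (Metric.closedBall (0 : Plane) R).indicator (fun k => h (‖k‖ ^ 2)) k =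
      (Set.Iic (R ^ 2)).indicator h (‖k‖ ^ 2) := fun k => by
    by_cases hk : ‖k‖ ≤ R
    · rw [Set.indicator_of_mem (by simpa using hk), Set.indicator_of_mem]
      exact pow_le_pow_left₀ (norm_nonneg _) hk 2
    · rw [Set.indicator_of_notMem (by simpa using hk), Set.indicator_of_notMem]
      rw [Set.mem_Iic, not_le]
      exact pow_lt_pow_left₀ (not_le.1 hk) hR two_ne_zero
  rw [← integral_indicator measurableSet_closedBall]
  simp_rw [e]
  rw [integral_radial (hm.aestronglyMeasurable.indicator measurableSet_Iic),
    setIntegral_indicator measurableSet_Iic, Set.Ioi_inter_Iic,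
    intervalIntegral.integral_of_le (sq_nonneg R)]

/-! ### Weak gradients and the Fourier transform -/

lemma basisVec_inner (x : Plane) (j : Fin 2) : inner ℝ x (basisVec j) = x j := by
  simp [basisVec, EuclideanSpace.inner_single_right]

lemma norm_sq_eq_sum (x : Plane) : ‖x‖ ^ 2 = x 0 ^ 2 + x 1 ^ 2 := by
  rw [EuclideanSpace.norm_sq_eq, Fin.sum_univ_two]; simp

lemma abs_coord_le_norm (x : Plane) (j : Fin 2) : |x j| ≤ ‖x‖ := by
  simpa using PiLp.norm_apply_le x j

lemma locallyIntegrable_L2 (f : L2) : LocallyIntegrable f (volume : Measure Plane) :=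
  (Lp.memLp f).locallyIntegrable (by norm_num)

/-- Two locally integrable functions that agree as functionals on Schwartz functions agree almost
everywhere. -/
lemma ae_eq_of_forall_schwartz {f g : Plane → ℂ} (hf : LocallyIntegrable f)
    (hg : LocallyIntegrable g)
    (h : ∀ φ : 𝓢(Plane, ℂ), ∫ x, φ x * f x = ∫ x, φ x * g x) : f =ᵐ[volume] g := by
  refine ae_eq_of_integral_contDiff_smul_eq hf hg fun φ hφ hφc => ?_
  have h₁ : HasCompactSupport (Complex.ofRealCLM ∘ φ) := hφc.comp_left rfl
  have h₂ : ContDiff ℝ (⊤ : ℕ∞) (Complex.ofRealCLM ∘ φ) := Complex.ofRealCLM.contDiff.comp hφ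
  simpa using h (h₁.toSchwartzMap h₂)

/-- Multiplication by a coordinate, as an operation on distributions and as one on functions. -/
lemma eq_smulLeftCLM_coord_iff (f g : L2) (c : ℂ) (j : Fin 2) :
    (g : 𝓢'(Plane, ℂ)) =
      c • TemperedDistribution.smulLeftCLM ℂ (fun x => (inner ℝ x (basisVec j) : ℂ))
        (f : 𝓢'(Plane, ℂ)) ↔
    g =ᵐ[volume] fun x => c * (x j : ℂ) * f x := by
  have htg : Function.HasTemperateGrowth fun x : Plane => ((inner ℝ x (basisVec j) : ℝ) : ℂ) := by
    fun_prop
  have happ : ∀ φ : 𝓢(Plane, ℂ),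
      (c • TemperedDistribution.smulLeftCLM ℂ (fun x => (inner ℝ x (basisVec j) : ℂ))
        (f : 𝓢'(Plane, ℂ))) φ = ∫ x, φ x * (c * (x j : ℂ) * f x) := fun φ => by
    change c • (TemperedDistribution.smulLeftCLM ℂ (fun x => (inner ℝ x (basisVec j) : ℂ))
        (f : 𝓢'(Plane, ℂ))) φ = _
    rw [TemperedDistribution.smulLeftCLM_apply_apply, Lp.toTemperedDistribution_apply,
      ← integral_smul]
    refine integral_congr_ae (Eventually.of_forall fun x => ?_)
    simp only [smul_eq_mul]
    rw [SchwartzMap.smulLeftCLM_apply_apply htg, smul_eq_mul, basisVec_inner]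
    ring
  constructor
  · intro h
    refine ae_eq_of_forall_schwartz (locallyIntegrable_L2 g) ?_ fun φ => ?_
    · have hc : Continuous fun x : Plane => c * (x j : ℂ) := by fun_prop
      have := (locallyIntegrable_L2 f).locallyIntegrableOn Set.univ
      rw [← locallyIntegrableOn_univ]
      exact this.continuousOn_mul hc.continuousOn isOpen_univ.isLocallyClosed
    · rw [← happ, ← h, Lp.toTemperedDistribution_apply]
      simp only [smul_eq_mul]
  · intro h
    ext φ
    rw [happ, Lp.toTemperedDistribution_apply]
    refine integral_congr_ae ?_
    filter_upwards [h] with x hx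
    rw [hx, smul_eq_mul]

/-- The weak derivative of an `L²` function, in Fourier space. -/
lemma lineDeriv_eq_iff_fourier (f g : L2) (j : Fin 2) :
    ∂_{basisVec j} (f : 𝓢'(Plane, ℂ)) = (g : 𝓢'(Plane, ℂ)) ↔
      (𝓕 g : L2) =ᵐ[volume] fun ξ => (2 * Real.pi * Complex.I) * (ξ j : ℂ) * (𝓕 f : L2) ξ := by
  rw [← eq_smulLeftCLM_coord_iff, ← Lp.fourier_toTemperedDistribution_eq,
    ← Lp.fourier_toTemperedDistribution_eq, ← TemperedDistribution.fourier_lineDerivOp_eq]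
  constructor
  · intro h; rw [h]
  · intro h
    have := congrArg (fun T : 𝓢'(Plane, ℂ) => 𝓕⁻ T) h
    simpa using this.symm

/-- A weak derivative of the Fourier transform, in physical space. -/
lemma lineDeriv_fourier_eq_iff (f g : L2) (j : Fin 2) :
    ∂_{basisVec j} ((𝓕 f : L2) : 𝓢'(Plane, ℂ)) = (g : 𝓢'(Plane, ℂ)) ↔
      (𝓕⁻ g : L2) =ᵐ[volume] fun x => -(2 * Real.pi * Complex.I) * (x j : ℂ) * f x := by
  rw [← eq_smulLeftCLM_coord_iff, ← Lp.fourierInv_toTemperedDistribution_eq,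
    ← Lp.fourier_toTemperedDistribution_eq, TemperedDistribution.lineDerivOp_fourier_eq]
  constructor
  · intro h
    rw [← h, FourierTransform.fourierInv_fourier_eq]
  · intro h
    rw [← h, FourierTransform.fourier_fourierInv_eq]

/-- A classical derivative in `L²` is a weak derivative. -/
lemma lineDeriv_eq_of_hasLineDerivAt {f g : L2} {N N' : Plane → ℂ} {j : Fin 2}
    (hf : f =ᵐ[volume] N) (hg : g =ᵐ[volume] N')
    (hd : ∀ k, HasLineDerivAt ℝ N (N' k) k (basisVec j)) :
    ∂_{basisVec j} (f : 𝓢'(Plane, ℂ)) = (g : 𝓢'(Plane, ℂ)) := by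
  have hN : MemLp N 2 volume := (memLp_congr_ae hf).1 (Lp.memLp f)
  have hN' : MemLp N' 2 volume := (memLp_congr_ae hg).1 (Lp.memLp g)
  ext φ
  rw [TemperedDistribution.lineDerivOp_apply_apply, Lp.toTemperedDistribution_apply,
    Lp.toTemperedDistribution_apply]
  have hφ : MemLp φ 2 volume := φ.memLp 2
  have hφ' : MemLp (∂_{basisVec j} φ : 𝓢(Plane, ℂ)) 2 (volume : Measure Plane) :=
    SchwartzMap.memLp _ 2 volume
  have key := integral_bilinear_hasLineDerivAt_right_eq_neg_left_of_integrable
    (μ := (volume : Measure Plane)) (f := N) (f' := N') (g := φ)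
    (g' := (∂_{basisVec j} φ : 𝓢(Plane, ℂ))) (v := basisVec j) (B := ContinuousLinearMap.mul ℝ ℂ)
    (hN'.integrable_mul hφ) (hN.integrable_mul hφ') (hN.integrable_mul hφ)
    (fun k _ => hd k) (fun k _ => φ.differentiableAt.hasFDerivAt.hasLineDerivAt _)
  simp only [ContinuousLinearMap.mul_apply'] at key
  calc _ = -∫ x, N x * (∂_{basisVec j} φ : 𝓢(Plane, ℂ)) x := by
        rw [← integral_neg]
        refine integral_congr_ae ?_
        filter_upwards [hf] with x hx
        rw [hx, neg_apply, smul_eq_mul]; ring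
    _ = ∫ x, N' x * φ x := by rw [key, neg_neg]
    _ = _ := by
        refine integral_congr_ae ?_
        filter_upwards [hg] with x hx
        rw [hx, smul_eq_mul]; ring

/-! ### The Green function in Fourier space -/

/-- The heat kernel of the plane at time `τ`, damped by `e^{-lam τ}`. -/
def dampedHeat (lam τ : ℝ) (x : Plane) : ℝ :=
  (4 * Real.pi * τ)⁻¹ * Real.exp (-((4 * τ)⁻¹ * ‖x‖ ^ 2)) * Real.exp (-(lam * τ))

/-- `G_lam` is the time integral of the damped heat kernel: substitute `τ = |x| e^s / (2 √lam)`. -/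
lemma integral_dampedHeat {lam : ℝ} (hlam : 0 < lam) {x : Plane} (hx : x ≠ 0) :
    ∫ τ in Set.Ioi (0 : ℝ), dampedHeat lam τ x = green lam x := by
  have hr : 0 < ‖x‖ := norm_pos_iff.2 hx
  have hs : 0 < √lam := Real.sqrt_pos.2 hlam
  set c : ℝ := ‖x‖ / (2 * √lam) with hc
  have hc0 : 0 < c := by positivity
  have himg : (fun s : ℝ => c * Real.exp s) '' Set.univ = Set.Ioi 0 := by
    ext y
    simp only [Set.image_univ, Set.mem_range, Set.mem_Ioi]
    constructor
    · rintro ⟨s, rfl⟩; positivity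
    · intro hy
      exact ⟨Real.log (y / c), by rw [Real.exp_log (by positivity)]; field_simp⟩
  have hcv := integral_image_eq_integral_abs_deriv_smul (s := Set.univ) MeasurableSet.univ
    (f := fun s : ℝ => c * Real.exp s) (f' := fun s => c * Real.exp s)
    (fun s _ => ((Real.hasDerivAt_exp s).const_mul c).hasDerivWithinAt)
    (fun s _ t _ h => Real.exp_injective (mul_left_cancel₀ hc0.ne' h))
    (fun τ => dampedHeat lam τ x)
  rw [himg, setIntegral_univ] at hcv
  have habs := integral_comp_abs (f := fun s => Real.exp (-(√lam * ‖x‖ * Real.cosh s)))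
  rw [hcv, green, macdonaldK0]
  have : ∀ s : ℝ, |c * Real.exp s| • dampedHeat lam (c * Real.exp s) x =
      (4 * Real.pi)⁻¹ * Real.exp (-(√lam * ‖x‖ * Real.cosh |s|)) := fun s => by
    have e1 : ∀ x y a b : ℝ, x * (y * a * b) = x * y * (a * b) := fun x y a b => by ring
    rw [abs_of_pos (by positivity), dampedHeat, smul_eq_mul, e1, ← Real.exp_add]
    congr 1
    · field_simp
    · congr 1
      rw [Real.cosh_abs, Real.cosh_eq, Real.exp_neg, hc]
      have h2 : √lam * √lam = lam := Real.mul_self_sqrt hlam.le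
      have he := Real.exp_pos s
      field_simp
      rw [show √lam ^ 2 = lam by rw [sq, h2]]
      ring
  simp_rw [this]
  rw [integral_const_mul, habs]
  ring

lemma integrable_gaussian {b : ℝ} (hb : 0 < b) :
    Integrable fun x : Plane => Real.exp (-(b * ‖x‖ ^ 2)) := by
  have := GaussianFourier.integrable_cexp_neg_mul_sq_norm_add (V := Plane) (b := b)
    (by simpa using hb) 0 0
  have h := this.norm
  refine h.congr (Eventually.of_forall fun x => ?_)
  simp only [Complex.norm_exp]
  congr 1
  simp [← Complex.ofReal_pow]

lemma integrable_dampedHeat_right {lam τ : ℝ} (hτ : 0 < τ) :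
    Integrable fun x : Plane => dampedHeat lam τ x :=
  ((integrable_gaussian (b := (4 * τ)⁻¹) (by positivity)).const_mul _).mul_const _

lemma dampedHeat_nonneg {lam τ : ℝ} (hτ : 0 < τ) (x : Plane) : 0 ≤ dampedHeat lam τ x := by
  unfold dampedHeat; positivity

lemma integral_dampedHeat_right {lam τ : ℝ} (hτ : 0 < τ) :
    ∫ x : Plane, dampedHeat lam τ x = Real.exp (-(lam * τ)) := by
  have := GaussianFourier.integral_rexp_neg_mul_sq_norm (V := Plane) (b := (4 * τ)⁻¹)
    (by positivity)
  simp only [dampedHeat]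
  rw [integral_mul_const, integral_const_mul]
  simp only [neg_mul] at this
  rw [this]
  simp
  field_simp

lemma integrable_dampedHeat_prod {lam : ℝ} (hlam : 0 < lam) :
    Integrable (fun p : ℝ × Plane => dampedHeat lam p.1 p.2)
      ((volume.restrict (Set.Ioi (0 : ℝ))).prod volume) := by
  have hm : Measurable fun p : ℝ × Plane => dampedHeat lam p.1 p.2 := by
    unfold dampedHeat; fun_prop
  rw [integrable_prod_iff hm.aestronglyMeasurable]
  constructor
  · filter_upwards [ae_restrict_mem measurableSet_Ioi] with τ hτ
    exact integrable_dampedHeat_right hτ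
  · have h : IntegrableOn (fun τ : ℝ => Real.exp (-(lam * τ))) (Set.Ioi 0) := by
      simpa only [neg_mul] using integrableOn_exp_mul_Ioi (neg_lt_zero.2 hlam) 0
    refine h.congr_fun (fun τ hτ => ?_) measurableSet_Ioi
    simp only
    rw [← integral_dampedHeat_right hτ]
    congr 1; ext x
    rw [Real.norm_of_nonneg (dampedHeat_nonneg hτ x)]

lemma fourier_dampedHeat {lam τ : ℝ} (hτ : 0 < τ) (ξ : Plane) :
    𝓕 (fun x : Plane => (dampedHeat lam τ x : ℂ)) ξ =
      Real.exp (-((4 * Real.pi ^ 2 * ‖ξ‖ ^ 2 + lam) * τ)) := by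
  have hg := fourier_gaussian_innerProductSpace (V := Plane) (b := (((4 * τ)⁻¹ : ℝ) : ℂ))
    (by rw [Complex.ofReal_re]; positivity) ξ
  have e : (fun x : Plane => (dampedHeat lam τ x : ℂ)) =
      (((4 * Real.pi * τ)⁻¹ * Real.exp (-(lam * τ)) : ℝ) : ℂ) •
        fun x : Plane => Complex.exp (-(((4 * τ)⁻¹ : ℝ) : ℂ) * ‖x‖ ^ 2) := by
    ext x
    simp only [dampedHeat, Pi.smul_apply, smul_eq_mul]
    push_cast
    rw [neg_mul]
    ring
  have hτ' : (τ : ℂ) ≠ 0 := by exact_mod_cast hτ.ne'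
  have hπ : (Real.pi : ℂ) ≠ 0 := by exact_mod_cast Real.pi_ne_zero
  rw [e, Real.fourier_eq]
  simp only [Pi.smul_apply, smul_comm _ (((4 * Real.pi * τ)⁻¹ * Real.exp (-(lam * τ)) : ℝ) : ℂ)]
  rw [integral_smul, ← Real.fourier_eq, hg]
  have h1 : ((Module.finrank ℝ Plane : ℂ) / 2) = 1 := by simp
  rw [h1, Complex.cpow_one, smul_eq_mul, ← mul_assoc]
  have h2 : -(Real.pi : ℂ) ^ 2 * ‖ξ‖ ^ 2 / (((4 * τ)⁻¹ : ℝ) : ℂ) =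
      ((-(4 * Real.pi ^ 2 * ‖ξ‖ ^ 2 * τ) : ℝ) : ℂ) := by
    push_cast
    field_simp
  rw [h2, ← Complex.ofReal_exp]
  have h3 : -((4 * Real.pi ^ 2 * ‖ξ‖ ^ 2 + lam) * τ) =
    -(lam * τ) + -(4 * Real.pi ^ 2 * ‖ξ‖ ^ 2 * τ) := by ring
  rw [h3, Real.exp_add]
  push_cast
  field_simp

/-- The symbol of `(-Δ + lam)⁻¹` in the variable `ξ = k / (2π)`. -/
def greenSymbol (lam : ℝ) (ξ : Plane) : ℝ := (4 * Real.pi ^ 2 * ‖ξ‖ ^ 2 + lam)⁻¹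

lemma greenSymbol_denom_pos {lam : ℝ} (hlam : 0 < lam) (ξ : Plane) :
    0 < 4 * Real.pi ^ 2 * ‖ξ‖ ^ 2 + lam := by positivity

lemma continuous_greenSymbol {lam : ℝ} (hlam : 0 < lam) : Continuous (greenSymbol lam) := by
  unfold greenSymbol
  exact Continuous.inv₀ (by fun_prop) fun ξ => (greenSymbol_denom_pos hlam ξ).ne'

/-- The Fourier transform of `G_lam` as a tempered distribution, by Fubini's theorem for the heat
kernel. -/
lemma integral_fourier_mul_green {lam : ℝ} (hlam : 0 < lam) (φ : 𝓢(Plane, ℂ)) :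
    ∫ x, (𝓕 φ : 𝓢(Plane, ℂ)) x * (green lam x : ℂ) = ∫ ξ, φ ξ * (greenSymbol lam ξ : ℂ) := by
  obtain ⟨C, hC⟩ : ∃ C, ∀ x, ‖(𝓕 φ : 𝓢(Plane, ℂ)) x‖ ≤ C := by
    obtain ⟨C, -, hC⟩ := (𝓕 φ : 𝓢(Plane, ℂ)).decay 0 0
    exact ⟨C, fun x => by simpa using hC x⟩
  have hexp : IntegrableOn (fun τ : ℝ => Real.exp (-(lam * τ))) (Set.Ioi 0) := by
    simpa only [neg_mul] using integrableOn_exp_mul_Ioi (neg_lt_zero.2 hlam) 0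
  have i1 : Integrable (fun p : ℝ × Plane => (dampedHeat lam p.1 p.2 : ℂ) *
      (𝓕 φ : 𝓢(Plane, ℂ)) p.2) ((volume.restrict (Set.Ioi (0 : ℝ))).prod volume) :=
    (integrable_dampedHeat_prod hlam).ofReal.mul_bdd (c := C)
      (Continuous.aestronglyMeasurable (by fun_prop)) (Eventually.of_forall fun p => hC p.2)
  have i2 : Integrable (fun p : ℝ × Plane =>
      (Real.exp (-((4 * Real.pi ^ 2 * ‖p.2‖ ^ 2 + lam) * p.1)) : ℂ) * φ p.2)
      ((volume.restrict (Set.Ioi (0 : ℝ))).prod volume) := by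
    have h := hexp.mul_prod (φ.integrable (μ := volume)).norm
    refine h.mono' (Continuous.aestronglyMeasurable (by fun_prop)) ?_
    have : ∀ᵐ p ∂((volume.restrict (Set.Ioi (0 : ℝ))).prod (volume : Measure Plane)),
        p.1 ∈ Set.Ioi (0 : ℝ) :=
      Measure.quasiMeasurePreserving_fst.ae (ae_restrict_mem measurableSet_Ioi)
    filter_upwards [this] with p hp
    have hp : 0 < p.1 := hp
    rw [norm_mul, Complex.norm_real, Real.norm_of_nonneg (Real.exp_nonneg _)]
    refine mul_le_mul_of_nonneg_right (Real.exp_le_exp.2 ?_) (norm_nonneg _)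
    have : 0 ≤ 4 * Real.pi ^ 2 * ‖p.2‖ ^ 2 * p.1 := by positivity
    linarith
  have hz : ∀ᵐ x : Plane, x ≠ 0 := by rw [ae_iff]; simp
  calc ∫ x, (𝓕 φ : 𝓢(Plane, ℂ)) x * (green lam x : ℂ)
      = ∫ x, ∫ τ in Set.Ioi (0 : ℝ), (dampedHeat lam τ x : ℂ) * (𝓕 φ : 𝓢(Plane, ℂ)) x := by
        refine integral_congr_ae ?_
        filter_upwards [hz] with x hx
        rw [integral_mul_const, integral_complex_ofReal, integral_dampedHeat hlam hx, mul_comm]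
    _ = ∫ τ in Set.Ioi (0 : ℝ), ∫ x, (dampedHeat lam τ x : ℂ) * (𝓕 φ : 𝓢(Plane, ℂ)) x :=
        (integral_integral_swap i1).symm
    _ = ∫ τ in Set.Ioi (0 : ℝ), ∫ ξ,
          (Real.exp (-((4 * Real.pi ^ 2 * ‖ξ‖ ^ 2 + lam) * τ)) : ℂ) * φ ξ := by
        refine setIntegral_congr_fun measurableSet_Ioi fun τ hτ => ?_
        have := VectorFourier.integral_fourierIntegral_smul_eq_flip (L := innerₗ Plane)
          (μ := volume) (ν := volume)
          Real.continuous_fourierChar continuous_inner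
          (integrable_dampedHeat_right (lam := lam) hτ).ofReal (φ.integrable (μ := volume))
        simp only [flip_innerₗ, smul_eq_mul] at this
        rw [SchwartzMap.fourier_coe]
        refine this.symm.trans ?_
        refine integral_congr_ae (Eventually.of_forall fun ξ => ?_)
        simp only
        rw [← fourier_dampedHeat hτ]
        rfl
    _ = ∫ ξ, ∫ τ in Set.Ioi (0 : ℝ),
          (Real.exp (-((4 * Real.pi ^ 2 * ‖ξ‖ ^ 2 + lam) * τ)) : ℂ) * φ ξ :=
        integral_integral_swap i2
    _ = ∫ ξ, φ ξ * (greenSymbol lam ξ : ℂ) := by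
        congr 1; ext ξ
        have hp := greenSymbol_denom_pos hlam ξ
        have := integral_exp_mul_Ioi (neg_lt_zero.2 hp) 0
        simp only [neg_mul, mul_zero, Real.exp_zero] at this
        rw [integral_mul_const, integral_complex_ofReal, this, greenSymbol, mul_comm]
        congr 2
        rw [neg_div_neg_eq, one_div]

/-- The decomposition of an element of `V` in Fourier space. -/
lemma FormDomain.fourier_toL2 {lam : ℝ} (hlam : 0 < lam) (χ : FormDomain lam) :
    (𝓕 χ.toL2 : L2) =ᵐ[volume] fun ξ => (𝓕 χ.reg.toL2 : L2) ξ + χ.charge * greenSymbol lam ξ := by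
  by_cases hq : χ.charge = 0
  · have : χ.toL2 = χ.reg.toL2 := by
      refine Lp.ext ?_
      filter_upwards [χ.decomp] with x hx
      rw [hx, hq, zero_mul, add_zero]
    rw [this, hq]
    simp
  · have hG : MemLp (fun x : Plane => (green lam x : ℂ)) 2 volume := by
      have := ((Lp.memLp χ.toL2).sub (Lp.memLp χ.reg.toL2)).const_mul (χ.charge)⁻¹
      refine (memLp_congr_ae ?_).1 this
      filter_upwards [χ.decomp] with x hx
      simp only [Pi.sub_apply, hx]
      field_simp
      ring
    set G : L2 := hG.toLp _ with hGdef
    have hdec : χ.toL2 = χ.reg.toL2 + χ.charge • G := by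
      refine Lp.ext ?_
      filter_upwards [χ.decomp, Lp.coeFn_add χ.reg.toL2 (χ.charge • G),
        Lp.coeFn_smul χ.charge G, hG.coeFn_toLp] with x h1 h2 h3 h4
      rw [h1, h2, Pi.add_apply, h3, Pi.smul_apply, hGdef, h4, smul_eq_mul]
    have hFG : (𝓕 G : L2) =ᵐ[volume] fun ξ => (greenSymbol lam ξ : ℂ) := by
      refine ae_eq_of_forall_schwartz (locallyIntegrable_L2 _)
        (Continuous.locallyIntegrable
          (Complex.continuous_ofReal.comp (continuous_greenSymbol hlam))) fun φ => ?_
      rw [← integral_fourier_mul_green hlam]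
      have h := congrArg (fun T : 𝓢'(Plane, ℂ) => T φ) (Lp.fourier_toTemperedDistribution_eq G)
      simp only [TemperedDistribution.fourier_apply, Lp.toTemperedDistribution_apply,
        smul_eq_mul] at h
      rw [← h]
      refine integral_congr_ae ?_
      filter_upwards [hG.coeFn_toLp] with x hx
      rw [hGdef, hx]
    rw [hdec, FourierTransform.fourier_add, FourierTransform.fourier_smul]
    filter_upwards [Lp.coeFn_add (𝓕 χ.reg.toL2 : L2) (χ.charge • (𝓕 G : L2)),
      Lp.coeFn_smul χ.charge (𝓕 G : L2), hFG] with ξ h1 h2 h3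
    rw [h1, Pi.add_apply, h2, Pi.smul_apply, h3, smul_eq_mul]

/-! ### The weak equation tested with band-limited functions -/

/-- The symbol `|k|²` of `-Δ` in the variable `ξ = k / (2π)`. -/
def freq (ξ : Plane) : ℝ := 4 * Real.pi ^ 2 * ‖ξ‖ ^ 2

lemma continuous_freq : Continuous freq := by unfold freq; fun_prop

lemma exists_norm_le_on_closedBall (R : ℝ) (m : C(Plane, ℂ)) :
    ∃ c : ℝ, 0 ≤ c ∧ ∀ ξ ∈ Metric.closedBall (0 : Plane) R, ‖m ξ‖ ≤ c := by
  obtain ⟨c, hc⟩ := (isCompact_closedBall (0 : Plane) R).exists_bound_of_continuousOn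
    m.continuous.continuousOn
  exact ⟨max c 0, le_max_right _ _, fun ξ hξ => (hc ξ hξ).trans (le_max_left _ _)⟩

lemma memLp_bandMul (R : ℝ) (m : C(Plane, ℂ)) (g : L2) :
    MemLp ((Metric.closedBall (0 : Plane) R).indicator fun ξ => m ξ * g ξ) 2 volume := by
  obtain ⟨c, hc0, hc⟩ := exists_norm_le_on_closedBall R m
  refine (Lp.memLp g).of_le_mul (c := c)
    ((m.continuous.aestronglyMeasurable.mul (Lp.aestronglyMeasurable g)).indicator
      measurableSet_closedBall) (Eventually.of_forall fun ξ => ?_)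
  by_cases hξ : ξ ∈ Metric.closedBall (0 : Plane) R
  · rw [Set.indicator_of_mem hξ, norm_mul]
    exact mul_le_mul_of_nonneg_right (hc ξ hξ) (norm_nonneg _)
  · rw [Set.indicator_of_notMem hξ, norm_zero]
    positivity

/-- Multiplication by the continuous function `m`, followed by the cut-off to the ball of
radius `R`. -/
def bandMul (R : ℝ) (m : C(Plane, ℂ)) (g : L2) : L2 := (memLp_bandMul R m g).toLp _

lemma coeFn_bandMul (R : ℝ) (m : C(Plane, ℂ)) (g : L2) :
    bandMul R m g =ᵐ[volume] (Metric.closedBall (0 : Plane) R).indicator fun ξ => m ξ * g ξ :=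
  MemLp.coeFn_toLp _

lemma inner_bandMul_left (R : ℝ) (m : C(Plane, ℂ)) (g f : L2) :
    inner ℂ (bandMul R m g) f = inner ℂ g (bandMul R (star m) f) := by
  rw [L2.inner_def, L2.inner_def]
  refine integral_congr_ae ?_
  filter_upwards [coeFn_bandMul R m g, coeFn_bandMul R (star m) f] with ξ h1 h2
  rw [h1, h2]
  by_cases hξ : ξ ∈ Metric.closedBall (0 : Plane) R
  · rw [Set.indicator_of_mem hξ, Set.indicator_of_mem hξ]
    simp only [RCLike.inner_apply, map_mul, ContinuousMap.star_apply]
    rw [starRingEnd_apply, starRingEnd_apply]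
    ring
  · rw [Set.indicator_of_notMem hξ, Set.indicator_of_notMem hξ]
    simp

lemma bandMul_bandMul (R : ℝ) (m n : C(Plane, ℂ)) (g : L2) :
    bandMul R m (bandMul R n g) = bandMul R (m * n) g := by
  refine Lp.ext ?_
  filter_upwards [coeFn_bandMul R m (bandMul R n g), coeFn_bandMul R n g,
    coeFn_bandMul R (m * n) g] with ξ h1 h2 h3
  rw [h1, h3]
  by_cases hξ : ξ ∈ Metric.closedBall (0 : Plane) R
  · rw [Set.indicator_of_mem hξ, Set.indicator_of_mem hξ, h2, Set.indicator_of_mem hξ,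
      ContinuousMap.mul_apply]
    ring
  · rw [Set.indicator_of_notMem hξ, Set.indicator_of_notMem hξ]

/-- The Fourier transform of a function in `L²` cut off to a ball belongs to `H¹`. -/
def bandH1 (R : ℝ) (g : L2) : H1 where
  toL2 := 𝓕⁻ (bandMul R 1 g)
  grad j := 𝓕⁻ (bandMul R ⟨fun ξ => 2 * Real.pi * Complex.I * (ξ j : ℂ), by fun_prop⟩ g)
  isWeakGradient j := by
    rw [lineDeriv_eq_iff_fourier, FourierTransform.fourier_fourierInv_eq,
      FourierTransform.fourier_fourierInv_eq]
    filter_upwards [coeFn_bandMul R 1 g,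
      coeFn_bandMul R ⟨fun ξ => 2 * Real.pi * Complex.I * (ξ j : ℂ), by fun_prop⟩ g] with ξ h1 h2
    rw [h1, h2]
    by_cases hξ : ξ ∈ Metric.closedBall (0 : Plane) R
    · rw [Set.indicator_of_mem hξ, Set.indicator_of_mem hξ]
      simp
    · rw [Set.indicator_of_notMem hξ, Set.indicator_of_notMem hξ, mul_zero]

/-- A band-limited function as an element of `V` without charge. -/
def bandForm (lam R : ℝ) (g : L2) : FormDomain lam where
  toL2 := (bandH1 R g).toL2
  reg := bandH1 R g
  charge := 0
  decomp := Eventually.of_forall fun x => by rw [zero_mul, add_zero]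

lemma inner_fourierInv_left (a b : L2) :
    inner ℂ (𝓕⁻ a : L2) b = inner ℂ a (𝓕 b : L2) := by
  rw [← Lp.inner_fourier_eq, FourierTransform.fourier_fourierInv_eq]

/-- The indicator function of the ball of radius `R`. -/
def ballOne (R : ℝ) : L2 :=
  indicatorConstLp 2 (measurableSet_closedBall (x := (0 : Plane)) (ε := R))
    (measure_closedBall_lt_top.ne) (1 : ℂ)

lemma coeFn_ballOne (R : ℝ) :
    ballOne R =ᵐ[volume] (Metric.closedBall (0 : Plane) R).indicator fun _ => (1 : ℂ) :=
  indicatorConstLp_coeFn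

/-- `|k|²` as a continuous multiplier. -/
def freqMap : C(Plane, ℂ) :=
  ⟨fun ξ => (freq ξ : ℂ), Complex.continuous_ofReal.comp continuous_freq⟩

/-- Tested with a band-limited function, the right-hand side of the weak equation is linear: since
`(|k|² + lam) Ĝ_lam = 1`, only the source term `-q` remains of the charge. -/
lemma weakForm_bandForm {β σ lam : ℝ} (hlam : 0 < lam) (R : ℝ) (g : L2) (ψ : FormDomain lam) :
    weakForm β σ (bandForm lam R g) ψ =
      inner ℂ g (bandMul R freqMap (𝓕 ψ.toL2) - ψ.charge • ballOne R) := by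
  have hcoord : ∀ j, Continuous fun ξ : Plane => 2 * Real.pi * Complex.I * (ξ j : ℂ) :=
    fun j => by fun_prop
  set c : Fin 2 → C(Plane, ℂ) := fun j => ⟨_, hcoord j⟩ with hc
  have e1 : weakForm β σ (bandForm lam R g) ψ =
      ∑ j : Fin 2, inner ℂ g (bandMul R (star (c j)) (𝓕 (ψ.reg.grad j)))
      + (lam : ℂ) * inner ℂ g (bandMul R (star 1) (𝓕 ψ.reg.toL2))
      - (lam : ℂ) * inner ℂ g (bandMul R (star 1) (𝓕 ψ.toL2)) := by
    simp only [← inner_bandMul_left, ← inner_fourierInv_left]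
    simp only [weakForm, bandForm, bandH1, map_zero, mul_zero, zero_mul, add_zero]
    rfl
  rw [e1, Fin.sum_univ_two, ← inner_add_right, ← inner_smul_right, ← inner_smul_right,
    ← inner_add_right, ← inner_sub_right]
  congr 1
  refine Lp.ext ?_
  have hg : ∀ j, (𝓕 (ψ.reg.grad j) : L2) =ᵐ[volume]
      fun ξ => (2 * Real.pi * Complex.I) * (ξ j : ℂ) * (𝓕 ψ.reg.toL2 : L2) ξ :=
    fun j => (lineDeriv_eq_iff_fourier _ _ j).1 (ψ.reg.isWeakGradient j)
  set A0 := bandMul R (star (c 0)) (𝓕 (ψ.reg.grad 0)) with hA0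
  set A1 := bandMul R (star (c 1)) (𝓕 (ψ.reg.grad 1)) with hA1
  set B := bandMul R (star 1) (𝓕 ψ.reg.toL2) with hB
  set D := bandMul R (star 1) (𝓕 ψ.toL2) with hD
  set F := bandMul R freqMap (𝓕 ψ.toL2) with hF
  filter_upwards [Lp.coeFn_sub (A0 + A1 + (lam : ℂ) • B) ((lam : ℂ) • D),
    Lp.coeFn_add (A0 + A1) ((lam : ℂ) • B), Lp.coeFn_add A0 A1, Lp.coeFn_smul (lam : ℂ) B,
    Lp.coeFn_smul (lam : ℂ) D, Lp.coeFn_sub F (ψ.charge • ballOne R),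
    Lp.coeFn_smul ψ.charge (ballOne R), coeFn_ballOne R,
    coeFn_bandMul R (star (c 0)) (𝓕 (ψ.reg.grad 0)),
    coeFn_bandMul R (star (c 1)) (𝓕 (ψ.reg.grad 1)), coeFn_bandMul R (star 1) (𝓕 ψ.reg.toL2),
    coeFn_bandMul R (star 1) (𝓕 ψ.toL2), coeFn_bandMul R freqMap (𝓕 ψ.toL2), hg 0, hg 1,
    ψ.fourier_toL2 hlam] with ξ h1 h2 h3 h4 h5 h6 h7 h8 h9 h10 h11 h12 h13 h14 h15 h16
  simp only [h1, h2, h3, h4, h5, h6, h7, Pi.sub_apply, Pi.add_apply, Pi.smul_apply, smul_eq_mul]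
  rw [hA0, hA1, hB, hD, hF, h8, h9, h10, h11, h12, h13]
  by_cases hξ : ξ ∈ Metric.closedBall (0 : Plane) R
  · simp only [Set.indicator_of_mem hξ, h14, h15, h16]
    have hp : ((freq ξ : ℝ) : ℂ) + lam ≠ 0 := by
      rw [← Complex.ofReal_add]
      exact_mod_cast (greenSymbol_denom_pos hlam ξ).ne'
    have hG : (greenSymbol lam ξ : ℂ) = ((freq ξ : ℂ) + lam)⁻¹ := by
      rw [← Complex.ofReal_add, ← Complex.ofReal_inv]
      rfl
    have hfr : (freq ξ : ℂ) = 4 * Real.pi ^ 2 * ((ξ 0 : ℂ) ^ 2 + (ξ 1 : ℂ) ^ 2) := by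
      rw [freq, norm_sq_eq_sum]; push_cast; ring
    rw [hG]
    have h0 : ∀ j, star (c j) ξ * (2 * Real.pi * Complex.I * (ξ j : ℂ) *
        (𝓕 ψ.reg.toL2 : L2) ξ) = 4 * Real.pi ^ 2 * (ξ j : ℂ) ^ 2 * (𝓕 ψ.reg.toL2 : L2) ξ := by
      intro j
      have : star (c j) ξ = -(2 * Real.pi * Complex.I * (ξ j : ℂ)) := by
        rw [ContinuousMap.star_apply, hc, ContinuousMap.coe_mk, ← starRingEnd_apply]
        simp only [map_mul, Complex.conj_ofReal, Complex.conj_I, map_ofNat]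
        ring
      rw [this]
      linear_combination (-(4 * Real.pi ^ 2 * (ξ j : ℂ) ^ 2 * (𝓕 ψ.reg.toL2 : L2) ξ)) *
        Complex.I_sq
    rw [h0, h0]
    have hfm : freqMap ξ = (freq ξ : ℂ) := rfl
    rw [hfm]
    simp only [star_one, ContinuousMap.one_apply, one_mul, mul_one]
    have h17 : (4 * Real.pi ^ 2 * (ξ 0 : ℂ) ^ 2 + 4 * Real.pi ^ 2 * (ξ 1 : ℂ) ^ 2) = freq ξ := by
      rw [hfr]; ring
    have h18 : ((freq ξ : ℂ) + lam) * ((freq ξ : ℂ) + lam)⁻¹ = 1 := mul_inv_cancel₀ hp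
    linear_combination (𝓕 ψ.reg.toL2 : L2) ξ * h17 - ψ.charge * h18
  · simp [Set.indicator_of_notMem hξ]

/-- The weak equation in the Fourier variable, for frequencies in a ball. -/
lemma hasDerivWithinAt_inner_bandMul {β σ lam : ℝ} (hlam : 0 < lam) {Tstar : EReal}
    {ψ₀ : FormDomain lam} {ψ : ℝ → FormDomain lam} (hψ : IsSolution β σ Tstar ψ₀ ψ) (R : ℝ)
    (g : L2) {t : ℝ} (ht : t ∈ timeInterval Tstar) :
    HasDerivWithinAt (fun s => (inner ℂ g (bandMul R 1 (𝓕 (ψ s).toL2)) : ℂ))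
      (-Complex.I * inner ℂ g
        (bandMul R freqMap (bandMul R 1 (𝓕 (ψ t).toL2)) - (ψ t).charge • ballOne R))
      (timeInterval Tstar) t := by
  obtain ⟨d, hd, he⟩ := hψ.weak_eq (bandForm lam R g) t ht
  have e : ∀ s, (inner ℂ (bandForm lam R g).toL2 (ψ s).toL2 : ℂ) =
      inner ℂ g (bandMul R 1 (𝓕 (ψ s).toL2)) := fun s => by
    rw [show (1 : C(Plane, ℂ)) = star 1 by simp, ← inner_bandMul_left, ← inner_fourierInv_left]
    rfl
  simp only [e] at hd
  convert! hd using 1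
  rw [bandMul_bandMul, mul_one, ← weakForm_bandForm hlam (β := β) (σ := σ), ← he, ← mul_assoc]
  simp

/-- A product rule: `a` is differentiable in norm and `y` is bounded and weakly differentiable in
the directions that matter. -/
lemma hasDerivWithinAt_inner_of_weak {H : Type*} [NormedAddCommGroup H] [InnerProductSpace ℂ H]
    {a : ℝ → H} {a' : H} {y : ℝ → H} {d : ℂ} {S : Set ℝ} {t C : ℝ}
    (ha : HasDerivWithinAt a a' S t) (hy : ∀ᶠ x in 𝓝[S] t, ‖y x‖ ≤ C)
    (hd : HasDerivWithinAt (fun x => (inner ℂ (a t) (y x) : ℂ)) d S t)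
    (hc : ContinuousWithinAt (fun x => (inner ℂ a' (y x) : ℂ)) S t) :
    HasDerivWithinAt (fun x => (inner ℂ (a x) (y x) : ℂ)) (inner ℂ a' (y t) + d) S t := by
  have h : HasDerivWithinAt (fun x => (inner ℂ (a x - a t) (y x) : ℂ)) (inner ℂ a' (y t)) S t := by
    rw [hasDerivWithinAt_iff_isLittleO] at ha ⊢
    have h1 : (fun x => (inner ℂ (a x - a t - (x - t) • a') (y x) : ℂ)) =o[𝓝[S] t]
        fun x => x - t := by
      refine Asymptotics.IsBigO.trans_isLittleO ?_ ha
      refine Asymptotics.IsBigO.of_bound C ?_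
      filter_upwards [hy] with x hx
      refine (norm_inner_le_norm _ _).trans ?_
      rw [mul_comm]
      exact mul_le_mul_of_nonneg_right hx (norm_nonneg _)
    have h2 : (fun x => (x - t) • ((inner ℂ a' (y x) : ℂ) - inner ℂ a' (y t))) =o[𝓝[S] t]
        fun x => x - t := by
      have h3 : (fun x => (inner ℂ a' (y x) : ℂ) - inner ℂ a' (y t)) =o[𝓝[S] t]
          fun _ => (1 : ℝ) := by
        rw [Asymptotics.isLittleO_one_iff]
        simpa using Tendsto.sub_const hc.tendsto (inner ℂ a' (y t) : ℂ)
      simpa using (Asymptotics.isBigO_refl (fun x => x - t) (𝓝[S] t)).smul_isLittleO h3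
    refine (h1.add h2).congr_left fun x => ?_
    rw [sub_self, inner_zero_left, sub_zero, inner_sub_left (a x - a t),
      show (x - t) • a' = ((x - t : ℝ) : ℂ) • a' from (Complex.coe_smul _ _).symm, inner_smul_left,
      Complex.conj_ofReal, Complex.real_smul, Complex.real_smul]
    ring
  have := h.add hd
  refine this.congr_of_eventuallyEq (Eventually.of_forall fun x => ?_) ?_ <;>
    simp

/-! ### Duhamel's formula -/

/-- The free propagator `e^{-i|k|²t}` as a continuous multiplier. -/
def phaseMap (t : ℝ) : C(Plane, ℂ) :=
  ⟨fun ξ => Complex.exp (-(Complex.I * freq ξ * t)), by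
    have := continuous_freq
    fun_prop⟩

lemma star_phaseMap (t : ℝ) (ξ : Plane) :
    star (phaseMap t) ξ = Complex.exp (Complex.I * freq ξ * t) := by
  rw [ContinuousMap.star_apply, phaseMap, ContinuousMap.coe_mk, ← starRingEnd_apply,
    ← Complex.exp_conj]
  simp [Complex.conj_ofReal]

/-- After a cut-off in frequency the free evolution is differentiable in norm. -/
lemma hasDerivAt_bandMul_phaseMap (R : ℝ) (g : L2) (t : ℝ) :
    HasDerivAt (fun t => bandMul R (phaseMap t) g)
      (-Complex.I • bandMul R freqMap (bandMul R (phaseMap t) g)) t := by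
  obtain ⟨c, hc0, hc⟩ := exists_norm_le_on_closedBall R freqMap
  have key : ∀ᶠ s in 𝓝 t, ‖bandMul R (phaseMap s) g - bandMul R (phaseMap t) g - (s - t) •
      (-Complex.I • bandMul R freqMap (bandMul R (phaseMap t) g))‖ ≤ (c ^ 2 * ‖g‖) *
      ‖(s - t) ^ 2‖ := by
    have hsmall : ∀ᶠ s in 𝓝 t, c * |s - t| < 1 := by
      have : Tendsto (fun s => c * |s - t|) (𝓝 t) (𝓝 (c * |t - t|)) :=
        Continuous.tendsto (by fun_prop) t
      exact this.eventually_lt_const (by simp)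
    filter_upwards [hsmall] with s hs
    have : ‖bandMul R (phaseMap s) g - bandMul R (phaseMap t) g - (s - t) •
      (-Complex.I • bandMul R freqMap (bandMul R (phaseMap t) g))‖ ≤
        (c ^ 2 * (s - t) ^ 2) * ‖g‖ := by
      refine Lp.norm_le_mul_norm_of_ae_le_mul ?_
      set A := bandMul R (phaseMap s) g with hA
      set B := bandMul R (phaseMap t) g with hB
      set D := bandMul R freqMap B with hD
      filter_upwards [Lp.coeFn_sub (A - B) ((s - t) • (-Complex.I • D)), Lp.coeFn_sub A B,
        Lp.coeFn_smul (s - t) (-Complex.I • D), Lp.coeFn_smul (-Complex.I) D,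
        coeFn_bandMul R (phaseMap s) g, coeFn_bandMul R (phaseMap t) g, coeFn_bandMul R freqMap B]
        with ξ h1 h2 h3 h4 h5 h6 h7
      simp only [h1, h2, h3, h4, Pi.sub_apply, Pi.smul_apply, smul_eq_mul]
      rw [hD, h7]
      by_cases hξ : ξ ∈ Metric.closedBall (0 : Plane) R
      · rw [Set.indicator_of_mem hξ, hB, h6, Set.indicator_of_mem hξ, hA, h5,
          Set.indicator_of_mem hξ]
        set z : ℂ := -(Complex.I * freq ξ * (s - t : ℝ)) with hz
        have hfm : ‖freqMap ξ‖ = |freq ξ| := by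
          rw [freqMap, ContinuousMap.coe_mk, Complex.norm_real, Real.norm_eq_abs]
        have hzn : ‖z‖ = |freq ξ| * |s - t| := by
          rw [hz, norm_neg, norm_mul, norm_mul, Complex.norm_I, Complex.norm_real,
            Complex.norm_real, one_mul, Real.norm_eq_abs, Real.norm_eq_abs]
        have hzc : ‖z‖ ≤ c * |s - t| := by
          rw [hzn, ← hfm]
          exact mul_le_mul_of_nonneg_right (hc ξ hξ) (abs_nonneg _)
        have hexp : phaseMap s ξ = phaseMap t ξ * Complex.exp z := by
          simp only [phaseMap, ContinuousMap.coe_mk]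
          rw [← Complex.exp_add, hz]
          congr 1; push_cast; ring
        have hpn : ‖phaseMap t ξ‖ = 1 := by
          simp only [phaseMap, ContinuousMap.coe_mk]
          rw [Complex.exp_neg, norm_inv, norm_exp_I_mul_mul, inv_one]
        have heq : phaseMap s ξ * g ξ - phaseMap t ξ * g ξ - (s - t) •
            (-Complex.I * (freqMap ξ * (phaseMap t ξ * g ξ))) =
            phaseMap t ξ * (Complex.exp z - 1 - z) * g ξ := by
          have hfm0 : freqMap ξ = (freq ξ : ℂ) := rfl
          rw [hexp, Complex.real_smul, hz, hfm0]
          ring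
        rw [heq, norm_mul, norm_mul, hpn, one_mul]
        refine mul_le_mul_of_nonneg_right ?_ (norm_nonneg _)
        refine (Complex.norm_exp_sub_one_sub_id_le (hzc.trans hs.le)).trans ?_
        calc ‖z‖ ^ 2 ≤ (c * |s - t|) ^ 2 := pow_le_pow_left₀ (norm_nonneg _) hzc 2
          _ = c ^ 2 * (s - t) ^ 2 := by rw [mul_pow, sq_abs]
      · rw [Set.indicator_of_notMem hξ, hB, h6, Set.indicator_of_notMem hξ, hA, h5,
          Set.indicator_of_notMem hξ]
        simp only [sub_self, mul_zero, smul_zero, norm_zero]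
        positivity
    refine this.trans_eq ?_
    rw [Real.norm_of_nonneg (sq_nonneg _)]
    ring
  rw [hasDerivAt_iff_isLittleO]
  refine (Asymptotics.IsBigO.of_bound _ key).trans_isLittleO ?_
  have h1 : (fun s : ℝ => s - t) =o[𝓝 t] fun _ => (1 : ℝ) := by
    rw [Asymptotics.isLittleO_one_iff]
    have : Tendsto (fun s : ℝ => s - t) (𝓝 t) (𝓝 (t - t)) := Continuous.tendsto (by fun_prop) t
    simpa using this
  simpa [sq] using (Asymptotics.isBigO_refl (fun s : ℝ => s - t) (𝓝 t)).mul_isLittleO h1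

/-- Uniform boundedness: a weakly continuous family is norm bounded on compact time intervals. -/
lemma exists_norm_bandMul_le {β σ lam : ℝ} (hlam : 0 < lam) {Tstar : EReal}
    {ψ₀ : FormDomain lam} {ψ : ℝ → FormDomain lam} (hψ : IsSolution β σ Tstar ψ₀ ψ) (R : ℝ)
    {T : ℝ} (hI : Set.Icc 0 T ⊆ timeInterval Tstar) :
    ∃ C, ∀ t ∈ Set.Icc 0 T, ‖bandMul R 1 (𝓕 (ψ t).toL2)‖ ≤ C := by
  obtain ⟨C, hC⟩ := banach_steinhaus
    (g := fun t : Set.Icc 0 T => innerSL ℂ (bandMul R 1 (𝓕 (ψ t).toL2))) (fun g => by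
      have hc : ContinuousOn (fun s => (inner ℂ g (bandMul R 1 (𝓕 (ψ s).toL2)) : ℂ))
          (Set.Icc 0 T) := fun t ht =>
        ((hasDerivWithinAt_inner_bandMul hlam hψ R g (hI ht)).mono hI).continuousWithinAt
      obtain ⟨C, hC⟩ := isCompact_Icc.exists_bound_of_continuousOn hc
      refine ⟨C, fun t => ?_⟩
      rw [innerSL_apply_apply, norm_inner_symm]
      exact hC t t.2)
  exact ⟨C, fun t ht => by simpa using hC ⟨t, ht⟩⟩

/-- In the interaction picture only the source term drives the evolution. -/
lemma hasDerivWithinAt_interaction {β σ lam : ℝ} (hlam : 0 < lam) {Tstar : EReal}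
    {ψ₀ : FormDomain lam} {ψ : ℝ → FormDomain lam} (hψ : IsSolution β σ Tstar ψ₀ ψ) (R : ℝ)
    {T : ℝ} (hI : Set.Icc 0 T ⊆ timeInterval Tstar) (g : L2) {t : ℝ} (ht : t ∈ Set.Icc 0 T) :
    HasDerivWithinAt (fun s => (inner ℂ g (bandMul R (star (phaseMap s)) (𝓕 (ψ s).toL2)) : ℂ))
      (Complex.I * (ψ t).charge * inner ℂ g (bandMul R (star (phaseMap t)) (ballOne R)))
      (Set.Icc 0 T) t := by
  obtain ⟨C, hC⟩ := exists_norm_bandMul_le hlam hψ R hI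
  have h := hasDerivWithinAt_inner_of_weak (y := fun s => bandMul R 1 (𝓕 (ψ s).toL2))
    (hasDerivAt_bandMul_phaseMap R g t).hasDerivWithinAt
    (eventually_mem_nhdsWithin.mono fun s hs => hC s hs)
    ((hasDerivWithinAt_inner_bandMul hlam hψ R (bandMul R (phaseMap t) g) (hI ht)).mono hI)
    (((hasDerivWithinAt_inner_bandMul hlam hψ R _ (hI ht)).mono hI).continuousWithinAt)
  have hs : star freqMap = freqMap := by
    ext ξ
    rw [ContinuousMap.star_apply, freqMap, ContinuousMap.coe_mk, ← starRingEnd_apply,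
      Complex.conj_ofReal]
  simp only [inner_sub_right, inner_smul_right, inner_smul_left] at h
  simp only [inner_bandMul_left, bandMul_bandMul, mul_one, star_mul, hs] at h
  convert! h using 1
  simp
  ring

/-- Duhamel's formula: `ψ̂_t = e^{-i|k|²t} (ψ̂_0 + i ∫_0^t e^{i|k|²s} q(s) ds)`. -/
lemma duhamel {β σ lam : ℝ} (hlam : 0 < lam) {Tstar : EReal}
    {ψ₀ : FormDomain lam} {ψ : ℝ → FormDomain lam} (hψ : IsSolution β σ Tstar ψ₀ ψ)
    {T : ℝ} (hT : 0 ≤ T) (hI : Set.Icc 0 T ⊆ timeInterval Tstar) {f : ℝ → ℂ} (hf : Continuous f)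
    (hfq : ∀ s ∈ Set.Icc 0 T, f s = (ψ s).charge) :
    ∀ᵐ ξ : Plane, Complex.exp (Complex.I * freq ξ * T) * (𝓕 (ψ T).toL2 : L2) ξ =
      (𝓕 (ψ 0).toL2 : L2) ξ + Complex.I * oscInt f 0 T (freq ξ) := by
  let w : C(Plane, ℂ) := ⟨fun ξ => Complex.I * oscInt f 0 T (freq ξ),
    continuous_const.mul ((continuous_oscInt_freq hf 0 T).comp continuous_freq)⟩
  have main : ∀ R : ℝ, bandMul R (star (phaseMap T)) (𝓕 (ψ T).toL2) -
      bandMul R 1 (𝓕 (ψ 0).toL2) - bandMul R w (ballOne R) = 0 := by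
    intro R
    set X := bandMul R (star (phaseMap T)) (𝓕 (ψ T).toL2) -
      bandMul R 1 (𝓕 (ψ 0).toL2) - bandMul R w (ballOne R) with hX
    suffices hall : ∀ g : L2, inner ℂ g X = (0 : ℂ) from inner_self_eq_zero.1 (hall X)
    intro g
    have hcont : ContinuousOn
        (fun s => (inner ℂ g (bandMul R (star (phaseMap s)) (𝓕 (ψ s).toL2)) : ℂ))
        (Set.Icc 0 T) := fun t ht =>
      (hasDerivWithinAt_interaction hlam hψ R hI g ht).continuousWithinAt
    have hG : ∀ t, (inner ℂ g (bandMul R (star (phaseMap t)) (ballOne R)) : ℂ) =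
        ∫ ξ in Metric.closedBall (0 : Plane) R,
          starRingEnd ℂ (g ξ) * Complex.exp (Complex.I * freq ξ * t) := by
      intro t
      rw [L2.inner_def, ← integral_indicator measurableSet_closedBall]
      refine integral_congr_ae ?_
      filter_upwards [coeFn_bandMul R (star (phaseMap t)) (ballOne R), coeFn_ballOne R]
        with ξ h1 h2
      rw [h1]
      by_cases hξ : ξ ∈ Metric.closedBall (0 : Plane) R
      · rw [Set.indicator_of_mem hξ, Set.indicator_of_mem hξ, h2, Set.indicator_of_mem hξ,
          star_phaseMap, RCLike.inner_apply]
        ring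
      · rw [Set.indicator_of_notMem hξ, Set.indicator_of_notMem hξ, inner_zero_right]
    have hgi : Integrable (fun ξ => starRingEnd ℂ (g ξ))
        (volume.restrict (Metric.closedBall (0 : Plane) R)) := by
      have : IsFiniteMeasure (volume.restrict (Metric.closedBall (0 : Plane) R)) :=
        ⟨by rw [Measure.restrict_apply_univ]; exact measure_closedBall_lt_top⟩
      have h1 : Integrable g (volume.restrict (Metric.closedBall (0 : Plane) R)) :=
        ((Lp.memLp g).restrict _).integrable (by norm_num)
      exact (LinearIsometryEquiv.integrable_comp_iff (Complex.conjLIE)).2 h1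
    have hprod : Integrable (fun p : ℝ × Plane => (Complex.I * f p.1) *
        (starRingEnd ℂ (g p.2) * Complex.exp (Complex.I * freq p.2 * p.1)))
        ((volume.restrict (Set.uIoc 0 T)).prod
          (volume.restrict (Metric.closedBall (0 : Plane) R))) := by
      have h1 : Integrable f (volume.restrict (Set.uIoc 0 T)) := by
        rw [Set.uIoc_of_le hT]
        exact (hf.intervalIntegrable 0 T).1
      have h2 := (h1.const_mul Complex.I).mul_prod hgi
      have hcf := continuous_freq
      refine (h2.mul_bdd (c := 1) (g := fun p : ℝ × Plane =>
        Complex.exp (Complex.I * freq p.2 * p.1)) (Continuous.aestronglyMeasurable (by fun_prop))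
        (Eventually.of_forall fun p => (norm_exp_I_mul_mul _ _).le)).congr
        (Eventually.of_forall fun p => ?_)
      simp only
      ring
    have hftc := intervalIntegral.integral_eq_sub_of_hasDeriv_right_of_le hT hcont
      (f' := fun t => Complex.I * f t *
        inner ℂ g (bandMul R (star (phaseMap t)) (ballOne R))) (fun t ht => by
        have := (hasDerivWithinAt_interaction hlam hψ R hI g (Set.Ioo_subset_Icc_self ht))
        rw [hfq t (Set.Ioo_subset_Icc_self ht)]
        exact (this.hasDerivAt (Icc_mem_nhds ht.1 ht.2)).hasDerivWithinAt)
      (by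
        rw [intervalIntegrable_iff]
        refine (hprod.integral_prod_left).congr (Eventually.of_forall fun t => ?_)
        simp only
        rw [integral_const_mul, hG])
    have hswap := intervalIntegral_integral_swap (f := fun (t : ℝ) (ξ : Plane) =>
      (Complex.I * f t) * (starRingEnd ℂ (g ξ) * Complex.exp (Complex.I * freq ξ * t))) hprod
    simp only [integral_const_mul] at hswap
    simp only [← hG] at hswap
    rw [hX, inner_sub_right, inner_sub_right, sub_eq_zero]
    have h0 : star (phaseMap 0) = 1 := by
      ext ξ
      rw [star_phaseMap]
      simp
    rw [h0] at hftc
    rw [← hftc, hswap, L2.inner_def, ← integral_indicator measurableSet_closedBall]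
    refine integral_congr_ae ?_
    filter_upwards [coeFn_bandMul R w (ballOne R), coeFn_ballOne R] with ξ h1 h2
    rw [h1]
    by_cases hξ : ξ ∈ Metric.closedBall (0 : Plane) R
    · rw [Set.indicator_of_mem hξ, Set.indicator_of_mem hξ, h2, Set.indicator_of_mem hξ,
        RCLike.inner_apply, mul_one]
      change _ = Complex.I * oscInt f 0 T (freq ξ) * _
      rw [oscInt, ← intervalIntegral.integral_const_mul, ← intervalIntegral.integral_mul_const]
      refine intervalIntegral.integral_congr fun t _ => ?_
      ring
    · rw [Set.indicator_of_notMem hξ, Set.indicator_of_notMem hξ, inner_zero_right]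
  have hae : ∀ n : ℕ, ∀ᵐ ξ : Plane, ξ ∈ Metric.closedBall (0 : Plane) n →
      Complex.exp (Complex.I * freq ξ * T) * (𝓕 (ψ T).toL2 : L2) ξ =
      (𝓕 (ψ 0).toL2 : L2) ξ + Complex.I * oscInt f 0 T (freq ξ) := by
    intro n
    have h := main n
    set A := bandMul n (star (phaseMap T)) (𝓕 (ψ T).toL2) with hA
    set B := bandMul n 1 (𝓕 (ψ 0).toL2) with hB
    set D := bandMul n w (ballOne n) with hD
    have hz : (A - B - D : L2) =ᵐ[volume] 0 := by rw [h]; exact Lp.coeFn_zero _ _ _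
    filter_upwards [hz, Lp.coeFn_sub (A - B) D, Lp.coeFn_sub A B,
      coeFn_bandMul n (star (phaseMap T)) (𝓕 (ψ T).toL2), coeFn_bandMul n 1 (𝓕 (ψ 0).toL2),
      coeFn_bandMul n w (ballOne n), coeFn_ballOne n] with ξ h0 h1 h2 h3 h4 h5 h6 hξ
    rw [h1, Pi.sub_apply, h2, Pi.sub_apply, hA, hB, hD, h3, h4, h5, Set.indicator_of_mem hξ,
      Set.indicator_of_mem hξ, Set.indicator_of_mem hξ, h6, Set.indicator_of_mem hξ,
      star_phaseMap] at h0
    have hw : w ξ = Complex.I * oscInt f 0 T (freq ξ) := rfl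
    rw [hw, ContinuousMap.one_apply, Pi.zero_apply] at h0
    linear_combination h0
  filter_upwards [ae_all_iff.2 hae] with ξ hξ
  obtain ⟨n, hn⟩ := exists_nat_ge ‖ξ‖
  exact hξ n (by simpa using hn)

/-! ### Differentiating the moment of inertia in Fourier space -/

/-- `n` is a profile with gradient `n'`, both decaying fast enough for every term below that
contains `n` or `n'` to be integrable on the plane. -/
structure IsDecayingProfile (n : Plane → ℂ) (n' : Fin 2 → Plane → ℂ) (C : ℝ) : Prop where
  continuous : Continuous n
  continuous_grad : ∀ j, Continuous (n' j)
  hasLineDerivAt : ∀ j k, HasLineDerivAt ℝ n (n' j k) k (basisVec j)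
  norm_le : ∀ k, ‖n k‖ ≤ C * ((1 + ‖k‖ ^ 2)⁻¹) ^ 3
  norm_grad_le : ∀ j k, ‖n' j k‖ ≤ C * (1 + ‖k‖) * ((1 + ‖k‖ ^ 2)⁻¹) ^ 3

/-- The gradient of the freely evolving part `e^{-i|k|²t} n(k)`, without its phase. -/
def freeGrad (n : Plane → ℂ) (n' : Fin 2 → Plane → ℂ) (t : ℝ) (j : Fin 2) (k : Plane) : ℂ :=
  n' j k - 2 * Complex.I * t * (k j : ℂ) * n k

/-- The gradient of `e^{-i|k|²t} (n(k) + (i/2π) ∫_a^t e^{i|k|²s} f(s) ds)`, without its phase. -/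
def fullGrad (n : Plane → ℂ) (n' : Fin 2 → Plane → ℂ) (f : ℝ → ℂ) (a t : ℝ) (j : Fin 2)
    (k : Plane) : ℂ :=
  freeGrad n n' t j k + (Real.pi⁻¹ : ℝ) * (k j : ℂ) * rampInt f a t (‖k‖ ^ 2)

/-- The absolutely integrable part of `ψ̂_t k·(∇ψ̂_t)^*`; what is left out is the term quadratic in
the charge. -/
def regularPairing (n : Plane → ℂ) (n' : Fin 2 → Plane → ℂ) (f : ℝ → ℂ) (a t : ℝ) (k : Plane) :
    ℂ :=
  (n k + Complex.I * ((Real.pi⁻¹ / 2 : ℝ) : ℂ) * oscInt f a t (‖k‖ ^ 2)) *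
      ∑ j : Fin 2, (k j : ℂ) * starRingEnd ℂ (freeGrad n n' t j k)
    + n k * ((Real.pi⁻¹ * ‖k‖ ^ 2 : ℝ) : ℂ) * starRingEnd ℂ (rampInt f a t (‖k‖ ^ 2))

/-- The absolutely integrable part of `|∇ψ̂_t|²`. -/
def regularDensity (n : Plane → ℂ) (n' : Fin 2 → Plane → ℂ) (f : ℝ → ℂ) (a t : ℝ) (k : Plane) :
    ℝ :=
  ∑ j : Fin 2, (starRingEnd ℂ (freeGrad n n' t j k) * (freeGrad n n' t j k +
    2 * (Real.pi⁻¹ : ℝ) * (k j : ℂ) * rampInt f a t (‖k‖ ^ 2))).re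

lemma sum_norm_fullGrad_sq (n : Plane → ℂ) (n' : Fin 2 → Plane → ℂ) (f : ℝ → ℂ) (a t : ℝ)
    (k : Plane) :
    ∑ j : Fin 2, ‖fullGrad n n' f a t j k‖ ^ 2 = regularDensity n n' f a t k +
      Real.pi⁻¹ ^ 2 * (‖k‖ ^ 2 * ‖rampInt f a t (‖k‖ ^ 2)‖ ^ 2) := by
  have h : ∀ (X P : ℂ) (c x : ℝ), ‖X + (c : ℂ) * (x : ℂ) * P‖ ^ 2 =
      (starRingEnd ℂ X * (X + 2 * (c : ℂ) * (x : ℂ) * P)).re + c ^ 2 * (x ^ 2 * ‖P‖ ^ 2) := by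
    intro X P c x
    rw [Complex.sq_norm, Complex.sq_norm, Complex.normSq_apply, Complex.normSq_apply]
    simp [Complex.mul_re, Complex.mul_im]
    ring
  simp only [fullGrad, regularDensity, Fin.sum_univ_two, h]
  rw [show (‖k‖ ^ 2 * ‖rampInt f a t (‖k‖ ^ 2)‖ ^ 2) = (k 0 ^ 2 + k 1 ^ 2) *
    ‖rampInt f a t (‖k‖ ^ 2)‖ ^ 2 by rw [← norm_sq_eq_sum]]
  ring

lemma hasDerivAt_regularDensity (n : Plane → ℂ) (n' : Fin 2 → Plane → ℂ) {f : ℝ → ℂ}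
    (hf : Continuous f) (a t : ℝ) (k : Plane) :
    HasDerivAt (fun t => regularDensity n n' f a t k) (4 * (regularPairing n n' f a t k).im) t := by
  have hX : ∀ j, HasDerivAt (fun t => freeGrad n n' t j k)
      (-(2 * Complex.I * (k j : ℂ) * n k)) t := fun j => by
    have h := ((((Complex.ofRealCLM.hasDerivAt (x := t)).const_mul (2 * Complex.I)).mul_const
      (k j : ℂ)).mul_const (n k)).const_sub (n' j k)
    convert! h using 1
    simp
  have hXc : ∀ j, HasDerivAt (fun t => starRingEnd ℂ (freeGrad n n' t j k))
      (starRingEnd ℂ (-(2 * Complex.I * (k j : ℂ) * n k))) t := fun j =>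
    (Complex.conjCLE.toContinuousLinearMap.hasFDerivAt).comp_hasDerivAt t (hX j)
  have hP := hasDerivAt_rampInt hf a t (‖k‖ ^ 2)
  have hj : ∀ j, HasDerivAt (fun t => (starRingEnd ℂ (freeGrad n n' t j k) *
      (freeGrad n n' t j k + 2 * (Real.pi⁻¹ : ℝ) * (k j : ℂ) * rampInt f a t (‖k‖ ^ 2))).re) _ t :=
    fun j => (Complex.reCLM.hasFDerivAt).comp_hasDerivAt t
      ((hXc j).mul ((hX j).add (hP.const_mul (2 * ((Real.pi⁻¹ : ℝ) : ℂ) * (k j : ℂ)))))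
  have h := (hj 0).add (hj 1)
  simp only [regularDensity, Fin.sum_univ_two]
  convert! h using 1
  simp only [regularPairing, Fin.sum_univ_two, norm_sq_eq_sum k, Pi.add_apply]
  generalize freeGrad n n' t 0 k = X
  generalize freeGrad n n' t 1 k = Y
  generalize oscInt f a t (k 0 ^ 2 + k 1 ^ 2) = F
  generalize rampInt f a t (k 0 ^ 2 + k 1 ^ 2) = P
  generalize Real.pi⁻¹ = c
  generalize k 0 = x
  generalize k 1 = y
  generalize n k = m
  simp [Complex.mul_re, Complex.mul_im, -Complex.ofReal_add, -Complex.ofReal_pow,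
    -Complex.ofReal_mul, -Complex.ofReal_div]
  ring

lemma integrable_weight_sq : Integrable fun k : Plane => ((1 + ‖k‖ ^ 2)⁻¹) ^ 2 := by
  have h := integrable_one_add_norm (E := Plane) (μ := volume) (r := 4) (by simp; norm_num)
  refine (h.const_mul 4).mono' (Continuous.aestronglyMeasurable ?_)
    (Eventually.of_forall fun k => ?_)
  · exact (Continuous.inv₀ (by fun_prop) fun k => by positivity).pow 2
  · rw [Real.norm_of_nonneg (by positivity), show (-(4 : ℝ)) = -((4 : ℕ) : ℝ) by norm_num,
      Real.rpow_neg (by positivity), Real.rpow_natCast, inv_pow, ← div_eq_mul_inv,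
      inv_eq_one_div, div_le_div_iff₀ (by positivity) (by positivity)]
    have h1 : (1 + ‖k‖) ^ 2 ≤ 2 * (1 + ‖k‖ ^ 2) := by nlinarith [sq_nonneg (1 - ‖k‖)]
    calc 1 * (1 + ‖k‖) ^ 4 = ((1 + ‖k‖) ^ 2) ^ 2 := by ring
      _ ≤ (2 * (1 + ‖k‖ ^ 2)) ^ 2 := pow_le_pow_left₀ (by positivity) h1 2
      _ = 4 * (1 + ‖k‖ ^ 2) ^ 2 := by ring

section Bounds

variable {n : Plane → ℂ} {n' : Fin 2 → Plane → ℂ} {C : ℝ}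

lemma IsDecayingProfile.nonneg (hn : IsDecayingProfile n n' C) : 0 ≤ C := by
  have := (norm_nonneg _).trans (hn.norm_le 0)
  simpa using this

lemma weight_bounds (k : Plane) : 0 ≤ (1 + ‖k‖ ^ 2)⁻¹ ∧ (1 + ‖k‖ ^ 2)⁻¹ ≤ 1 ∧
    (1 + ‖k‖) ^ 2 * (1 + ‖k‖ ^ 2)⁻¹ ≤ 2 := by
  refine ⟨by positivity, inv_le_one_of_one_le₀ (by nlinarith [sq_nonneg ‖k‖]), ?_⟩
  rw [← div_eq_mul_inv, div_le_iff₀ (by positivity)]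
  nlinarith [sq_nonneg (1 - ‖k‖)]

lemma IsDecayingProfile.norm_freeGrad_le (hn : IsDecayingProfile n n' C) {τ t : ℝ} (ht : |t| ≤ τ)
    (j : Fin 2) (k : Plane) :
    ‖freeGrad n n' t j k‖ ≤ (C + 2 * τ * C) * ((1 + ‖k‖) * ((1 + ‖k‖ ^ 2)⁻¹) ^ 3) := by
  have hC := hn.nonneg
  have hk := abs_coord_le_norm k j
  have hw := (weight_bounds k).1
  set w := (1 + ‖k‖ ^ 2)⁻¹
  have h2 : ‖2 * Complex.I * t * (k j : ℂ) * n k‖ ≤ 2 * τ * (1 + ‖k‖) * (C * w ^ 3) := by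
    have e : ‖2 * Complex.I * t * (k j : ℂ) * n k‖ = 2 * |t| * |k j| * ‖n k‖ := by simp
    rw [e]
    have : 0 ≤ τ := (abs_nonneg _).trans ht
    gcongr
    · linarith
    · exact hn.norm_le k
  calc ‖freeGrad n n' t j k‖ ≤ ‖n' j k‖ + ‖2 * Complex.I * t * (k j : ℂ) * n k‖ := norm_sub_le _ _
    _ ≤ C * (1 + ‖k‖) * w ^ 3 + 2 * τ * (1 + ‖k‖) * (C * w ^ 3) :=
        add_le_add (hn.norm_grad_le j k) h2
    _ = _ := by ring

lemma IsDecayingProfile.continuous_freeGrad (hn : IsDecayingProfile n n' C) (t : ℝ) (j : Fin 2) :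
    Continuous (freeGrad n n' t j) := by
  have h1 := hn.continuous
  have h2 := hn.continuous_grad j
  unfold freeGrad
  fun_prop

variable {f : ℝ → ℂ} {a t τ K : ℝ}

lemma continuous_oscInt_norm_sq (hf : Continuous f) (a t : ℝ) :
    Continuous fun k : Plane => oscInt f a t (‖k‖ ^ 2) :=
  (continuous_oscInt_freq hf a t).comp (by fun_prop)

lemma continuous_rampInt_norm_sq (hf : Continuous f) (a t : ℝ) :
    Continuous fun k : Plane => rampInt f a t (‖k‖ ^ 2) :=
  (continuous_rampInt_freq hf a t).comp (by fun_prop)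

lemma IsDecayingProfile.norm_regularPairing_le (hn : IsDecayingProfile n n' C) (ht : |t| ≤ τ)
    (hF : ∀ u, ‖oscInt f a t u‖ ≤ K) (hP : ∀ u, ‖rampInt f a t u‖ ≤ K) (k : Plane) :
    ‖regularPairing n n' f a t k‖ ≤
      ((C + K) * (4 * (C + 2 * τ * C)) + 2 * C * K) * ((1 + ‖k‖ ^ 2)⁻¹) ^ 2 := by
  have hC := hn.nonneg
  have hK : 0 ≤ K := (norm_nonneg _).trans (hF 0)
  have hτ : 0 ≤ τ := (abs_nonneg _).trans ht
  obtain ⟨hw0, hw1, hpw⟩ := weight_bounds k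
  have hX := fun j => hn.norm_freeGrad_le ht j k
  have hnk := hn.norm_le k
  set w := (1 + ‖k‖ ^ 2)⁻¹
  set p := 1 + ‖k‖ with hp
  have hp0 : 0 ≤ p := by positivity
  have hkp : ‖k‖ ≤ p := by rw [hp]; linarith
  set D := C + 2 * τ * C
  have hD : 0 ≤ D := by positivity
  have hπ : Real.pi⁻¹ ≤ 1 := inv_le_one_of_one_le₀ (by linarith [Real.pi_gt_three])
  have hπ0 : 0 ≤ Real.pi⁻¹ := by positivity
  have hw3 : w ^ 3 ≤ 1 := pow_le_one₀ hw0 hw1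
  have h1 : ‖n k + Complex.I * ((Real.pi⁻¹ / 2 : ℝ) : ℂ) * oscInt f a t (‖k‖ ^ 2)‖ ≤ C + K := by
    refine (norm_add_le _ _).trans (add_le_add ?_ ?_)
    · exact hnk.trans (mul_le_of_le_one_right hC hw3)
    · rw [norm_mul, norm_mul, Complex.norm_I, one_mul, Complex.norm_real,
        Real.norm_of_nonneg (by positivity)]
      calc Real.pi⁻¹ / 2 * ‖oscInt f a t (‖k‖ ^ 2)‖ ≤ 1 * K := by
            gcongr
            · linarith
            · exact hF _
        _ = K := one_mul K
  have h2 : ‖∑ j : Fin 2, (k j : ℂ) * starRingEnd ℂ (freeGrad n n' t j k)‖ ≤ 4 * D * w ^ 2 := by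
    have hj : ∀ j : Fin 2, ‖(k j : ℂ) * starRingEnd ℂ (freeGrad n n' t j k)‖ ≤ 2 * D * w ^ 2 := by
      intro j
      rw [norm_mul, RCLike.norm_conj, Complex.norm_real, Real.norm_eq_abs]
      calc |k j| * ‖freeGrad n n' t j k‖ ≤ p * (D * (p * w ^ 3)) := by
            gcongr
            · exact (abs_coord_le_norm k j).trans hkp
            · exact hX j
        _ = D * w ^ 2 * (p ^ 2 * w) := by ring
        _ ≤ D * w ^ 2 * 2 := by gcongr
        _ = 2 * D * w ^ 2 := by ring
    rw [Fin.sum_univ_two]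
    refine (norm_add_le _ _).trans ((add_le_add (hj 0) (hj 1)).trans_eq ?_)
    ring
  have h3 : ‖n k * ((Real.pi⁻¹ * ‖k‖ ^ 2 : ℝ) : ℂ) * starRingEnd ℂ (rampInt f a t (‖k‖ ^ 2))‖ ≤
      2 * C * K * w ^ 2 := by
    rw [norm_mul, norm_mul, RCLike.norm_conj, Complex.norm_real,
      Real.norm_of_nonneg (by positivity)]
    calc ‖n k‖ * (Real.pi⁻¹ * ‖k‖ ^ 2) * ‖rampInt f a t (‖k‖ ^ 2)‖
        ≤ (C * w ^ 3) * (1 * p ^ 2) * K := by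
          gcongr
          exact hP _
      _ = C * K * w ^ 2 * (p ^ 2 * w) := by ring
      _ ≤ C * K * w ^ 2 * 2 := by gcongr
      _ = _ := by ring
  refine (norm_add_le _ _).trans ?_
  rw [norm_mul]
  calc _ ≤ (C + K) * (4 * D * w ^ 2) + 2 * C * K * w ^ 2 := by gcongr
    _ = _ := by ring

lemma IsDecayingProfile.continuous_regularPairing (hn : IsDecayingProfile n n' C)
    (hf : Continuous f) (a t : ℝ) : Continuous (regularPairing n n' f a t) := by
  have h1 := hn.continuous
  have h2 := fun j => hn.continuous_freeGrad t j
  have h3 := continuous_oscInt_norm_sq hf a t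
  have h4 := continuous_rampInt_norm_sq hf a t
  unfold regularPairing
  simp only [Fin.sum_univ_two]
  have h5 := h2 0
  have h6 := h2 1
  have hs : Continuous (starRingEnd ℂ) := Complex.continuous_conj
  fun_prop

lemma IsDecayingProfile.integrable_regularPairing (hn : IsDecayingProfile n n' C)
    (hf : Continuous f) (hF : ∀ u, ‖oscInt f a t u‖ ≤ K) (hP : ∀ u, ‖rampInt f a t u‖ ≤ K) :
    Integrable (regularPairing n n' f a t) :=
  (integrable_weight_sq.const_mul _).mono'
    (hn.continuous_regularPairing hf a t).aestronglyMeasurable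
    (Eventually.of_forall fun k => hn.norm_regularPairing_le le_rfl hF hP k)

lemma IsDecayingProfile.continuous_regularDensity (hn : IsDecayingProfile n n' C)
    (hf : Continuous f) (a t : ℝ) : Continuous (regularDensity n n' f a t) := by
  have h2 := fun j => hn.continuous_freeGrad t j
  have h4 := continuous_rampInt_norm_sq hf a t
  unfold regularDensity
  have hs : Continuous (starRingEnd ℂ) := Complex.continuous_conj
  refine continuous_finsetSum _ fun j _ => Complex.continuous_re.comp ?_
  have h5 := h2 j
  fun_prop

lemma IsDecayingProfile.integrable_regularDensity (hn : IsDecayingProfile n n' C)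
    (hf : Continuous f) (hP : ∀ u, ‖rampInt f a t u‖ ≤ K) :
    Integrable (regularDensity n n' f a t) := by
  have hC := hn.nonneg
  have hK : 0 ≤ K := (norm_nonneg _).trans (hP 0)
  refine (integrable_weight_sq.const_mul
    (2 * ((C + 2 * |t| * C) * (2 * ((C + 2 * |t| * C) + 2 * K))))).mono'
    (hn.continuous_regularDensity hf a t).aestronglyMeasurable
    (Eventually.of_forall fun k => ?_)
  obtain ⟨hw0, hw1, hpw⟩ := weight_bounds k
  have hX := fun j => hn.norm_freeGrad_le (le_refl |t|) j k
  set w := (1 + ‖k‖ ^ 2)⁻¹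
  set p := 1 + ‖k‖ with hp
  have hp0 : 0 ≤ p := by positivity
  have hkp : ‖k‖ ≤ p := by rw [hp]; linarith
  set D := C + 2 * |t| * C
  have hD : 0 ≤ D := by positivity
  have hπ : Real.pi⁻¹ ≤ 1 := inv_le_one_of_one_le₀ (by linarith [Real.pi_gt_three])
  have hπ0 : 0 ≤ Real.pi⁻¹ := by positivity
  have hw3 : w ^ 3 ≤ 1 := pow_le_one₀ hw0 hw1
  have hj : ∀ j : Fin 2, ‖(starRingEnd ℂ (freeGrad n n' t j k) * (freeGrad n n' t j k +
      2 * (Real.pi⁻¹ : ℝ) * (k j : ℂ) * rampInt f a t (‖k‖ ^ 2))).re‖ ≤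
      D * (2 * (D + 2 * K)) * w ^ 2 := by
    intro j
    refine (Complex.abs_re_le_norm _).trans ?_
    rw [norm_mul, RCLike.norm_conj]
    have e : ‖2 * ((Real.pi⁻¹ : ℝ) : ℂ) * (k j : ℂ) * rampInt f a t (‖k‖ ^ 2)‖ =
        2 * Real.pi⁻¹ * |k j| * ‖rampInt f a t (‖k‖ ^ 2)‖ := by
      rw [norm_mul, norm_mul, norm_mul, Complex.norm_real, Complex.norm_real,
        Real.norm_of_nonneg hπ0, Real.norm_eq_abs]
      simp
    have h1 : ‖freeGrad n n' t j k + 2 * (Real.pi⁻¹ : ℝ) * (k j : ℂ) *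
        rampInt f a t (‖k‖ ^ 2)‖ ≤ D * p + 2 * 1 * p * K := by
      refine (norm_add_le _ _).trans (add_le_add ((hX j).trans ?_) ?_)
      · gcongr
        exact mul_le_of_le_one_right hp0 hw3
      · rw [e]
        gcongr
        · exact (abs_coord_le_norm k j).trans hkp
        · exact hP _
    calc _ ≤ (D * (p * w ^ 3)) * (D * p + 2 * 1 * p * K) := by
          gcongr
          exact hX j
      _ = D * (D + 2 * K) * w ^ 2 * (p ^ 2 * w) := by ring
      _ ≤ D * (D + 2 * K) * w ^ 2 * 2 := by gcongr
      _ = _ := by ring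
  rw [regularDensity, Fin.sum_univ_two]
  refine (norm_add_le _ _).trans ((add_le_add (hj 0) (hj 1)).trans_eq ?_)
  ring

lemma IsDecayingProfile.continuous_fullGrad (hn : IsDecayingProfile n n' C)
    (hf : Continuous f) (a t : ℝ) (j : Fin 2) : Continuous (fullGrad n n' f a t j) := by
  have h2 := hn.continuous_freeGrad t j
  have h4 := continuous_rampInt_norm_sq hf a t
  unfold fullGrad
  fun_prop

end Bounds

/-- Up to the limit `ℓ` that describes the term quadratic in the charge, the time derivative of
`∫ |∇ψ̂_t|²` is four times the imaginary part of `∫ ψ̂_t k·(∇ψ̂_t)^*`. -/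
lemma exists_hasDerivAt_integral_fullGrad {n : Plane → ℂ} {n' : Fin 2 → Plane → ℂ} {C : ℝ}
    (hn : IsDecayingProfile n n' C) {f : ℝ → ℂ} (hf : Continuous f) {a b : ℝ} (hab : a ≤ b)
    (hE : IntegrableOn (fun u => u * ‖oscInt f a b u‖ ^ 2) (Set.Ioi 0)) :
    ∃ (B : ℝ) (ℓ : ℝ → ℝ), ∀ t ∈ Set.Ioo a b,
      (∀ j, MemLp (fullGrad n n' f a t j) 2 volume) ∧
      |4 * (∫ k, regularPairing n n' f a t k).im + Real.pi⁻¹ * (2 * ℓ t)| ≤ B ∧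
      HasDerivAt (fun t => ∫ k, ∑ j : Fin 2, ‖fullGrad n n' f a t j k‖ ^ 2)
        (4 * (∫ k, regularPairing n n' f a t k).im + Real.pi⁻¹ * (2 * ℓ t)) t ∧
      Integrable (regularPairing n n' f a t) ∧
      Tendsto (fun ε => rampPairing f a ε t) (𝓝[>] 0) (𝓝 (ℓ t)) := by
  obtain ⟨K, hK, -, hb⟩ := exists_bound_osc hf hab
  obtain ⟨C₁, ℓ, hℓ⟩ := exists_hasDerivAt_rampEnergy hf hab hE
  set τ := max |a| |b| with hτ
  have htτ : ∀ t ∈ Set.Ioo a b, |t| ≤ τ := fun t ht => abs_le_max_abs_abs ht.1.le ht.2.le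
  have hIcc : ∀ t ∈ Set.Ioo a b, t ∈ Set.Icc (a - 1) (b + 1) := fun t ht =>
    ⟨by linarith [ht.1], by linarith [ht.2]⟩
  have hF : ∀ t ∈ Set.Ioo a b, ∀ u, ‖oscInt f a t u‖ ≤ K := fun t ht u => (hb t (hIcc t ht) u).1
  have hP : ∀ t ∈ Set.Ioo a b, ∀ u, ‖rampInt f a t u‖ ≤ K := fun t ht u =>
    (hb t (hIcc t ht) u).2.2
  set B₀ := (C + K) * (4 * (C + 2 * τ * C)) + 2 * C * K with hB₀
  have hbound : ∀ t ∈ Set.Ioo a b, ∀ k, ‖regularPairing n n' f a t k‖ ≤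
      B₀ * ((1 + ‖k‖ ^ 2)⁻¹) ^ 2 := fun t ht k =>
    hn.norm_regularPairing_le (htτ t ht) (hF t ht) (hP t ht) k
  have hint : ∀ t ∈ Set.Ioo a b, Integrable (regularPairing n n' f a t) := fun t ht =>
    hn.integrable_regularPairing hf (hF t ht) (hP t ht)
  have hdens : ∀ t ∈ Set.Ioo a b, Integrable (regularDensity n n' f a t) := fun t ht =>
    hn.integrable_regularDensity hf (hP t ht)
  have hmr : ∀ t, AEStronglyMeasurable (fun u => u * ‖rampInt f a t u‖ ^ 2)
      (volume.restrict (Set.Ioi (0 : ℝ))) := fun t => by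
    have := continuous_rampInt_freq hf a t
    exact Continuous.aestronglyMeasurable (by fun_prop)
  have hramp : ∀ t ∈ Set.Ioo a b, Integrable fun k : Plane =>
      ‖k‖ ^ 2 * ‖rampInt f a t (‖k‖ ^ 2)‖ ^ 2 := fun t ht =>
    (integrable_radial_iff (hmr t)).2 (hℓ t ht).1
  refine ⟨4 * (B₀ * ∫ k : Plane, ((1 + ‖k‖ ^ 2)⁻¹) ^ 2) + Real.pi⁻¹ * (2 * C₁), ℓ,
    fun t ht => ⟨fun j => ?_, ?_, ?_, hint t ht, (hℓ t ht).2.2.2⟩⟩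
  · rw [memLp_two_iff_integrable_sq_norm (hn.continuous_fullGrad hf a t j).aestronglyMeasurable]
    have hs : Integrable fun k => ∑ j : Fin 2, ‖fullGrad n n' f a t j k‖ ^ 2 := by
      simp only [sum_norm_fullGrad_sq]
      exact (hdens t ht).add ((hramp t ht).const_mul _)
    refine hs.mono' ((hn.continuous_fullGrad hf a t j).norm.pow 2).aestronglyMeasurable
      (Eventually.of_forall fun k => ?_)
    rw [Real.norm_of_nonneg (by positivity)]
    exact Finset.single_le_sum (f := fun j => ‖fullGrad n n' f a t j k‖ ^ 2)
      (fun j _ => by positivity) (Finset.mem_univ j)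
  · have h1 : |(∫ k, regularPairing n n' f a t k).im| ≤
        B₀ * ∫ k : Plane, ((1 + ‖k‖ ^ 2)⁻¹) ^ 2 := by
      refine (Complex.abs_im_le_norm _).trans ?_
      rw [← integral_const_mul]
      exact norm_integral_le_of_norm_le (integrable_weight_sq.const_mul _)
        (Eventually.of_forall (hbound t ht))
    have h2 := (hℓ t ht).2.1
    refine (abs_add_le _ _).trans (add_le_add ?_ ?_)
    · rw [abs_mul, abs_of_pos (by norm_num : (0 : ℝ) < 4)]
      gcongr
    · rw [abs_mul, abs_mul, abs_of_pos (by positivity : 0 < Real.pi⁻¹),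
        abs_of_pos (by norm_num : (0 : ℝ) < 2)]
      gcongr
  · have hd := (hasDerivAt_integral_of_dominated_loc_of_deriv_le
      (F := fun t k => regularDensity n n' f a t k)
      (F' := fun t k => 4 * (regularPairing n n' f a t k).im)
      (bound := fun k => 4 * (B₀ * ((1 + ‖k‖ ^ 2)⁻¹) ^ 2)) (Ioo_mem_nhds ht.1 ht.2)
      (Eventually.of_forall fun t => (hn.continuous_regularDensity hf a t).aestronglyMeasurable)
      (hdens t ht)
      ((Complex.continuous_im.comp
        (hn.continuous_regularPairing hf a t)).const_mul 4).aestronglyMeasurable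
      (Eventually.of_forall fun k s hs => by
        rw [norm_mul, Real.norm_of_nonneg (by norm_num : (0 : ℝ) ≤ 4)]
        gcongr
        exact (Complex.abs_im_le_norm _).trans (hbound s hs k))
      ((integrable_weight_sq.const_mul _).const_mul _)
      (Eventually.of_forall fun k s _ => hasDerivAt_regularDensity n n' hf a s k)).2
    have him : ∫ k, 4 * (regularPairing n n' f a t k).im =
        4 * (∫ k, regularPairing n n' f a t k).im := by
      rw [integral_const_mul]
      congr 1
      exact integral_im (hint t ht)
    rw [him] at hd
    refine (hd.add ((hℓ t ht).2.2.1.const_mul Real.pi⁻¹)).congr_of_eventuallyEq ?_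
    filter_upwards [Ioo_mem_nhds ht.1 ht.2] with s hs
    simp only [sum_norm_fullGrad_sq]
    rw [integral_add (hdens s hs) ((hramp s hs).const_mul _), integral_const_mul,
      integral_radial (h := fun u => u * ‖rampInt f a s u‖ ^ 2) (hmr s)]
    simp only [Pi.add_apply, smul_eq_mul]
    congr 1
    field_simp

/-- The improper integral of `ψ̂_t k·(∇ψ̂_t)^*`: in polar coordinates the term quadratic in the
charge becomes a one-dimensional improper integral. -/
lemma tendsto_setIntegral_pairing {n : Plane → ℂ} {n' : Fin 2 → Plane → ℂ} {f : ℝ → ℂ}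
    (hf : Continuous f) {a t : ℝ} (hint : Integrable (regularPairing n n' f a t)) {j : ℂ}
    (hj : Tendsto (fun U => ∫ u in (0 : ℝ)..U,
      (u : ℂ) * (oscInt f a t u * starRingEnd ℂ (rampInt f a t u))) atTop (𝓝 j)) :
    Tendsto (fun R => ∫ k in Metric.closedBall (0 : Plane) R,
      (n k + Complex.I * ((Real.pi⁻¹ / 2 : ℝ) : ℂ) * oscInt f a t (‖k‖ ^ 2)) *
        ∑ j : Fin 2, (k j : ℂ) * starRingEnd ℂ (fullGrad n n' f a t j k)) atTop
      (𝓝 ((∫ k, regularPairing n n' f a t k) + Complex.I * ((Real.pi⁻¹ / 2 : ℝ) : ℂ) * j)) := by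
  have hcF := continuous_oscInt_freq hf a t
  have hcP := continuous_rampInt_freq hf a t
  have hs : Continuous (starRingEnd ℂ) := Complex.continuous_conj
  set h : ℝ → ℂ := fun u => Complex.I * ((Real.pi⁻¹ ^ 2 / 2 : ℝ) : ℂ) *
    ((u : ℂ) * (oscInt f a t u * starRingEnd ℂ (rampInt f a t u))) with hh
  have hc : Continuous h := by rw [hh]; fun_prop
  have hsplit : ∀ k : Plane, (n k + Complex.I * ((Real.pi⁻¹ / 2 : ℝ) : ℂ) *
      oscInt f a t (‖k‖ ^ 2)) * ∑ j : Fin 2, (k j : ℂ) * starRingEnd ℂ (fullGrad n n' f a t j k) =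
      regularPairing n n' f a t k + h (‖k‖ ^ 2) := by
    intro k
    have hk : ((‖k‖ ^ 2 : ℝ) : ℂ) = (k 0 : ℂ) ^ 2 + (k 1 : ℂ) ^ 2 := by
      rw [norm_sq_eq_sum]; push_cast; ring
    simp only [hh, regularPairing, fullGrad, Fin.sum_univ_two, map_add, map_mul,
      Complex.conj_ofReal, Complex.ofReal_mul, Complex.ofReal_div, Complex.ofReal_ofNat]
    rw [Complex.ofReal_pow Real.pi⁻¹ 2, hk]
    ring
  simp only [hsplit]
  have hball : Tendsto (fun R => ∫ k in Metric.closedBall (0 : Plane) R,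
      regularPairing n n' f a t k) atTop (𝓝 (∫ k, regularPairing n n' f a t k)) :=
    (aecover_closedBall (μ := volume) (x := (0 : Plane))
      tendsto_id).integral_tendsto_of_countably_generated hint
  have hrad : Tendsto (fun R : ℝ => Complex.I * ((Real.pi⁻¹ / 2 : ℝ) : ℂ) *
      ∫ u in (0 : ℝ)..R ^ 2, (u : ℂ) * (oscInt f a t u * starRingEnd ℂ (rampInt f a t u))) atTop
      (𝓝 (Complex.I * ((Real.pi⁻¹ / 2 : ℝ) : ℂ) * j)) :=
    (hj.comp (tendsto_pow_atTop (by norm_num))).const_mul _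
  refine (hball.add hrad).congr' ?_
  filter_upwards [eventually_ge_atTop 0] with R hR
  have hk2 : Continuous fun k : Plane => ‖k‖ ^ 2 := by fun_prop
  have hi : IntegrableOn (fun k : Plane => h (‖k‖ ^ 2)) (Metric.closedBall 0 R) :=
    ((hc.comp hk2).continuousOn).integrableOn_compact (isCompact_closedBall _ _)
  rw [integral_add hint.integrableOn hi, setIntegral_radial hc hR]
  congr 1
  simp only [hh]
  rw [intervalIntegral.integral_const_mul, Complex.real_smul, ← mul_assoc]
  congr 1
  have : (Real.pi : ℂ) ≠ 0 := by exact_mod_cast Real.pi_ne_zero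
  push_cast
  field_simp

/-- The Abel sum of the quadratic pairing is the real part of its improper integral. -/
lemma tendsto_rampPairing_of_tendsto {f : ℝ → ℂ} (hf : Continuous f) {a b t : ℝ} (hab : a ≤ b)
    (ht : t ∈ Set.Icc (a - 1) (b + 1)) {j : ℂ}
    (hj : Tendsto (fun U => ∫ u in (0 : ℝ)..U,
      (u : ℂ) * (oscInt f a t u * starRingEnd ℂ (rampInt f a t u))) atTop (𝓝 j)) :
    Tendsto (fun ε => rampPairing f a ε t) (𝓝[>] 0) (𝓝 j.re) := by
  obtain ⟨K, hK, -, hb⟩ := exists_bound_osc hf hab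
  have c1 := continuous_oscInt_freq hf a t
  have c2 := continuous_rampInt_freq hf a t
  have hs : Continuous (starRingEnd ℂ) := Complex.continuous_conj
  have hi : ∀ ε > 0, IntegrableOn (fun u : ℝ => Real.exp (-(ε * u)) •
      ((u : ℂ) * (oscInt f a t u * starRingEnd ℂ (rampInt f a t u)))) (Set.Ioi 0) := by
    intro ε hε
    have h := (integrableOn_exp_mul_id hε).ofReal (𝕜 := ℂ)
    refine (h.mul_bdd (c := K * K)
      (g := fun u => oscInt f a t u * starRingEnd ℂ (rampInt f a t u))
      (Continuous.aestronglyMeasurable (by fun_prop)) (Eventually.of_forall fun u => ?_)).congr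
      (Eventually.of_forall fun u => ?_)
    · rw [norm_mul, RCLike.norm_conj]
      exact mul_le_mul (hb t ht u).1 (hb t ht u).2.2 (norm_nonneg _) hK
    · simp only [Complex.real_smul, Complex.coe_algebraMap, Complex.ofReal_mul]
      ring
  have h := tendsto_integral_exp_neg_mul_of_tendsto_intervalIntegral (g := fun u : ℝ =>
    (u : ℂ) * (oscInt f a t u * starRingEnd ℂ (rampInt f a t u))) (by fun_prop) hi hj
  refine ((Complex.continuous_re.tendsto j).comp h).congr' ?_
  filter_upwards [self_mem_nhdsWithin] with ε hε
  rw [rampPairing, Function.comp_apply]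
  refine (integral_re (hi ε hε)).symm.trans ?_
  refine integral_congr_ae (Eventually.of_forall fun u => ?_)
  simp only [Complex.real_smul, RCLike.re_to_complex]
  rw [← mul_assoc, ← Complex.ofReal_mul, Complex.re_ofReal_mul]

/-! ### Extending the charge beyond a compact time interval -/

/-- What remains of `1/v` after subtracting the contribution of a smooth cut-off on `[-1, 0]`,
see `integral_cutoff`. -/
def tailSymbol (v : ℝ) : ℂ :=
  -6 * (1 + Complex.exp (-(Complex.I * v))) / (v : ℂ) ^ 3
    - 12 * Complex.I * (1 - Complex.exp (-(Complex.I * v))) / (v : ℂ) ^ 4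

/-- The derivative of `tailSymbol`. -/
def tailSymbolDeriv (v : ℝ) : ℂ :=
  6 * Complex.I * Complex.exp (-(Complex.I * v)) / (v : ℂ) ^ 3
    + (18 + 30 * Complex.exp (-(Complex.I * v))) / (v : ℂ) ^ 4
    + 48 * Complex.I * (1 - Complex.exp (-(Complex.I * v))) / (v : ℂ) ^ 5

lemma hasDerivAt_exp_neg_I_mul (v : ℝ) :
    HasDerivAt (fun v : ℝ => Complex.exp (-(Complex.I * v)))
      (-(Complex.I * Complex.exp (-(Complex.I * v)))) v := by
  have h1 : HasDerivAt (fun v : ℝ => -(Complex.I * (v : ℂ))) (-Complex.I) v := by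
    simpa using ((Complex.ofRealCLM.hasDerivAt (x := v)).const_mul Complex.I).fun_neg
  exact h1.cexp.congr_deriv (by ring)

lemma hasDerivAt_tailSymbol {v : ℝ} (hv : v ≠ 0) :
    HasDerivAt tailSymbol (tailSymbolDeriv v) v := by
  have hv' : (v : ℂ) ≠ 0 := by exact_mod_cast hv
  have h0 : HasDerivAt (fun v : ℝ => (v : ℂ)) 1 v := (hasDerivAt_id v).ofReal_comp
  have he := hasDerivAt_exp_neg_I_mul v
  have h := (((he.const_add 1).const_mul (-6)).fun_div (h0.fun_pow 3) (pow_ne_zero 3 hv')).fun_sub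
    (((he.const_sub 1).const_mul (12 * Complex.I)).fun_div (h0.fun_pow 4) (pow_ne_zero 4 hv'))
  refine h.congr_deriv ?_
  rw [tailSymbolDeriv]
  field_simp
  linear_combination (-12 * Complex.exp (-(Complex.I * v)) * (v : ℂ) ^ 4) * Complex.I_sq

lemma norm_exp_neg_I_mul (v : ℝ) : ‖Complex.exp (-(Complex.I * v))‖ = 1 := by
  rw [show -(Complex.I * (v : ℂ)) = ((-v : ℝ) : ℂ) * Complex.I by push_cast; ring]
  exact Complex.norm_exp_ofReal_mul_I _

/-- A constant that controls `tailSymbol` and its derivative at distance `c (1 + u)` from `0`. -/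
def tailBound (c : ℝ) : ℝ := 60 * (c⁻¹ ^ 3 + c⁻¹ ^ 4) + 96 * c⁻¹ ^ 5

lemma inv_abs_pow_le {c u v : ℝ} (hc : 0 < c) (hu : 0 ≤ u) (hv : c * (1 + u) ≤ |v|) (m : ℕ) :
    (|v| ^ (m + 3))⁻¹ ≤ c⁻¹ ^ (m + 3) * ((1 + u)⁻¹) ^ 3 := by
  have h1 : 0 < c * (1 + u) := by positivity
  have h2 : (|v| ^ (m + 3))⁻¹ ≤ ((c * (1 + u)) ^ (m + 3))⁻¹ :=
    inv_anti₀ (by positivity) (pow_le_pow_left₀ h1.le hv _)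
  refine h2.trans ?_
  rw [mul_pow, mul_inv, ← inv_pow, ← inv_pow]
  refine mul_le_mul_of_nonneg_left ?_ (by positivity)
  exact pow_le_pow_of_le_one (by positivity) (inv_le_one_of_one_le₀ (by linarith)) (by omega)

lemma norm_tailSymbol_le {c u v : ℝ} (hc : 0 < c) (hu : 0 ≤ u) (hv : c * (1 + u) ≤ |v|) :
    ‖tailSymbol v‖ ≤ tailBound c * ((1 + u)⁻¹) ^ 3 := by
  have he := norm_exp_neg_I_mul v
  have h3 := inv_abs_pow_le hc hu hv 0
  have h4 := inv_abs_pow_le hc hu hv 1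
  have e1 : ‖1 + Complex.exp (-(Complex.I * v))‖ ≤ 2 :=
    (norm_add_le _ _).trans (by rw [he, norm_one]; norm_num)
  have e2 : ‖1 - Complex.exp (-(Complex.I * v))‖ ≤ 2 :=
    (norm_sub_le _ _).trans (by rw [he, norm_one]; norm_num)
  have hw : 0 ≤ ((1 + u)⁻¹) ^ 3 := by positivity
  calc ‖tailSymbol v‖ ≤ 6 * 2 * (|v| ^ (0 + 3))⁻¹ + 12 * 2 * (|v| ^ (1 + 3))⁻¹ := by
        refine (norm_sub_le _ _).trans (add_le_add ?_ ?_)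
        · rw [norm_div, norm_mul, norm_neg, norm_pow, Complex.norm_real, Real.norm_eq_abs,
            div_eq_mul_inv]
          refine mul_le_mul_of_nonneg_right ?_ (by positivity)
          simpa using e1
        · rw [norm_div, norm_mul, norm_mul, norm_pow, Complex.norm_real, Real.norm_eq_abs,
            div_eq_mul_inv, Complex.norm_I]
          refine mul_le_mul_of_nonneg_right ?_ (by positivity)
          simpa using e2
    _ ≤ 6 * 2 * (c⁻¹ ^ (0 + 3) * ((1 + u)⁻¹) ^ 3) +
          12 * 2 * (c⁻¹ ^ (1 + 3) * ((1 + u)⁻¹) ^ 3) := by gcongr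
    _ = (12 * c⁻¹ ^ 3 + 24 * c⁻¹ ^ 4) * ((1 + u)⁻¹) ^ 3 := by ring
    _ ≤ tailBound c * ((1 + u)⁻¹) ^ 3 := by
        refine mul_le_mul_of_nonneg_right ?_ hw
        rw [tailBound]
        have p3 : 0 ≤ c⁻¹ ^ 3 := by positivity
        have p4 : 0 ≤ c⁻¹ ^ 4 := by positivity
        have p5 : 0 ≤ c⁻¹ ^ 5 := by positivity
        linarith

lemma norm_tailSymbolDeriv_le {c u v : ℝ} (hc : 0 < c) (hu : 0 ≤ u) (hv : c * (1 + u) ≤ |v|) :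
    ‖tailSymbolDeriv v‖ ≤ tailBound c * ((1 + u)⁻¹) ^ 3 := by
  have he := norm_exp_neg_I_mul v
  have h3 := inv_abs_pow_le hc hu hv 0
  have h4 := inv_abs_pow_le hc hu hv 1
  have h5 := inv_abs_pow_le hc hu hv 2
  have e1 : ‖18 + 30 * Complex.exp (-(Complex.I * v))‖ ≤ 48 :=
    (norm_add_le _ _).trans (by rw [norm_mul, he]; norm_num)
  have e2 : ‖1 - Complex.exp (-(Complex.I * v))‖ ≤ 2 :=
    (norm_sub_le _ _).trans (by rw [he, norm_one]; norm_num)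
  have hw : 0 ≤ ((1 + u)⁻¹) ^ 3 := by positivity
  calc ‖tailSymbolDeriv v‖ ≤ 6 * (|v| ^ (0 + 3))⁻¹ + 48 * (|v| ^ (1 + 3))⁻¹ +
        48 * 2 * (|v| ^ (2 + 3))⁻¹ := by
        refine (norm_add_le _ _).trans (add_le_add ((norm_add_le _ _).trans
          (add_le_add ?_ ?_)) ?_)
        · rw [norm_div, norm_mul, norm_mul, he, norm_pow, Complex.norm_real, Real.norm_eq_abs,
            div_eq_mul_inv, Complex.norm_I]
          simp
        · rw [norm_div, norm_pow, Complex.norm_real, Real.norm_eq_abs, div_eq_mul_inv]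
          exact mul_le_mul_of_nonneg_right e1 (by positivity)
        · rw [norm_div, norm_mul, norm_mul, norm_pow, Complex.norm_real, Real.norm_eq_abs,
            div_eq_mul_inv, Complex.norm_I]
          refine mul_le_mul_of_nonneg_right ?_ (by positivity)
          simpa using e2
    _ ≤ 6 * (c⁻¹ ^ (0 + 3) * ((1 + u)⁻¹) ^ 3) + 48 * (c⁻¹ ^ (1 + 3) * ((1 + u)⁻¹) ^ 3) +
          48 * 2 * (c⁻¹ ^ (2 + 3) * ((1 + u)⁻¹) ^ 3) := by gcongr
    _ = (6 * c⁻¹ ^ 3 + 48 * c⁻¹ ^ 4 + 96 * c⁻¹ ^ 5) * ((1 + u)⁻¹) ^ 3 := by ring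
    _ ≤ tailBound c * ((1 + u)⁻¹) ^ 3 := by
        refine mul_le_mul_of_nonneg_right ?_ hw
        rw [tailBound]
        have p3 : 0 ≤ c⁻¹ ^ 3 := by positivity
        have p4 : 0 ≤ c⁻¹ ^ 4 := by positivity
        linarith

/-- The cut-off `(1 + s)² (1 - 2s)` rises from `0` to `1` on `[-1, 0]` with vanishing slope at both
ends. -/
lemma integral_cutoff {v : ℝ} (hv : v ≠ 0) :
    ∫ s in (-1 : ℝ)..0, Complex.exp (Complex.I * v * s) * (((1 + s) ^ 2 * (1 - 2 * s) : ℝ) : ℂ) =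
      -Complex.I / v + Complex.I * tailSymbol v := by
  have hv' : (v : ℂ) ≠ 0 := by exact_mod_cast hv
  -- integration by parts, four times
  set A : ℝ → ℂ := fun s => Complex.exp (Complex.I * v * s) *
    (-Complex.I / v * (1 - 3 * (s : ℂ) ^ 2 - 2 * (s : ℂ) ^ 3) + (-6 * (s : ℂ) - 6 * (s : ℂ) ^ 2) /
      (v : ℂ) ^ 2 + Complex.I / (v : ℂ) ^ 3 * (-6 - 12 * (s : ℂ)) + 12 / (v : ℂ) ^ 4) with hA
  have hd : ∀ s : ℝ, HasDerivAt A
      (Complex.exp (Complex.I * v * s) * (((1 + s) ^ 2 * (1 - 2 * s) : ℝ) : ℂ)) s := by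
    intro s
    have h0 : HasDerivAt (fun s : ℝ => (s : ℂ)) 1 s := (hasDerivAt_id s).ofReal_comp
    have he := (h0.const_mul (Complex.I * (v : ℂ))).cexp
    have hp := ((((((h0.fun_pow 2).const_mul 3).const_sub 1).fun_sub
      ((h0.fun_pow 3).const_mul 2)).const_mul (-Complex.I / (v : ℂ))).fun_add
      (((h0.const_mul (-6)).fun_sub ((h0.fun_pow 2).const_mul 6)).div_const ((v : ℂ) ^ 2))).fun_add
      (((h0.const_mul 12).const_sub (-6)).const_mul (Complex.I / (v : ℂ) ^ 3))
    refine (he.fun_mul (hp.add_const (12 / (v : ℂ) ^ 4))).congr_deriv ?_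
    push_cast
    field_simp
    ring_nf
    simp only [Complex.I_sq]
    ring
  rw [intervalIntegral.integral_eq_sub_of_hasDerivAt (fun s _ => hd s)
    (Continuous.intervalIntegrable (by fun_prop) _ _)]
  simp only [hA, tailSymbol]
  have e1 : Complex.I * v * ((-1 : ℝ) : ℂ) = -(Complex.I * v) := by push_cast; ring
  rw [e1]
  simp only [Complex.ofReal_zero, Complex.ofReal_neg, Complex.ofReal_one, mul_zero,
    Complex.exp_zero]
  field_simp
  ring_nf
  simp only [Complex.I_sq]
  ring

/-- The projection of the time axis to `[0, T]`. -/
def clampTime (T s : ℝ) : ℝ := max 0 (min T s)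

/-- A continuous extension of the charge `q` from `[0, T]` to the time axis, supported in
`[-1, T + 1]`.  The phase `e^{i lam s}` makes its Fourier transform match `(|k|² + lam)⁻¹` at high
frequency. -/
def extendCharge (lam T : ℝ) (q : ℝ → ℂ) (s : ℝ) : ℂ :=
  q (clampTime T s) * Complex.exp (Complex.I * lam * (s - clampTime T s : ℝ)) *
    (((max 0 (1 - |s - clampTime T s|)) ^ 2 * (1 + 2 * |s - clampTime T s|) : ℝ) : ℂ)

lemma continuous_extendCharge {lam T : ℝ} (hT : 0 ≤ T) {q : ℝ → ℂ}
    (hq : ContinuousOn q (Set.Icc 0 T)) : Continuous (extendCharge lam T q) := by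
  have h1 : Continuous (clampTime T) := by unfold clampTime; fun_prop
  have h2 : Continuous fun s => q (clampTime T s) := hq.comp_continuous h1 fun s =>
    ⟨le_max_left _ _, max_le hT (min_le_left _ _)⟩
  exact (h2.mul (by fun_prop)).mul (by fun_prop)

lemma extendCharge_of_mem {lam T : ℝ} {q : ℝ → ℂ} {s : ℝ} (hs : s ∈ Set.Icc 0 T) :
    extendCharge lam T q s = q s := by
  have : clampTime T s = s := by rw [clampTime, min_eq_right hs.2, max_eq_right hs.1]
  simp [extendCharge, this]

lemma oscInt_extendCharge_left {lam T : ℝ} (hT : 0 ≤ T) (q : ℝ → ℂ) {u : ℝ} (hv : u + lam ≠ 0) :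
    oscInt (extendCharge lam T q) (-1) 0 u =
      q 0 * (-Complex.I / (u + lam : ℝ) + Complex.I * tailSymbol (u + lam)) := by
  rw [← integral_cutoff hv, ← intervalIntegral.integral_const_mul, oscInt]
  refine intervalIntegral.integral_congr fun s hs => ?_
  rw [Set.uIcc_of_le (by norm_num)] at hs
  have hc : clampTime T s = 0 := by
    rw [clampTime, min_eq_right (hs.2.trans hT), max_eq_left hs.2]
  have ha : |s - 0| = -s := by rw [sub_zero, abs_of_nonpos hs.2]
  simp only [extendCharge, hc, ha]
  rw [max_eq_right (by linarith [hs.1]), sub_neg_eq_add, mul_neg, ← sub_eq_add_neg, sub_zero,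
    Complex.ofReal_add, mul_add, add_mul, Complex.exp_add]
  ring

lemma oscInt_extendCharge_right {lam T : ℝ} (hT : 0 ≤ T) (q : ℝ → ℂ) {u : ℝ} (hv : u + lam ≠ 0) :
    oscInt (extendCharge lam T q) T (T + 1) u = q T * Complex.exp (Complex.I * u * T) *
      (Complex.I / (u + lam : ℝ) + Complex.I * tailSymbol (-(u + lam))) := by
  have h := integral_cutoff (neg_ne_zero.2 hv)
  rw [Complex.ofReal_neg, neg_div_neg_eq] at h
  rw [← h, ← intervalIntegral.integral_const_mul, oscInt]
  have hs := intervalIntegral.integral_comp_sub_left (a := -1) (b := 0)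
    (fun s : ℝ => Complex.exp (Complex.I * u * s) * extendCharge lam T q s) T
  rw [sub_zero, sub_neg_eq_add] at hs
  rw [← hs]
  refine intervalIntegral.integral_congr fun s hs => ?_
  rw [Set.uIcc_of_le (by norm_num)] at hs
  have hc : clampTime T (T - s) = T := by
    rw [clampTime, min_eq_left (by linarith [hs.2]), max_eq_right hT]
  have ha : |T - s - T| = -s := by
    rw [show T - s - T = -s by ring, abs_of_nonneg (by linarith [hs.2])]
  simp only [extendCharge, hc, ha]
  rw [max_eq_right (by linarith [hs.1]), sub_neg_eq_add, mul_neg, ← sub_eq_add_neg,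
    show T - s - T = -s by ring]
  have e : Complex.exp (Complex.I * -((u + lam : ℝ) : ℂ) * s) =
      Complex.exp (-(Complex.I * u * s)) * Complex.exp (Complex.I * lam * (-s : ℝ)) := by
    rw [← Complex.exp_add]; congr 1; push_cast; ring
  have e2 : Complex.exp (Complex.I * u * (T - s : ℝ)) =
      Complex.exp (Complex.I * u * T) * Complex.exp (-(Complex.I * u * s)) := by
    rw [← Complex.exp_add]; congr 1; push_cast; ring
  rw [e, e2]
  ring

/-! ### The initial charge -/

lemma norm_sq_eq_integral (g : L2) : ‖g‖ ^ 2 = ∫ x, ‖g x‖ ^ 2 := by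
  have h : ((‖g‖ ^ 2 : ℝ) : ℂ) = ((∫ x, ‖g x‖ ^ 2 : ℝ) : ℂ) := by
    rw [← integral_complex_ofReal, Complex.ofReal_pow]
    refine (inner_self_eq_norm_sq_to_K (𝕜 := ℂ) g).symm.trans ?_
    rw [L2.inner_def]
    refine integral_congr_ae (Eventually.of_forall fun x => ?_)
    simp only
    rw [inner_self_eq_norm_sq_to_K]
    push_cast
    rfl
  exact_mod_cast h

lemma integrable_norm_sq (g : L2) : Integrable fun x => ‖g x‖ ^ 2 :=
  (memLp_two_iff_integrable_sq_norm (Lp.aestronglyMeasurable g)).1 (Lp.memLp g)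

/-- The Fourier characterisation of `H¹`. -/
lemma H1.integrable_fourier (φ : H1) :
    Integrable fun ξ : Plane => ‖ξ‖ ^ 2 * ‖(𝓕 φ.toL2 : L2) ξ‖ ^ 2 := by
  have hj : ∀ j, (𝓕 (φ.grad j) : L2) =ᵐ[volume]
      fun ξ => (2 * Real.pi * Complex.I) * (ξ j : ℂ) * (𝓕 φ.toL2 : L2) ξ := fun j =>
    (lineDeriv_eq_iff_fourier _ _ j).1 (φ.isWeakGradient j)
  have h := (((integrable_norm_sq (𝓕 (φ.grad 0) : L2)).add
    (integrable_norm_sq (𝓕 (φ.grad 1) : L2))).const_mul ((2 * Real.pi) ^ 2)⁻¹)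
  refine h.congr ?_
  filter_upwards [hj 0, hj 1] with ξ h0 h1
  have hπ := Real.pi_pos
  simp only [Pi.add_apply, h0, h1, norm_mul, Complex.norm_I, Complex.norm_real,
    Real.norm_eq_abs, abs_of_pos hπ, RCLike.norm_ofNat, mul_one, mul_pow, sq_abs, norm_sq_eq_sum ξ]
  field_simp

/-- The Green function does not belong to `H¹`, so the charge is determined by the function. -/
lemma FormDomain.charge_eq {lam : ℝ} (hlam : 0 < lam) {χ₁ χ₂ : FormDomain lam}
    (h : χ₁.toL2 = χ₂.toL2) : χ₁.charge = χ₂.charge := by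
  by_contra hne
  have hq : 0 < ‖χ₁.charge - χ₂.charge‖ := norm_pos_iff.2 (sub_ne_zero.2 hne)
  have hc : Continuous fun ξ : Plane => ‖ξ‖ ^ 2 * greenSymbol lam ξ ^ 2 := by
    have := continuous_greenSymbol hlam
    fun_prop
  have hint : Integrable fun ξ : Plane => ‖ξ‖ ^ 2 * greenSymbol lam ξ ^ 2 := by
    refine (((χ₁.reg.integrable_fourier.add χ₂.reg.integrable_fourier).const_mul 2).const_mul
      (‖χ₁.charge - χ₂.charge‖ ^ 2)⁻¹).mono' hc.aestronglyMeasurable ?_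
    have h2 := χ₂.fourier_toL2 hlam
    rw [← h] at h2
    filter_upwards [χ₁.fourier_toL2 hlam, h2] with ξ e1 e2
    have e3 : (χ₁.charge - χ₂.charge) * (greenSymbol lam ξ : ℂ) =
        (𝓕 χ₂.reg.toL2 : L2) ξ - (𝓕 χ₁.reg.toL2 : L2) ξ := by linear_combination e2 - e1
    have e4 : ‖χ₁.charge - χ₂.charge‖ ^ 2 * greenSymbol lam ξ ^ 2 ≤
        2 * (‖(𝓕 χ₁.reg.toL2 : L2) ξ‖ ^ 2 + ‖(𝓕 χ₂.reg.toL2 : L2) ξ‖ ^ 2) := by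
      have := congrArg (fun z => ‖z‖ ^ 2) e3
      simp only [norm_mul, Complex.norm_real, Real.norm_eq_abs, mul_pow, sq_abs] at this
      rw [this]
      have hn := norm_sub_le ((𝓕 χ₂.reg.toL2 : L2) ξ) ((𝓕 χ₁.reg.toL2 : L2) ξ)
      nlinarith [sq_nonneg (‖(𝓕 χ₁.reg.toL2 : L2) ξ‖ - ‖(𝓕 χ₂.reg.toL2 : L2) ξ‖),
        norm_nonneg ((𝓕 χ₂.reg.toL2 : L2) ξ - (𝓕 χ₁.reg.toL2 : L2) ξ)]
    rw [Real.norm_of_nonneg (by positivity), le_inv_mul_iff₀ (by positivity)]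
    calc ‖χ₁.charge - χ₂.charge‖ ^ 2 * (‖ξ‖ ^ 2 * greenSymbol lam ξ ^ 2)
        = ‖ξ‖ ^ 2 * (‖χ₁.charge - χ₂.charge‖ ^ 2 * greenSymbol lam ξ ^ 2) := by ring
      _ ≤ ‖ξ‖ ^ 2 * (2 * (‖(𝓕 χ₁.reg.toL2 : L2) ξ‖ ^ 2 + ‖(𝓕 χ₂.reg.toL2 : L2) ξ‖ ^ 2)) := by
        gcongr
      _ = _ := by simp only [Pi.add_apply]; ring
  have hmeas : Measurable fun u : ℝ => u * ((4 * Real.pi ^ 2 * u + lam)⁻¹) ^ 2 := by fun_prop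
  have hrad := (integrable_radial_iff (h := fun u : ℝ => u * ((4 * Real.pi ^ 2 * u + lam)⁻¹) ^ 2)
    hmeas.aestronglyMeasurable).1 hint
  refine not_integrableOn_Ioi_inv (a := 1) ?_
  refine ((hrad.mono_set (Set.Ioi_subset_Ioi zero_le_one)).const_mul
    ((4 * Real.pi ^ 2 + lam) ^ 2)).mono' measurable_inv.aestronglyMeasurable ?_
  filter_upwards [ae_restrict_mem measurableSet_Ioi] with u hu
  have hu : 1 < u := hu
  have hu0 : 0 < u := by linarith
  rw [Real.norm_of_nonneg (by positivity)]
  have h1 : 4 * Real.pi ^ 2 * u + lam ≤ (4 * Real.pi ^ 2 + lam) * u := by nlinarith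
  have h2 : ((4 * Real.pi ^ 2 + lam) * u)⁻¹ ≤ (4 * Real.pi ^ 2 * u + lam)⁻¹ :=
    inv_anti₀ (by positivity) h1
  calc u⁻¹ = (4 * Real.pi ^ 2 + lam) ^ 2 * (u * (((4 * Real.pi ^ 2 + lam) * u)⁻¹) ^ 2) := by
        have : 4 * Real.pi ^ 2 + lam ≠ 0 := by positivity
        field_simp
    _ ≤ _ := by gcongr

/-! ### The unitary Fourier transform -/

lemma coeFn_fourierHat (f : L2) : fourierHat f =ᵐ[volume]
    fun k => ((2 * Real.pi : ℝ) : ℂ)⁻¹ * (𝓕 f : L2) ((2 * Real.pi)⁻¹ • k) :=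
  MemLp.coeFn_toLp _

/-- Dilations preserve null sets. -/
lemma ae_smul {p : Plane → Prop} (h : ∀ᵐ ξ, p ξ) {c : ℝ} (hc : c ≠ 0) :
    ∀ᵐ k : Plane, p (c • k) := by
  have hq : Measure.QuasiMeasurePreserving (fun k : Plane => c • k) volume volume :=
    ⟨measurable_const_smul c, by
      rw [Measure.map_addHaar_smul _ hc]
      exact Measure.smul_absolutelyContinuous⟩
  exact hq.ae h

lemma freq_smul (k : Plane) : freq ((2 * Real.pi)⁻¹ • k) = ‖k‖ ^ 2 := by
  rw [freq, norm_smul, Real.norm_of_nonneg (by positivity)]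
  field_simp
  norm_num

lemma FormDomain.fourierHat_toL2 {lam : ℝ} (hlam : 0 < lam) (χ : FormDomain lam) :
    fourierHat χ.toL2 =ᵐ[volume] fun k => fourierHat χ.reg.toL2 k +
      χ.charge * ((Real.pi⁻¹ / 2 : ℝ) : ℂ) / ((‖k‖ ^ 2 + lam : ℝ) : ℂ) := by
  filter_upwards [coeFn_fourierHat χ.toL2, coeFn_fourierHat χ.reg.toL2,
    ae_smul (χ.fourier_toL2 hlam) (c := (2 * Real.pi)⁻¹) (by positivity)] with k h1 h2 h3
  have hg : greenSymbol lam ((2 * Real.pi)⁻¹ • k) = (‖k‖ ^ 2 + lam)⁻¹ := by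
    rw [← freq_smul]; rfl
  rw [h1, h2, h3, hg]
  have : (Real.pi : ℂ) ≠ 0 := by exact_mod_cast Real.pi_ne_zero
  push_cast
  field_simp

lemma H1.integrable_fourierHat (φ : H1) :
    Integrable fun k : Plane => ‖k‖ ^ 2 * ‖fourierHat φ.toL2 k‖ ^ 2 := by
  have h := φ.integrable_fourier.comp_smul (R := (2 * Real.pi)⁻¹) (by positivity)
  refine h.congr ?_
  filter_upwards [coeFn_fourierHat φ.toL2] with k hk
  rw [hk, norm_mul, norm_smul, norm_inv, norm_inv, Complex.norm_real]
  ring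

/-- Duhamel's formula for the unitary transform. -/
lemma duhamel_fourierHat {β σ lam : ℝ} (hlam : 0 < lam) {Tstar : EReal}
    {ψ₀ : FormDomain lam} {ψ : ℝ → FormDomain lam} (hψ : IsSolution β σ Tstar ψ₀ ψ)
    {T : ℝ} (hT : 0 ≤ T) (hI : Set.Icc 0 T ⊆ timeInterval Tstar) {f : ℝ → ℂ} (hf : Continuous f)
    (hfq : ∀ s ∈ Set.Icc 0 T, f s = (ψ s).charge) :
    ∀ᵐ k : Plane, Complex.exp (Complex.I * ((‖k‖ ^ 2 : ℝ) : ℂ) * T) * fourierHat (ψ T).toL2 k =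
      fourierHat (ψ 0).toL2 k +
        Complex.I * ((Real.pi⁻¹ / 2 : ℝ) : ℂ) * oscInt f 0 T (‖k‖ ^ 2) := by
  filter_upwards [coeFn_fourierHat (ψ T).toL2, coeFn_fourierHat (ψ 0).toL2,
    ae_smul (duhamel hlam hψ hT hI hf hfq) (c := (2 * Real.pi)⁻¹) (by positivity)] with k h1 h2 h3
  rw [freq_smul] at h3
  rw [h1, h2, mul_left_comm, h3]
  push_cast
  ring

/-- If the Fourier transform of `f` has a square integrable gradient then `f` has a finite moment
of inertia, by Plancherel's theorem. -/
lemma exists_weakGradient_fourierHat {f : L2} {N : Plane → ℂ} {N' : Fin 2 → Plane → ℂ}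
    (hf : fourierHat f =ᵐ[volume] N) (hN' : ∀ j, MemLp (N' j) 2 volume)
    (hd : ∀ j k, HasLineDerivAt ℝ N (N' j k) k (basisVec j)) :
    (∃ g : Fin 2 → L2, IsWeakGradient (fourierHat f) g ∧ ∀ j, g j =ᵐ[volume] N' j) ∧
      Integrable (fun x : Plane => ‖x‖ ^ 2 * ‖f x‖ ^ 2) ∧
      momentOfInertia f = ∫ k, ∑ j : Fin 2, ‖N' j k‖ ^ 2 := by
  refine ⟨⟨fun j => (hN' j).toLp _, fun j => lineDeriv_eq_of_hasLineDerivAt hf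
    (MemLp.coeFn_toLp _) (hd j), fun j => MemLp.coeFn_toLp _⟩, ?_⟩
  have hc0 : (0 : ℝ) < 2 * Real.pi := by positivity
  set c : ℝ := 2 * Real.pi with hc
  have hF : (𝓕 f : L2) =ᵐ[volume] fun ξ => (c : ℂ) * N (c • ξ) := by
    filter_upwards [ae_smul hf hc0.ne', ae_smul (coeFn_fourierHat f) hc0.ne'] with ξ h1 h2
    rw [← h1, h2, inv_smul_smul₀ hc0.ne', mul_inv_cancel_left₀]
    exact_mod_cast hc0.ne'
  have hmem : ∀ j, MemLp (fun ξ : Plane => (c : ℂ) ^ 2 * N' j (c • ξ)) 2 volume := fun j => by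
    have hmap := Measure.map_addHaar_smul (volume : Measure Plane) hc0.ne'
    have h2 : MemLp (N' j) 2 (Measure.map (fun k : Plane => c • k) volume) := by
      rw [hmap]
      exact (hN' j).smul_measure ENNReal.ofReal_ne_top
    exact (h2.comp_of_map (measurable_const_smul _).aemeasurable).const_mul _
  have hline : ∀ j ξ, HasLineDerivAt ℝ (fun ξ : Plane => (c : ℂ) * N (c • ξ))
      ((c : ℂ) ^ 2 * N' j (c • ξ)) ξ (basisVec j) := by
    intro j ξ
    have h1 := hd j (c • ξ)
    rw [HasLineDerivAt] at h1 ⊢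
    have h2 : HasDerivAt (fun t : ℝ => c * t) c 0 := by
      simpa using (hasDerivAt_id (0 : ℝ)).const_mul c
    have h3 := HasDerivAt.scomp (g₁ := fun t : ℝ => N (c • ξ + t • basisVec j))
      (h := fun t : ℝ => c * t) (0 : ℝ) (by rw [mul_zero]; exact h1) h2
    have h4 := h3.const_mul (c : ℂ)
    convert! h4 using 1
    · ext t
      simp only [Function.comp_apply, smul_add, smul_smul]
    · rw [Complex.real_smul]; ring
  set G : Fin 2 → L2 := fun j => (hmem j).toLp _ with hG
  have hmul : ∀ j, (𝓕⁻ (G j) : L2) =ᵐ[volume]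
      fun x => -(2 * Real.pi * Complex.I) * (x j : ℂ) * f x := fun j =>
    (lineDeriv_fourier_eq_iff f (G j) j).1
      (lineDeriv_eq_of_hasLineDerivAt hF (MemLp.coeFn_toLp (hmem j)) (hline j))
  have hnorm : ∀ j, (fun x => ‖(𝓕⁻ (G j) : L2) x‖ ^ 2) =ᵐ[volume]
      fun x => c ^ 2 * (x j ^ 2 * ‖f x‖ ^ 2) := fun j => by
    filter_upwards [hmul j] with x hx
    have hcoef : ‖2 * (Real.pi : ℂ) * Complex.I‖ = c := by
      rw [norm_mul, norm_mul, Complex.norm_I, Complex.norm_real,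
        Real.norm_of_nonneg Real.pi_pos.le, hc]
      simp
    rw [hx, norm_mul, norm_mul, norm_neg, hcoef, Complex.norm_real, Real.norm_eq_abs, mul_pow,
      mul_pow, sq_abs]
    ring
  have hint : ∀ j, Integrable fun x : Plane => x j ^ 2 * ‖f x‖ ^ 2 := fun j => by
    have := ((integrable_norm_sq (𝓕⁻ (G j) : L2)).congr (hnorm j)).const_mul (c ^ 2)⁻¹
    refine this.congr (Eventually.of_forall fun x => ?_)
    simp only
    rw [inv_mul_cancel_left₀ (by positivity)]
  have hval : ∀ j, ∫ x : Plane, x j ^ 2 * ‖f x‖ ^ 2 = ∫ k, ‖N' j k‖ ^ 2 := fun j => by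
    have e1 : ‖(𝓕⁻ (G j) : L2)‖ = ‖G j‖ := by
      rw [← Lp.norm_fourier_eq, FourierTransform.fourier_fourierInv_eq]
    have e2 := norm_sq_eq_integral (𝓕⁻ (G j) : L2)
    rw [integral_congr_ae (hnorm j), integral_const_mul, e1, norm_sq_eq_integral] at e2
    have e3 : (fun ξ => ‖G j ξ‖ ^ 2) =ᵐ[volume] fun ξ => c ^ 4 * ‖N' j (c • ξ)‖ ^ 2 := by
      filter_upwards [MemLp.coeFn_toLp (hmem j)] with ξ hξ
      rw [hG, hξ, norm_mul, norm_pow, Complex.norm_real, Real.norm_of_nonneg hc0.le]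
      ring
    rw [integral_congr_ae e3, integral_const_mul,
      Measure.integral_comp_smul volume (fun k => ‖N' j k‖ ^ 2) c] at e2
    have hfin : Module.finrank ℝ Plane = 2 := by simp
    rw [hfin, abs_of_pos (by positivity), smul_eq_mul] at e2
    have e4 : c ^ 4 * ((c ^ 2)⁻¹ * ∫ k, ‖N' j k‖ ^ 2) = c ^ 2 * ∫ k, ‖N' j k‖ ^ 2 := by
      field_simp
    rw [e4] at e2
    exact (mul_left_cancel₀ (by positivity) e2).symm
  have hsum : ∀ x : Plane, ‖x‖ ^ 2 * ‖f x‖ ^ 2 = x 0 ^ 2 * ‖f x‖ ^ 2 + x 1 ^ 2 * ‖f x‖ ^ 2 :=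
    fun x => by rw [norm_sq_eq_sum]; ring
  constructor
  · simp only [hsum]
    exact (hint 0).add (hint 1)
  · have hsq : ∀ j, Integrable fun k => ‖N' j k‖ ^ 2 := fun j =>
      (memLp_two_iff_integrable_sq_norm (hN' j).1).1 (hN' j)
    rw [momentOfInertia]
    simp only [hsum, Fin.sum_univ_two]
    rw [integral_add (hint 0) (hint 1), integral_add (hsq 0) (hsq 1), hval, hval]

/-! ### The profile of a solution -/

lemma hasLineDerivAt_radial {h : ℝ → ℂ} {h' : ℂ} {k : Plane} (hd : HasDerivAt h h' (‖k‖ ^ 2))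
    (j : Fin 2) :
    HasLineDerivAt ℝ (fun k : Plane => h (‖k‖ ^ 2)) (2 * (k j : ℂ) * h') k (basisVec j) := by
  have he : ‖basisVec j‖ = 1 := by simp [basisVec]
  have e : ∀ t : ℝ, ‖k + t • basisVec j‖ ^ 2 = ‖k‖ ^ 2 + 2 * k j * t + t ^ 2 := fun t => by
    rw [norm_add_sq_real, inner_smul_right, basisVec_inner, norm_smul, he, mul_one,
      Real.norm_eq_abs, sq_abs]
    ring
  rw [HasLineDerivAt]
  simp only [e]
  have h2 : HasDerivAt (fun t : ℝ => ‖k‖ ^ 2 + 2 * k j * t + t ^ 2) (2 * k j) 0 := by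
    have := (((hasDerivAt_id (0 : ℝ)).const_mul (2 * k j)).const_add (‖k‖ ^ 2)).fun_add
      ((hasDerivAt_id (0 : ℝ)).fun_pow 2)
    simpa using this
  have h3 := HasDerivAt.scomp (g₁ := h)
    (h := fun t : ℝ => ‖k‖ ^ 2 + 2 * k j * t + t ^ 2) (0 : ℝ) (by simpa using hd) h2
  convert! h3 using 1
  rw [Complex.real_smul]
  push_cast
  ring

lemma IsDecayingProfile.hasLineDerivAt_state {n : Plane → ℂ} {n' : Fin 2 → Plane → ℂ} {C : ℝ}
    (hn : IsDecayingProfile n n' C) {f : ℝ → ℂ} (hf : Continuous f) (a t : ℝ) (j : Fin 2)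
    (k : Plane) :
    HasLineDerivAt ℝ (fun k : Plane => Complex.exp (-(Complex.I * ((‖k‖ ^ 2 : ℝ) : ℂ) * t)) *
        (n k + Complex.I * ((Real.pi⁻¹ / 2 : ℝ) : ℂ) * oscInt f a t (‖k‖ ^ 2)))
      (Complex.exp (-(Complex.I * ((‖k‖ ^ 2 : ℝ) : ℂ) * t)) * fullGrad n n' f a t j k) k
      (basisVec j) := by
  have h1 : HasDerivAt (fun u : ℝ => Complex.exp (-(Complex.I * (u : ℂ) * t)))
      (Complex.exp (-(Complex.I * ((‖k‖ ^ 2 : ℝ) : ℂ) * t)) * -(Complex.I * t)) (‖k‖ ^ 2) := by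
    have h0 : HasDerivAt (fun v : ℝ => -(Complex.I * (v : ℂ) * t)) (-(Complex.I * t))
        (‖k‖ ^ 2) := by
      simpa using (((Complex.ofRealCLM.hasDerivAt (x := ‖k‖ ^ 2)).const_mul Complex.I).mul_const
        (t : ℂ)).fun_neg
    exact h0.cexp
  have h2 := hasLineDerivAt_radial h1 j
  have h3 := hasLineDerivAt_radial (hasDerivAt_exp_mul_oscInt hf a t (‖k‖ ^ 2)) j
  have h4 := hn.hasLineDerivAt j k
  rw [HasLineDerivAt] at h2 h3 h4 ⊢
  have h5 := (h2.fun_mul h4).fun_add (h3.const_mul (Complex.I * ((Real.pi⁻¹ / 2 : ℝ) : ℂ)))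
  convert! h5 using 1
  · ext s; ring
  · simp only [zero_smul, add_zero, fullGrad, freeGrad]
    push_cast
    linear_combination (Complex.exp (-(Complex.I * (‖k‖ : ℂ) ^ 2 * t)) * (Real.pi : ℂ)⁻¹ *
      (k j : ℂ) * rampInt f a t (‖k‖ ^ 2)) * Complex.I_sq

lemma exists_schwartz_decay (Φ : 𝓢(Plane, ℂ)) :
    ∃ C, 0 ≤ C ∧ ∀ k, ‖Φ k‖ ≤ C * ((1 + ‖k‖ ^ 2)⁻¹) ^ 3 := by
  have h := fun k => SchwartzMap.one_add_le_sup_seminorm_apply (𝕜 := ℂ) (m := (6, 0)) (k := 6)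
    (n := 0) le_rfl le_rfl Φ k
  simp only [norm_iteratedFDeriv_zero] at h
  set C := 2 ^ 6 * ((Finset.Iic (6, 0)).sup fun m => SchwartzMap.seminorm ℂ m.1 m.2) Φ
  have hC : 0 ≤ C := (by positivity : (0 : ℝ) ≤ (1 + ‖(0 : Plane)‖) ^ 6 * ‖Φ 0‖).trans (h 0)
  refine ⟨C, hC, fun k => ?_⟩
  rw [inv_pow, ← div_eq_mul_inv, le_div_iff₀ (by positivity), mul_comm]
  refine le_trans ?_ (h k)
  have : (1 + ‖k‖ ^ 2) ≤ (1 + ‖k‖) ^ 2 := by nlinarith [norm_nonneg k]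
  calc (1 + ‖k‖ ^ 2) ^ 3 * ‖Φ k‖ ≤ ((1 + ‖k‖) ^ 2) ^ 3 * ‖Φ k‖ := by gcongr
    _ = (1 + ‖k‖) ^ 6 * ‖Φ k‖ := by ring

lemma exists_schwartz_fourierHat {g : L2} {φ : 𝓢(Plane, ℂ)} (h : g =ᵐ[volume] φ) :
    ∃ Φ : 𝓢(Plane, ℂ), fourierHat g =ᵐ[volume] Φ := by
  have hc : (2 * Real.pi)⁻¹ ≠ 0 := by positivity
  have hg : g = φ.toLp 2 := Lp.ext (h.trans (φ.coeFn_toLp 2 volume).symm)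
  have hF : (𝓕 g : L2) =ᵐ[volume] (𝓕 φ : 𝓢(Plane, ℂ)) := by
    rw [hg, SchwartzMap.toLp_fourier_eq]
    exact SchwartzMap.coeFn_toLp _ 2 volume
  refine ⟨((2 * Real.pi : ℝ) : ℂ)⁻¹ • SchwartzMap.compCLMOfContinuousLinearEquiv ℂ
    (LinearEquiv.smulOfNeZero ℝ Plane _ hc).toContinuousLinearEquiv (𝓕 φ : 𝓢(Plane, ℂ)), ?_⟩
  filter_upwards [coeFn_fourierHat g, ae_smul hF hc] with k h1 h2
  rw [h1, h2]
  rfl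

/-- The profile of a solution: a Schwartz function plus a rapidly decaying remnant of the Fourier
transform of the Green function. -/
lemma isDecayingProfile_add_tail {lam : ℝ} (hlam : 0 < lam) (Φ : 𝓢(Plane, ℂ)) (q : ℂ) :
    ∃ (n' : Fin 2 → Plane → ℂ) (C : ℝ),
      IsDecayingProfile (fun k => Φ k + q * tailSymbol (‖k‖ ^ 2 + lam)) n' C := by
  set c := min 1 lam with hc
  have hc0 : 0 < c := lt_min one_pos hlam
  have hv : ∀ k : Plane, c * (1 + ‖k‖ ^ 2) ≤ |‖k‖ ^ 2 + lam| := fun k => by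
    rw [abs_of_pos (by positivity)]
    have h1 : c ≤ 1 := min_le_left _ _
    have h2 : c ≤ lam := min_le_right _ _
    nlinarith [sq_nonneg ‖k‖]
  have hv0 : ∀ k : Plane, ‖k‖ ^ 2 + lam ≠ 0 := fun k => by positivity
  have hv0' : ∀ k : Plane, ((‖k‖ ^ 2 + lam : ℝ) : ℂ) ≠ 0 := fun k => by exact_mod_cast hv0 k
  obtain ⟨C₀, hC₀, h₀⟩ := exists_schwartz_decay Φ
  choose C₁ hC₁ h₁ using fun j : Fin 2 => exists_schwartz_decay (∂_{basisVec j} Φ)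
  have hB : 0 ≤ tailBound c := by unfold tailBound; positivity
  refine ⟨fun j k => (∂_{basisVec j} Φ : 𝓢(Plane, ℂ)) k +
    q * (2 * (k j : ℂ) * tailSymbolDeriv (‖k‖ ^ 2 + lam)),
    C₀ + C₁ 0 + C₁ 1 + 2 * (‖q‖ * tailBound c), ?_, ?_, ?_, ?_, ?_⟩
  · refine Φ.continuous.add (continuous_const.mul ?_)
    unfold tailSymbol
    have := fun k => pow_ne_zero 3 (hv0' k)
    have := fun k => pow_ne_zero 4 (hv0' k)
    fun_prop (disch := assumption)
  · intro j
    refine (∂_{basisVec j} Φ : 𝓢(Plane, ℂ)).continuous.add (continuous_const.mul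
      (Continuous.mul (by fun_prop) ?_))
    unfold tailSymbolDeriv
    have := fun k => pow_ne_zero 3 (hv0' k)
    have := fun k => pow_ne_zero 4 (hv0' k)
    have := fun k => pow_ne_zero 5 (hv0' k)
    fun_prop (disch := assumption)
  · intro j k
    have h1 : HasLineDerivAt ℝ Φ ((∂_{basisVec j} Φ : 𝓢(Plane, ℂ)) k) k (basisVec j) := by
      rw [SchwartzMap.lineDerivOp_apply]
      exact (Φ.differentiableAt.lineDifferentiableAt).hasLineDerivAt
    have h2 := hasLineDerivAt_radial (k := k) (h := fun u => tailSymbol (u + lam))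
      ((hasDerivAt_tailSymbol (hv0 k)).comp_add_const (‖k‖ ^ 2) lam) j
    rw [HasLineDerivAt] at h1 h2 ⊢
    exact h1.fun_add (h2.const_mul q)
  · intro k
    have ht := norm_tailSymbol_le hc0 (sq_nonneg ‖k‖) (hv k)
    have hw : 0 ≤ ((1 + ‖k‖ ^ 2)⁻¹) ^ 3 := by positivity
    have := hC₁ 0
    have := hC₁ 1
    calc ‖Φ k + q * tailSymbol (‖k‖ ^ 2 + lam)‖
        ≤ C₀ * ((1 + ‖k‖ ^ 2)⁻¹) ^ 3 + ‖q‖ * (tailBound c * ((1 + ‖k‖ ^ 2)⁻¹) ^ 3) := by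
          refine (norm_add_le _ _).trans (add_le_add (h₀ k) ?_)
          rw [norm_mul]
          gcongr
      _ = (C₀ + ‖q‖ * tailBound c) * ((1 + ‖k‖ ^ 2)⁻¹) ^ 3 := by ring
      _ ≤ _ := by
          refine mul_le_mul_of_nonneg_right ?_ hw
          have : 0 ≤ ‖q‖ * tailBound c := by positivity
          linarith
  · intro j k
    have ht := norm_tailSymbolDeriv_le hc0 (sq_nonneg ‖k‖) (hv k)
    have hw : 0 ≤ ((1 + ‖k‖ ^ 2)⁻¹) ^ 3 := by positivity
    have h0 := hC₁ 0
    have h1 := hC₁ 1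
    have hj : C₁ j ≤ C₀ + C₁ 0 + C₁ 1 := by fin_cases j <;> simp <;> linarith
    have hk := norm_nonneg k
    calc ‖(∂_{basisVec j} Φ : 𝓢(Plane, ℂ)) k +
          q * (2 * (k j : ℂ) * tailSymbolDeriv (‖k‖ ^ 2 + lam))‖
        ≤ C₁ j * ((1 + ‖k‖ ^ 2)⁻¹) ^ 3 +
          ‖q‖ * (2 * ‖k‖ * (tailBound c * ((1 + ‖k‖ ^ 2)⁻¹) ^ 3)) := by
          refine (norm_add_le _ _).trans (add_le_add (h₁ j k) ?_)
          rw [norm_mul, norm_mul, norm_mul, Complex.norm_real, Real.norm_eq_abs,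
            RCLike.norm_ofNat]
          gcongr
          exact abs_coord_le_norm k j
      _ = (C₁ j + 2 * (‖q‖ * tailBound c) * ‖k‖) * ((1 + ‖k‖ ^ 2)⁻¹) ^ 3 := by ring
      _ ≤ _ := by
          refine mul_le_mul_of_nonneg_right ?_ hw
          have : 0 ≤ ‖q‖ * tailBound c := by positivity
          nlinarith

/-- On a compact time interval a solution is `e^{-i|k|²t}` times a decaying profile plus an
oscillatory integral of a continuous function.  That `ψ_t` belongs to `V`, at the intermediate times
and at the final one, provides the two integrability statements. -/
lemma exists_profile {β σ lam : ℝ} (hlam : 0 < lam) {Tstar : EReal} {ψ₀ : FormDomain lam}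
    (hψ₀ : IsSchwartzDatum ψ₀) {ψ : ℝ → FormDomain lam} (hψ : IsSolution β σ Tstar ψ₀ ψ) {T : ℝ}
    (hT : T ∈ timeInterval Tstar) :
    ∃ (n : Plane → ℂ) (n' : Fin 2 → Plane → ℂ) (C : ℝ) (f : ℝ → ℂ),
      IsDecayingProfile n n' C ∧ Continuous f ∧
      (∀ t ∈ Set.Icc 0 T, fourierHat (ψ t).toL2 =ᵐ[volume] fun k =>
        Complex.exp (-(Complex.I * ((‖k‖ ^ 2 : ℝ) : ℂ) * t)) *
          (n k + Complex.I * ((Real.pi⁻¹ / 2 : ℝ) : ℂ) * oscInt f (-1) t (‖k‖ ^ 2))) ∧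
      (∀ t ∈ Set.Icc 0 T, IntegrableOn (fun u : ℝ => u * ‖oscInt f (-1) t u +
        Complex.I * (ψ t).charge * Complex.exp (Complex.I * u * t) / (u + lam)‖ ^ 2)
        (Set.Ioi 0)) ∧
      IntegrableOn (fun u => u * ‖oscInt f (-1) (T + 1) u‖ ^ 2) (Set.Ioi 0) := by
  have hT0 : 0 ≤ T := hT.1
  have hI : Set.Icc 0 T ⊆ timeInterval Tstar := fun s hs =>
    ⟨hs.1, lt_of_le_of_lt (EReal.coe_le_coe_iff.2 hs.2) hT.2⟩
  set q : ℝ → ℂ := fun t => (ψ t).charge with hq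
  set f := extendCharge lam T q with hf
  have hfc : Continuous f := continuous_extendCharge hT0 (hψ.continuousOn_charge.mono hI)
  obtain ⟨φ, hφ⟩ := hψ₀
  obtain ⟨Φ, hΦ⟩ := exists_schwartz_fourierHat (g := ψ₀.reg.toL2) hφ
  obtain ⟨n', C, hn⟩ := isDecayingProfile_add_tail hlam Φ (q 0 * ((Real.pi⁻¹ / 2 : ℝ) : ℂ))
  set n : Plane → ℂ := fun k => Φ k +
    q 0 * ((Real.pi⁻¹ / 2 : ℝ) : ℂ) * tailSymbol (‖k‖ ^ 2 + lam) with hndef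
  have hq0 : ψ₀.charge = q 0 := (FormDomain.charge_eq hlam hψ.initial).symm
  -- the slowly decaying `q(0) / (|k|² + lam)` in `ψ̂_0` cancels against the integral over `[-1, 0]`
  have hstate : ∀ t ∈ Set.Icc 0 T, ∀ᵐ k : Plane,
      Complex.exp (Complex.I * ((‖k‖ ^ 2 : ℝ) : ℂ) * t) * fourierHat (ψ t).toL2 k =
        n k + Complex.I * ((Real.pi⁻¹ / 2 : ℝ) : ℂ) * oscInt f (-1) t (‖k‖ ^ 2) := by
    intro t ht
    have h0 := ψ₀.fourierHat_toL2 hlam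
    rw [← hψ.initial, hq0] at h0
    filter_upwards [duhamel_fourierHat hlam hψ ht.1 ((Set.Icc_subset_Icc_right ht.2).trans hI) hfc
      (fun s hs => extendCharge_of_mem ⟨hs.1, hs.2.trans ht.2⟩), h0, hΦ] with k h1 h2 h3
    have hv : ‖k‖ ^ 2 + lam ≠ 0 := by positivity
    have hv' : ((‖k‖ ^ 2 + lam : ℝ) : ℂ) ≠ 0 := by exact_mod_cast hv
    have hadd := oscInt_add_adjacent hfc (-1) 0 t (‖k‖ ^ 2)
    rw [hf, oscInt_extendCharge_left hT0 q hv, ← hf] at hadd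
    rw [h1, h2, h3, ← hadd, hndef]
    simp only
    linear_combination (q 0 * ((Real.pi⁻¹ / 2 : ℝ) : ℂ) * (1 / ((‖k‖ ^ 2 + lam : ℝ) : ℂ) -
      tailSymbol (‖k‖ ^ 2 + lam))) * Complex.I_sq
  have hn2 : Integrable fun k : Plane => ‖k‖ ^ 2 * ‖n k‖ ^ 2 := by
    refine (integrable_weight_sq.const_mul (C ^ 2)).mono'
      (Continuous.aestronglyMeasurable (by have := hn.continuous; fun_prop))
      (Eventually.of_forall fun k => ?_)
    obtain ⟨hw0, hw1, -⟩ := weight_bounds k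
    have hb := hn.norm_le k
    have hkw : ‖k‖ ^ 2 * (1 + ‖k‖ ^ 2)⁻¹ ≤ 1 := by
      rw [← div_eq_mul_inv, div_le_one (by positivity)]
      linarith
    rw [Real.norm_of_nonneg (by positivity)]
    set w := (1 + ‖k‖ ^ 2)⁻¹
    have hw3 : w ^ 3 ≤ 1 := pow_le_one₀ hw0 hw1
    calc ‖k‖ ^ 2 * ‖n k‖ ^ 2 ≤ ‖k‖ ^ 2 * (C * w ^ 3) ^ 2 := by gcongr
      _ = C ^ 2 * w ^ 2 * ((‖k‖ ^ 2 * w) * w ^ 3) := by ring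
      _ ≤ C ^ 2 * w ^ 2 * (1 * 1) := by gcongr
      _ = C ^ 2 * w ^ 2 := by ring
  -- up to `n`, the integrand is the Fourier transform of the regular part, which lies in `H¹`
  have hcD : ∀ t : ℝ, Measurable fun u : ℝ => oscInt f (-1) t u +
      Complex.I * (ψ t).charge * Complex.exp (Complex.I * u * t) / (u + lam) := fun t => by
    have := (continuous_oscInt_freq hfc (-1) t).measurable
    fun_prop
  have hD : ∀ t ∈ Set.Icc 0 T, IntegrableOn (fun u : ℝ => u * ‖oscInt f (-1) t u +
      Complex.I * (ψ t).charge * Complex.exp (Complex.I * u * t) / (u + lam)‖ ^ 2)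
      (Set.Ioi 0) := by
    intro t ht
    have hm : Measurable fun u : ℝ => u * ‖oscInt f (-1) t u +
      Complex.I * (ψ t).charge * Complex.exp (Complex.I * u * t) / (u + lam)‖ ^ 2 :=
      measurable_id.mul ((hcD t).norm.pow_const 2)
    refine (integrable_radial_iff hm.aestronglyMeasurable).1 ?_
    refine ((((ψ t).reg.integrable_fourierHat.add hn2).const_mul 2).const_mul
      ((Real.pi⁻¹ / 2) ^ 2)⁻¹).mono' (hm.comp measurable_norm_sq).aestronglyMeasurable ?_
    filter_upwards [hstate t ht, (ψ t).fourierHat_toL2 hlam] with k h1 h2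
    have hv' : ((‖k‖ ^ 2 : ℝ) : ℂ) + lam ≠ 0 := by
      rw [← Complex.ofReal_add]
      exact_mod_cast (by positivity : ‖k‖ ^ 2 + lam ≠ 0)
    set D : ℂ := oscInt f (-1) t (‖k‖ ^ 2) + Complex.I * (ψ t).charge *
      Complex.exp (Complex.I * ((‖k‖ ^ 2 : ℝ) : ℂ) * t) / (((‖k‖ ^ 2 : ℝ) : ℂ) + lam) with hDdef
    have e : Complex.I * ((Real.pi⁻¹ / 2 : ℝ) : ℂ) * D =
        Complex.exp (Complex.I * ((‖k‖ ^ 2 : ℝ) : ℂ) * t) * fourierHat (ψ t).reg.toL2 k - n k := by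
      rw [h2, Complex.ofReal_add] at h1
      rw [hDdef]
      linear_combination (-1 : ℂ) * h1 + ((Real.pi⁻¹ / 2 : ℝ) : ℂ) * ((ψ t).charge *
        Complex.exp (Complex.I * ((‖k‖ ^ 2 : ℝ) : ℂ) * t) / (((‖k‖ ^ 2 : ℝ) : ℂ) + lam)) *
        Complex.I_sq
    have e2 : (Real.pi⁻¹ / 2) ^ 2 * ‖D‖ ^ 2 ≤
        2 * (‖fourierHat (ψ t).reg.toL2 k‖ ^ 2 + ‖n k‖ ^ 2) := by
      have h3 := congrArg norm e
      rw [norm_mul, norm_mul, Complex.norm_I, one_mul, Complex.norm_real,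
        Real.norm_of_nonneg (by positivity)] at h3
      rw [← mul_pow, h3]
      have h4 := norm_sub_le
        (Complex.exp (Complex.I * ((‖k‖ ^ 2 : ℝ) : ℂ) * t) * fourierHat (ψ t).reg.toL2 k) (n k)
      rw [norm_mul, norm_exp_I_mul_mul, one_mul] at h4
      refine (pow_le_pow_left₀ (norm_nonneg _) h4 2).trans ?_
      nlinarith [sq_nonneg (‖fourierHat (ψ t).reg.toL2 k‖ - ‖n k‖)]
    rw [Real.norm_of_nonneg (by positivity), le_inv_mul_iff₀ (by positivity)]
    calc (Real.pi⁻¹ / 2) ^ 2 * (‖k‖ ^ 2 * ‖D‖ ^ 2) = ‖k‖ ^ 2 * ((Real.pi⁻¹ / 2) ^ 2 * ‖D‖ ^ 2) := by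
          ring
      _ ≤ ‖k‖ ^ 2 * (2 * (‖fourierHat (ψ t).reg.toL2 k‖ ^ 2 + ‖n k‖ ^ 2)) := by gcongr
      _ = _ := by simp only [Pi.add_apply]; ring
  refine ⟨n, n', C, f, hn, hfc, fun t ht => ?_, hD, ?_⟩
  · filter_upwards [hstate t ht] with k hk
    rw [← hk, ← mul_assoc, ← Complex.exp_add]
    simp
  · -- the integral over `[T, T + 1]` supplies the end point term at `T` up to a rapid decay
    set c := min 1 lam with hc
    have hc0 : 0 < c := lt_min one_pos hlam
    have hB : 0 ≤ tailBound c := by unfold tailBound; positivity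
    have hwm : Measurable fun u : ℝ => ((1 + u)⁻¹) ^ 2 := by fun_prop
    have hw := (integrable_radial_iff (h := fun u : ℝ => ((1 + u)⁻¹) ^ 2)
      hwm.aestronglyMeasurable).1 integrable_weight_sq
    have hco := continuous_oscInt_freq hfc (-1) (T + 1)
    refine (((hD T ⟨hT0, le_rfl⟩).add (hw.const_mul ((‖q T‖ * tailBound c) ^ 2))).const_mul
      2).mono' (Continuous.aestronglyMeasurable (by fun_prop)) ?_
    filter_upwards [ae_restrict_mem measurableSet_Ioi] with u hu
    have hu : 0 < u := hu
    have hv : u + lam ≠ 0 := by positivity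
    have hvb : c * (1 + u) ≤ |-(u + lam)| := by
      rw [abs_neg, abs_of_pos (by positivity)]
      have h1 : c ≤ 1 := min_le_left _ _
      have h2 : c ≤ lam := min_le_right _ _
      nlinarith
    have htail := norm_tailSymbol_le hc0 hu.le hvb
    have hadd := oscInt_add_adjacent hfc (-1) T (T + 1) u
    rw [hf, oscInt_extendCharge_right hT0 q hv, ← hf, Complex.ofReal_add] at hadd
    set D : ℂ := oscInt f (-1) T u + Complex.I * (ψ T).charge *
      Complex.exp (Complex.I * u * T) / (u + lam) with hDdef
    have e : oscInt f (-1) (T + 1) u =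
        D + q T * Complex.exp (Complex.I * u * T) * (Complex.I * tailSymbol (-(u + lam))) := by
      rw [← hadd, hDdef]
      ring
    have hnorm : ‖oscInt f (-1) (T + 1) u‖ ≤ ‖D‖ + ‖q T‖ * tailBound c * ((1 + u)⁻¹) ^ 3 := by
      rw [e]
      refine (norm_add_le _ _).trans (add_le_add le_rfl ?_)
      rw [norm_mul, norm_mul, norm_mul, norm_exp_I_mul_mul, Complex.norm_I, mul_one, one_mul,
        mul_assoc ‖q T‖]
      gcongr
    rw [Real.norm_of_nonneg (by positivity)]
    simp only [Pi.add_apply]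
    have hw0 : 0 ≤ (1 + u)⁻¹ := by positivity
    have hw1 : (1 + u)⁻¹ ≤ 1 := inv_le_one_of_one_le₀ (by linarith)
    have huw : u * (1 + u)⁻¹ ≤ 1 := by
      rw [← div_eq_mul_inv, div_le_one (by positivity)]
      linarith
    set w := (1 + u)⁻¹
    set Q := ‖q T‖ * tailBound c
    have hw3 : w ^ 3 ≤ 1 := pow_le_one₀ hw0 hw1
    have h5 : u * (Q * w ^ 3) ^ 2 ≤ Q ^ 2 * w ^ 2 := by
      calc u * (Q * w ^ 3) ^ 2 = Q ^ 2 * w ^ 2 * ((u * w) * w ^ 3) := by ring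
        _ ≤ Q ^ 2 * w ^ 2 * (1 * 1) := by gcongr
        _ = _ := by ring
    calc u * ‖oscInt f (-1) (T + 1) u‖ ^ 2 ≤ u * (‖D‖ + Q * w ^ 3) ^ 2 := by gcongr
      _ ≤ u * (2 * (‖D‖ ^ 2 + (Q * w ^ 3) ^ 2)) := by
          gcongr
          nlinarith [sq_nonneg (‖D‖ - Q * w ^ 3)]
      _ = 2 * (u * ‖D‖ ^ 2 + u * (Q * w ^ 3) ^ 2) := by ring
      _ ≤ 2 * (u * ‖D‖ ^ 2 + Q ^ 2 * w ^ 2) := by gcongr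

/-- On a compact time interval the moment of inertia coincides with a differentiable function whose
derivative is bounded and given by the improper integral. -/
lemma exists_momentOfInertia_eq {β σ lam : ℝ} (hlam : 0 < lam) {Tstar : EReal}
    {ψ₀ : FormDomain lam} (hψ₀ : IsSchwartzDatum ψ₀) {ψ : ℝ → FormDomain lam}
    (hψ : IsSolution β σ Tstar ψ₀ ψ) {T : ℝ} (hT : T ∈ timeInterval Tstar) :
    ∃ (B : ℝ) (M m : ℝ → ℝ), ∀ t ∈ Set.Icc 0 T,
      Integrable (fun x : Plane => ‖x‖ ^ 2 * ‖(ψ t).toL2 x‖ ^ 2) ∧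
      momentOfInertia (ψ t).toL2 = M t ∧ HasDerivAt M (m t) t ∧ |m t| ≤ B ∧
      ∃ (g : Fin 2 → L2) (J : ℂ), IsWeakGradient (fourierHat (ψ t).toL2) g ∧
        Tendsto (truncatedPairing (fourierHat (ψ t).toL2) g) atTop (𝓝 J) ∧ 4 * J.im = m t := by
  obtain ⟨n, n', C, f, hn, hf, hstate, hD, hE⟩ := exists_profile hlam hψ₀ hψ hT
  have hT0 : 0 ≤ T := hT.1
  have hab : (-1 : ℝ) ≤ T + 1 := by linarith
  obtain ⟨B, ℓ, h⟩ := exists_hasDerivAt_integral_fullGrad hn hf hab hE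
  obtain ⟨_, _, hramp⟩ := exists_hasDerivAt_rampEnergy hf hab hE
  refine ⟨B, fun t => ∫ k, ∑ j : Fin 2, ‖fullGrad n n' f (-1) t j k‖ ^ 2,
    fun t => 4 * (∫ k, regularPairing n n' f (-1) t k).im + Real.pi⁻¹ * (2 * ℓ t),
    fun t ht => ?_⟩
  have htI : t ∈ Set.Ioo (-1) (T + 1) := ⟨by linarith [ht.1], by linarith [ht.2]⟩
  obtain ⟨hmem, hB, hderiv, hint, hℓ⟩ := h t htI
  set e : Plane → ℂ := fun k => Complex.exp (-(Complex.I * ((‖k‖ ^ 2 : ℝ) : ℂ) * t)) with he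
  have hen : ∀ k, ‖e k‖ = 1 := fun k => by
    simp only [he]
    rw [Complex.exp_neg, norm_inv, norm_exp_I_mul_mul, inv_one]
  have hmem' : ∀ j, MemLp (fun k => e k * fullGrad n n' f (-1) t j k) 2 volume := fun j => by
    have hc := hn.continuous_fullGrad hf (-1) t j
    refine (hmem j).mono (Continuous.aestronglyMeasurable (by fun_prop))
      (Eventually.of_forall fun k => ?_)
    rw [norm_mul, hen, one_mul]
  obtain ⟨⟨g, hg, hge⟩, hfin, hM⟩ := exists_weakGradient_fourierHat (hstate t ht) hmem'
    (fun j k => hn.hasLineDerivAt_state hf (-1) t j k)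
  simp only [norm_mul, hen, one_mul] at hM
  obtain ⟨j, hj⟩ := exists_tendsto_intervalIntegral_pairing hf hlam (hramp t htI).1 (hD t ht)
  have hℓj : ℓ t = j.re := tendsto_nhds_unique hℓ (tendsto_rampPairing_of_tendsto hf hab
    ⟨by linarith [htI.1], by linarith [htI.2]⟩ hj)
  refine ⟨hfin, hM, hderiv, hB, g, _, hg, (tendsto_setIntegral_pairing hf hint hj).congr
    fun R => ?_, ?_⟩
  · refine integral_congr_ae (ae_restrict_of_ae ?_)
    filter_upwards [hstate t ht, hge 0, hge 1] with k h1 h2 h3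
    have h4 : e k * starRingEnd ℂ (e k) = 1 := by rw [RCLike.mul_conj, hen]; simp
    rw [h1, Fin.sum_univ_two, Fin.sum_univ_two, h2, h3, map_mul, map_mul]
    linear_combination (-(n k + Complex.I * ((Real.pi⁻¹ / 2 : ℝ) : ℂ) *
      oscInt f (-1) t (‖k‖ ^ 2)) * ((k 0 : ℂ) * starRingEnd ℂ (fullGrad n n' f (-1) t 0 k) +
      (k 1 : ℂ) * starRingEnd ℂ (fullGrad n n' f (-1) t 1 k))) * h4
  · simp only
    rw [hℓj, Complex.add_im, mul_comm Complex.I, mul_assoc, Complex.im_ofReal_mul]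
    simp only [Complex.mul_im, Complex.I_re, Complex.I_im, zero_mul, one_mul, zero_add]
    ring

end PointNLS

end

theorem proposition4p2 (β σ lam : ℝ) (hσ : 1 / 2 ≤ σ) (hlam : 0 < lam) (Tstar : EReal)
    (ψ₀ : PointNLS.FormDomain lam) (hψ₀ : PointNLS.IsSchwartzDatum ψ₀)
    (ψ : ℝ → PointNLS.FormDomain lam) (hψ : PointNLS.IsSolution β σ Tstar ψ₀ ψ) :
    (∀ t ∈ PointNLS.timeInterval Tstar,
      Integrable (fun x : PointNLS.Plane => ‖x‖ ^ 2 * ‖(ψ t).toL2 x‖ ^ 2)) ∧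
    (∀ T ∈ PointNLS.timeInterval Tstar,
      AbsolutelyContinuousOnInterval (fun t => PointNLS.momentOfInertia (ψ t).toL2) 0 T) ∧
    (∀ t ∈ PointNLS.timeInterval Tstar, 0 < t →
      ∃ (g : Fin 2 → PointNLS.L2) (J : ℂ),
        PointNLS.IsWeakGradient (PointNLS.fourierHat (ψ t).toL2) g ∧
        Tendsto (PointNLS.truncatedPairing (PointNLS.fourierHat (ψ t).toL2) g) atTop (𝓝 J) ∧
        HasDerivAt (fun s => PointNLS.momentOfInertia (ψ s).toL2) (4 * J.im) t) := by
  refine ⟨fun t ht => ?_, fun T hT => ?_, fun t ht ht0 => ?_⟩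
  · obtain ⟨B, M, m, h⟩ := PointNLS.exists_momentOfInertia_eq hlam hψ₀ hψ ht
    exact (h t ⟨ht.1, le_rfl⟩).1
  · obtain ⟨B, M, m, h⟩ := PointNLS.exists_momentOfInertia_eq hlam hψ₀ hψ hT
    have hB : 0 ≤ B := (abs_nonneg _).trans (h T ⟨hT.1, le_rfl⟩).2.2.2.1
    have hlip : LipschitzOnWith ⟨B, hB⟩ M (Set.Icc 0 T) :=
      (convex_Icc 0 T).lipschitzOnWith_of_nnnorm_hasDerivWithin_le
        (fun t ht => (h t ht).2.2.1.hasDerivWithinAt) (fun t ht => (h t ht).2.2.2.1)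
    refine LipschitzOnWith.absolutelyContinuousOnInterval (K := ⟨B, hB⟩) ?_
    rw [Set.uIcc_of_le hT.1]
    intro x hx y hy
    simp only [(h x hx).2.1, (h y hy).2.1]
    exact hlip hx hy
  · -- a later time in the interval of existence makes `t` an interior point
    obtain ⟨T, htT, hTs⟩ := EReal.lt_iff_exists_real_btwn.1 ht.2
    have htT : t < T := EReal.coe_lt_coe_iff.1 htT
    obtain ⟨B, M, m, h⟩ := PointNLS.exists_momentOfInertia_eq hlam hψ₀ hψ
      (T := T) ⟨ht0.le.trans htT.le, hTs⟩
    obtain ⟨-, -, hM, -, g, J, hg, hJ, hm⟩ := h t ⟨ht0.le, htT.le⟩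
    refine ⟨g, J, hg, hJ, ?_⟩
    rw [hm]
    refine hM.congr_of_eventuallyEq ?_
    filter_upwards [Ioo_mem_nhds ht0 htT] with s hs
    exact (h s ⟨hs.1.le, hs.2.le⟩).2.1
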